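/- Let $n,m\in\mathbb{N}=\{1,2,\dots\}$, $1\le p<\infty$ and $\sigma>0$, and let $B=\{x\in\mathbb{R}^n:|x|<1\}$ be the open Euclidean unit ball. Let $C_0^m(B)$ be the space of complex-valued $C^m$ functions on $\mathbb{R}^n$ with compact support contained in $B$, and let $E^m_{p,\sigma}(B)$ be the completion of $C_0^m(B)$ in the norm $$\|f\,|\,E^m_{p,\sigma}(B)\|=\Big(\int_B |x|^{mp}(1+|\log|x||)^{\sigma p}\sum_{|\alpha|=m}|D^\alpha f(x)|^p\,dx\Big)^{1/p}.$$ Then the inclusion $C_0^m(B)\subset L_p(B)$ extends to a bounded injective linear operator $\mathrm{id}:E^m_{p,\sigma}(B)\hookrightarrow L_p(B)$ (so that $E^m_{p,\sigma}(B)$ is a space of functions in $L_p(B)$), and this embedding is compact. For $k\in\mathbb{N}$ let $$a_k(\mathrm{id})=\inf\{\|\mathrm{id}-S\|:\ S:E^m_{p,\sigma}(B)\to L_p(B)\text{ bounded and linear},\ \operatorname{rank}S<k\}$$ be its approximation numbers. There are constants $c_1,c_2>0$, depending only on $n,m,p,\sigma$, such that $c_1\,a_k(\mathrm{id})\le\beta_k\le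 c_2\,a_k(\mathrm{id})$, where - $\beta_k=k^{-m/n}$, for all $k\ge1$, if $\sigma>m/n$; - $\beta_k=k^{-m/n}(\log k)^{m/n}$, for all $k\ge2$, if $\sigma=m/n$; - $\beta_k=k^{-\sigma}$, for all $k\ge1$, if $0<\sigma<m/n$. -/

import Mathlib

open MeasureTheory
open scoped NNReal ENNReal Distributions

noncomputable section

/-- The open Euclidean unit ball `B` of `ℝⁿ`. -/
def unitBall (n : ℕ) : TopologicalSpace.Opens (EuclideanSpace ℝ (Fin n)) :=
  ⟨Metric.ball 0 1, Metric.isOpen_ball⟩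

/-- Lebesgue measure on the unit ball. -/
abbrev ballMeasure (n : ℕ) : Measure (EuclideanSpace ℝ (Fin n)) :=
  volume.restrict (unitBall n : Set (EuclideanSpace ℝ (Fin n)))

/-- The space `L_p(B)` of complex-valued functions on the unit ball. -/
abbrev LpBall (n : ℕ) (p : ℝ≥0) : Type :=
  Lp ℂ (p : ℝ≥0∞) (ballMeasure n)

/-- The coordinate directions prescribed by a multi-index `α`: the list in which `e_i` occurs
`α i` times. -/
def multiDirections {n : ℕ} (α : Fin n → ℕ) : List (EuclideanSpace ℝ (Fin n)) :=
  (List.finRange n).flatMap fun i => List.replicate (α i) (EuclideanSpace.single i (1 : ℝ))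

/-- The classical partial derivative `D^α f (x)` of order `|α| = ∑ i, α i`. -/
def multiDeriv {n : ℕ} (α : Fin n → ℕ) (f : EuclideanSpace ℝ (Fin n) → ℂ)
    (x : EuclideanSpace ℝ (Fin n)) : ℂ :=
  iteratedFDeriv ℝ (multiDirections α).length f x (multiDirections α).get

/-- The finite set of multi-indices `α ∈ ℕ₀ⁿ` with `|α| = m`. -/
abbrev multiIndices (n m : ℕ) : Finset (Fin n → ℕ) :=
  Finset.piAntidiag Finset.univ m

/-- The weighted norm
`(∫_B |x|^{mp} (1 + |log |x||)^{σp} ∑_{|α| = m} |D^α f(x)|^p dx)^{1/p}`. -/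
def weightedNorm (n m : ℕ) (p : ℝ≥0) (σ : ℝ) (f : EuclideanSpace ℝ (Fin n) → ℂ) : ℝ :=
  (∫ x in (unitBall n : Set (EuclideanSpace ℝ (Fin n))),
    ‖x‖ ^ ((m : ℝ) * p) * (1 + |Real.log ‖x‖|) ^ (σ * p) *
      ∑ α ∈ multiIndices n m, ‖multiDeriv α f x‖ ^ (p : ℝ)) ^ (1 / (p : ℝ))

/-- The vector space `C_0^m(B)`: complex-valued `C^m` functions on `ℝⁿ` whose support is compact
and contained in `B`. The parameters `p` and `σ` only record which norm it will carry. -/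
def CompactlySupported (n m : ℕ) (_p : ℝ≥0) (_σ : ℝ) : Type :=
  𝓓^{(m : ℕ∞)}(unitBall n, ℂ)

namespace CompactlySupported

variable {n m : ℕ} {p : ℝ≥0} {σ : ℝ}

instance : AddCommGroup (CompactlySupported n m p σ) :=
  inferInstanceAs (AddCommGroup (𝓓^{(m : ℕ∞)}(unitBall n, ℂ)))

instance : Module ℂ (CompactlySupported n m p σ) :=
  inferInstanceAs (Module ℂ (𝓓^{(m : ℕ∞)}(unitBall n, ℂ)))

instance : FunLike (CompactlySupported n m p σ) (EuclideanSpace ℝ (Fin n)) ℂ :=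
  inferInstanceAs (FunLike (𝓓^{(m : ℕ∞)}(unitBall n, ℂ)) (EuclideanSpace ℝ (Fin n)) ℂ)

theorem contDiff (f : CompactlySupported n m p σ) : ContDiff ℝ m f :=
  TestFunction.contDiff (f : 𝓓^{(m : ℕ∞)}(unitBall n, ℂ))

theorem hasCompactSupport (f : CompactlySupported n m p σ) : HasCompactSupport f :=
  TestFunction.hasCompactSupport (f : 𝓓^{(m : ℕ∞)}(unitBall n, ℂ))

theorem coe_add (f g : CompactlySupported n m p σ) : ⇑(f + g) = f + g := rfl

theorem coe_smul (c : ℂ) (f : CompactlySupported n m p σ) : ⇑(c • f) = c • ⇑f := rfl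

end CompactlySupported

theorem multiDirections_length {n : ℕ} (α : Fin n → ℕ) :
    (multiDirections α).length = ∑ i, α i := by
  simp [multiDirections, List.length_flatMap, Fin.sum_univ_def]

theorem multiDirections_length_of_mem {n m : ℕ} {α : Fin n → ℕ} (h : α ∈ multiIndices n m) :
    (multiDirections α).length = m := by
  rw [multiDirections_length]
  exact (Finset.mem_piAntidiag.1 h).1

theorem multiDeriv_add {n m : ℕ} {α : Fin n → ℕ} (h : α ∈ multiIndices n m)
    {f g : EuclideanSpace ℝ (Fin n) → ℂ} (hf : ContDiff ℝ m f) (hg : ContDiff ℝ m g)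
    (x : EuclideanSpace ℝ (Fin n)) :
    multiDeriv α (f + g) x = multiDeriv α f x + multiDeriv α g x := by
  have hm := multiDirections_length_of_mem h
  unfold multiDeriv
  rw [iteratedFDeriv_add_apply (by rw [hm]; exact hf.contDiffAt) (by rw [hm]; exact hg.contDiffAt)]
  rfl

theorem multiDeriv_smul {n m : ℕ} {α : Fin n → ℕ} (h : α ∈ multiIndices n m) (c : ℂ)
    {f : EuclideanSpace ℝ (Fin n) → ℂ} (hf : ContDiff ℝ m f) (x : EuclideanSpace ℝ (Fin n)) :
    multiDeriv α (c • f) x = c * multiDeriv α f x := by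
  have hm := multiDirections_length_of_mem h
  unfold multiDeriv
  rw [iteratedFDeriv_const_smul_apply (by rw [hm]; exact hf.contDiffAt)]
  rfl

theorem continuous_multiDeriv {n m : ℕ} {α : Fin n → ℕ} (h : α ∈ multiIndices n m)
    {f : EuclideanSpace ℝ (Fin n) → ℂ} (hf : ContDiff ℝ m f) : Continuous (multiDeriv α f) := by
  have hm := multiDirections_length_of_mem h
  have := hf.continuous_iteratedFDeriv (m := (multiDirections α).length) (by rw [hm])
  exact (ContinuousMultilinearMap.apply ℝ _ ℂ (multiDirections α).get).continuous.comp this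

theorem exists_bound_multiDeriv {n m : ℕ} {α : Fin n → ℕ} (h : α ∈ multiIndices n m)
    {f : EuclideanSpace ℝ (Fin n) → ℂ} (hf : ContDiff ℝ m f) (hc : HasCompactSupport f) :
    ∃ C, ∀ x, ‖multiDeriv α f x‖ ≤ C := by
  refine (continuous_multiDeriv h hf).bounded_above_of_compact_support ?_
  refine (hc.iteratedFDeriv (𝕜 := ℝ) (multiDirections α).length).mono' ?_
  intro x hx
  apply subset_tsupport
  intro h0
  apply hx
  simp [multiDeriv, h0]

/-- The `p`-th root `|x|^m (1 + |log |x||)^σ` of the weight. -/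
def radialWeight (n m : ℕ) (σ : ℝ) (x : EuclideanSpace ℝ (Fin n)) : ℝ :=
  ‖x‖ ^ m * (1 + |Real.log ‖x‖|) ^ σ

theorem radialWeight_nonneg (n m : ℕ) (σ : ℝ) (x : EuclideanSpace ℝ (Fin n)) :
    0 ≤ radialWeight n m σ x := by
  unfold radialWeight; positivity

theorem exists_bound_radialWeight (n m : ℕ) [NeZero m] (σ : ℝ) :
    ∃ C, ∀ x ∈ (unitBall n : Set (EuclideanSpace ℝ (Fin n))), radialWeight n m σ x ≤ C := by
  have hm : (0 : ℝ) < m := by exact_mod_cast Nat.pos_of_ne_zero (NeZero.ne m)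
  have aux : ∀ τ : ℝ, 0 < τ → ∀ r : ℝ, 0 ≤ r → r < 1 →
      r ^ m * (1 + |Real.log r|) ^ τ ≤ (1 + τ / m) ^ τ := by
    intro τ hτ r hr0 hr1
    have hpos : 0 < (m : ℝ) / τ := div_pos hm hτ
    rcases hr0.eq_or_lt with rfl | hr
    · rw [zero_pow (NeZero.ne m), zero_mul]; positivity
    have h1 : r ^ m = (r ^ ((m : ℝ) / τ)) ^ τ := by
      rw [← Real.rpow_mul hr.le, div_mul_cancel₀ _ hτ.ne', Real.rpow_natCast]
    rw [h1, ← Real.mul_rpow (by positivity) (by positivity)]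
    refine Real.rpow_le_rpow (by positivity) ?_ hτ.le
    have h2 := Real.abs_log_mul_self_rpow_lt r _ hr hr1.le hpos
    rw [abs_mul, abs_of_pos (Real.rpow_pos_of_pos hr _), one_div_div] at h2
    have h3 : r ^ ((m : ℝ) / τ) ≤ 1 := Real.rpow_le_one hr.le hr1.le hpos.le
    nlinarith
  refine ⟨(1 + max σ 1 / m) ^ (max σ 1), fun x hx => ?_⟩
  have hx1 : ‖x‖ < 1 := by simpa [unitBall] using hx
  refine le_trans ?_ (aux (max σ 1) (by positivity) ‖x‖ (norm_nonneg x) hx1)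
  unfold radialWeight
  refine mul_le_mul_of_nonneg_left ?_ (by positivity)
  exact Real.rpow_le_rpow_of_exponent_le (by simp) (le_max_left _ _)

theorem measurable_radialWeight (n m : ℕ) (σ : ℝ) : Measurable (radialWeight n m σ) := by
  unfold radialWeight
  have h : Measurable fun x : EuclideanSpace ℝ (Fin n) => |Real.log ‖x‖| :=
    continuous_abs.measurable.comp (Real.measurable_log.comp measurable_norm)
  exact (measurable_norm.pow_const m).mul ((measurable_const.add h).pow_const σ)

/-- The vector of weighted derivatives `(|x|^m (1 + |log |x||)^σ D^α f(x))_{|α| = m}`, with the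
`ℓ^p` norm on its values. -/
def weightedDerivs (n m : ℕ) (p : ℝ≥0) (σ : ℝ) (f : EuclideanSpace ℝ (Fin n) → ℂ)
    (x : EuclideanSpace ℝ (Fin n)) : PiLp (p : ℝ≥0∞) (fun _ : multiIndices n m => ℂ) :=
  WithLp.toLp p fun α => (radialWeight n m σ x : ℂ) * multiDeriv α.1 f x

section

variable {n m : ℕ} {p : ℝ≥0} [Fact (1 ≤ (p : ℝ≥0∞))] {σ : ℝ}

theorem memLp_weightedDerivs [NeZero m] (f : CompactlySupported n m p σ) :
    MemLp (weightedDerivs n m p σ f) p (ballMeasure n) := by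
  have : IsFiniteMeasure (ballMeasure n) :=
    ⟨by simpa [unitBall] using measure_ball_lt_top⟩
  obtain ⟨C, hC⟩ := exists_bound_radialWeight n m σ
  have hcomp : ∀ α : multiIndices n m,
      MemLp (fun x => (radialWeight n m σ x : ℂ) * multiDeriv α.1 f x) p (ballMeasure n) := by
    intro α
    obtain ⟨D, hD⟩ := exists_bound_multiDeriv α.2 f.contDiff f.hasCompactSupport
    refine MemLp.of_bound ?_ (C * D) ?_
    · exact ((Complex.measurable_ofReal.comp (measurable_radialWeight n m σ)).mul
        (continuous_multiDeriv α.2 f.contDiff).measurable).aestronglyMeasurable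
    · filter_upwards [ae_restrict_mem (unitBall n).isOpen.measurableSet] with x hx
      rw [norm_mul, Complex.norm_real, Real.norm_of_nonneg (radialWeight_nonneg ..)]
      exact mul_le_mul (hC x hx) (hD x) (norm_nonneg _)
        ((radialWeight_nonneg n m σ x).trans (hC x hx))
  exact MemLp.of_eval_piLp hcomp

theorem weightedNorm_eq [NeZero m] (f : CompactlySupported n m p σ) :
    weightedNorm n m p σ f = ‖(memLp_weightedDerivs f).toLp‖ := by
  have hp1 : (1 : ℝ≥0∞) ≤ p := Fact.out
  have hp0 : (p : ℝ≥0∞) ≠ 0 := (zero_lt_one.trans_le hp1).ne'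
  have hpp : 0 < (p : ℝ) := NNReal.coe_pos.2 (pos_iff_ne_zero.2 (by simpa using hp0))
  rw [Lp.norm_toLp, (memLp_weightedDerivs f).eLpNorm_eq_integral_rpow_norm hp0 ENNReal.coe_ne_top,
    ENNReal.toReal_ofReal (by positivity), ENNReal.coe_toReal, ← one_div]
  unfold weightedNorm
  congr 2
  ext x
  rw [PiLp.norm_eq_sum (by simpa using hpp) (weightedDerivs n m p σ f x), ENNReal.coe_toReal, ← Real.rpow_mul
    (by positivity), one_div, inv_mul_cancel₀ hpp.ne', Real.rpow_one, Finset.mul_sum,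
    ← Finset.sum_coe_sort]
  refine Finset.sum_congr rfl fun α _ => ?_
  have h1 : (0 : ℝ) ≤ 1 + |Real.log ‖x‖| := by positivity
  simp only [weightedDerivs]
  rw [norm_mul, Complex.norm_real, Real.norm_of_nonneg (radialWeight_nonneg ..),
    Real.mul_rpow (radialWeight_nonneg ..) (norm_nonneg _), radialWeight,
    Real.mul_rpow (by positivity) (by positivity), ← Real.rpow_mul h1, ← Real.rpow_natCast,
    ← Real.rpow_mul (norm_nonneg x)]

instance : Norm (CompactlySupported n m p σ) := ⟨fun f => weightedNorm n m p σ f⟩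

theorem compactlySupported_core [NeZero m] :
    SeminormedSpace.Core ℂ (CompactlySupported n m p σ) where
  norm_nonneg f := by
    change 0 ≤ weightedNorm n m p σ f
    rw [weightedNorm_eq]
    exact norm_nonneg _
  norm_smul c f := by
    change weightedNorm n m p σ (c • f : CompactlySupported n m p σ) =
      ‖c‖ * weightedNorm n m p σ f
    rw [weightedNorm_eq, weightedNorm_eq, ← norm_smul, ← MemLp.toLp_const_smul]
    congr 2
    ext x α
    simp only [weightedDerivs, CompactlySupported.coe_smul, Pi.smul_apply, PiLp.smul_apply,
      multiDeriv_smul α.2 c f.contDiff, smul_eq_mul]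
    ring
  norm_triangle f g := by
    change weightedNorm n m p σ (f + g : CompactlySupported n m p σ) ≤
      weightedNorm n m p σ f + weightedNorm n m p σ g
    rw [weightedNorm_eq, weightedNorm_eq, weightedNorm_eq]
    refine le_trans (le_of_eq ?_) (norm_add_le _ _)
    rw [← MemLp.toLp_add]
    congr 2
    ext x α
    simp only [weightedDerivs, CompactlySupported.coe_add, Pi.add_apply, PiLp.add_apply,
      multiDeriv_add α.2 f.contDiff g.contDiff]
    ring

/-- `C_0^m(B)` with the norm `weightedNorm n m p σ`. -/
instance [NeZero m] : SeminormedAddCommGroup (CompactlySupported n m p σ) :=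
  SeminormedAddCommGroup.ofCore compactlySupported_core

instance [NeZero m] : NormedSpace ℂ (CompactlySupported n m p σ) where
  norm_smul_le c f := (compactlySupported_core.norm_smul c f).le

/-- The class in `L_p(B)` of a function in `C_0^m(B)`. -/
def CompactlySupported.toLpBall (f : CompactlySupported n m p σ) : LpBall n p :=
  MemLp.toLp (p := (p : ℝ≥0∞)) (μ := ballMeasure n) f
    (f.contDiff.continuous.memLp_of_hasCompactSupport f.hasCompactSupport)

end

/-- The Banach space `E^m_{p,σ}(B)`: the completion of `C_0^m(B)` in the norm
`weightedNorm n m p σ`. -/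
abbrev WeightedSobolev (n m : ℕ) [NeZero m] (p : ℝ≥0) [Fact (1 ≤ (p : ℝ≥0∞))] (σ : ℝ) : Type :=
  UniformSpace.Completion (CompactlySupported n m p σ)

/-- The `k`-th approximation number
`a_k(T) = inf {‖T - S‖ : S a bounded linear operator with rank S < k}` (for `k ≥ 1`). -/
def approximationNumber {X Y : Type} [NormedAddCommGroup X] [NormedSpace ℂ X]
    [NormedAddCommGroup Y] [NormedSpace ℂ Y] (T : X →L[ℂ] Y) (k : ℕ) : ℝ :=
  sInf {r : ℝ | ∃ S : X →L[ℂ] Y, (S : X →ₗ[ℂ] Y).rank < (k : Cardinal) ∧ r = ‖T - S‖}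

/-- `a_k ∼ b_k` for all `k ≥ k₀`: each sequence is bounded by a positive constant times the
other. -/
def EquivalentFrom (k₀ : ℕ) (a b : ℕ → ℝ) : Prop :=
  ∃ c₁ > 0, ∃ c₂ > 0, ∀ k ≥ k₀, c₁ * a k ≤ b k ∧ b k ≤ c₂ * a k

end

/-! Write w(x) = |x|^m (1 + |log |x||)^σ. Two inequalities bound the approximation error from above.
The Hardy inequality `exists_lintegral_logWeight_le` bounds the L_p norm of (1 + |log |x||)^σ f by
the norm of f in E: Taylor's formula based far out on the ray through x, where f vanishes, gives
|f(x)| ≤ ∫_1^∞ |tx|^m |D^m f(tx)| dt/t, and dilating by t costs the logarithm only a factor 1 + log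
t. The Poincaré inequality `lintegral_sub_averagedTaylor_le` approximates f on a convex set of
diameter d by an averaged Taylor polynomial with error at most a constant times d^m |D^m f| in L_p.
Hence, if disjoint convex cells satisfy d^m ≤ ε w and (1 + |log |x||)^σ ≥ 1/ε on the rest of the
ball, piecewise polynomials approximate the embedding up to Cε (`exists_finiteRank_approx`).

On the dyadic shell |x| ≈ 2^(-j) the weight is about 2^(-jm) (1 + j)^σ. A grid with M_j subdivisions
there is fine enough for ε ≈ 1/K when M_j^m (1 + j)^σ ≥ K, and the shells j ≥ J need no cells once
(1 + J)^σ ≥ K. This gives rank at most D ∑_{j<J} M_j^n and error at most C/K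
(`exists_graded_approx`). Conversely, if M_j^m (1 + j)^σ ≤ K, bumps in the cells of the same kind of
grid span a space of dimension at least ∑ M_j^n on which the norm of E is at most CK times the L_p
norm. An operator of smaller rank kills a nonzero element of that space, so its distance to the
embedding is at least c/K (`exists_graded_lower_bound`).

For the upper bounds put K = x^σ, M_j ≈ (x/(1 + j))^(σ/m) and s = σn/m. The rank is of order x^s
∑_{j<x} (1 + j)^(-s), which is bounded by a multiple of x^s, x log x or x according as s > 1, s = 1
or s < 1; solving for x in terms of k gives the three rates. For the lower bounds a single shell
suffices if s > 1, one subdivision in each of k shells if s < 1, and the balanced grid if s = 1.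

Compactness is approximability by operators of finite rank. For injectivity, E embeds isometrically
by its weighted derivatives; away from the origin w is continuous and positive, so integration by
parts shows that these vanish when the image in L_p does. -/

noncomputable section

/-! ### Symmetry of mixed directional derivatives. -/

section MixedDerivatives

variable {V : Type*} [NormedAddCommGroup V] [NormedSpace ℝ V]

/-- The iterated directional derivative along a list of directions. -/
def listDeriv (L : List V) (f : V → ℂ) (x : V) : ℂ :=
  iteratedFDeriv ℝ L.length f x L.get

theorem listDeriv_cons {L : List V} {f : V → ℂ} (a : V)
    (hf : ContDiff ℝ ((L.length + 1 : ℕ)) f) :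
    listDeriv (a :: L) f = fun x => fderiv ℝ (listDeriv L f) x a := by
  ext x
  have h : DifferentiableAt ℝ (iteratedFDeriv ℝ L.length f) x :=
    hf.contDiffAt.differentiableAt_iteratedFDeriv (by exact_mod_cast Nat.lt_succ_self _)
  exact h.iteratedFDeriv_succ_apply_left' (m := (a :: L).get)

theorem contDiff_listDeriv {L : List V} {f : V → ℂ} {k : ℕ}
    (hf : ContDiff ℝ ((L.length + k : ℕ)) f) : ContDiff ℝ k (listDeriv L f) := by
  have h : ContDiff ℝ k (iteratedFDeriv ℝ L.length f) :=
    hf.iteratedFDeriv_right (by rw [add_comm]; norm_cast)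
  exact (ContinuousMultilinearMap.apply ℝ (fun _ : Fin L.length => V) ℂ L.get).contDiff.comp h

/-- The only substantial case is the exchange of two leading directions, which is the symmetry of
the second derivative of the C² function `listDeriv L f`. -/
theorem listDeriv_perm {L L' : List V} (h : L.Perm L') {f : V → ℂ}
    (hf : ContDiff ℝ (L.length : ℕ) f) : listDeriv L f = listDeriv L' f := by
  induction h with
  | nil => rfl
  | @cons a L L' hp ih =>
    have hlen := hp.length_eq
    rw [listDeriv_cons a (by simpa using hf), listDeriv_cons a (by rw [← hlen]; simpa using hf),
      ih (hf.of_le (by simp))]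
  | swap a b L =>
    have h2 : ContDiff ℝ ((L.length + 2 : ℕ)) f := by simpa [add_assoc] using hf
    have h1 : ContDiff ℝ ((L.length + 1 : ℕ)) f := h2.of_le (by norm_cast; omega)
    have hg := contDiff_listDeriv h2
    rw [listDeriv_cons (L := a :: L) b (by simpa [add_assoc] using h2),
      listDeriv_cons (L := b :: L) a (by simpa [add_assoc] using h2), listDeriv_cons a h1,
      listDeriv_cons b h1]
    ext x
    have hd : DifferentiableAt ℝ (fderiv ℝ (listDeriv L f)) x :=
      ((hg.fderiv_right (m := 1) (by norm_num)).differentiable (by norm_num)) x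
    have hs : IsSymmSndFDerivAt ℝ (listDeriv L f) x :=
      hg.contDiffAt.isSymmSndFDerivAt (by simp [minSmoothness_of_isRCLikeNormedField])
    rw [fderiv_clm_apply hd (differentiableAt_const _),
      fderiv_clm_apply hd (differentiableAt_const _)]
    simpa using hs b a
  | trans h1 h2 ih1 ih2 =>
    rw [ih1 hf, ih2 (by rw [← h1.length_eq]; exact hf)]

end MixedDerivatives

/-! ### Comparison of the full m-th derivative with the partial derivatives D^α. -/

section NormBound

variable {n m : ℕ}

/-- A tuple of coordinate directions is a permutation of the ordered list `multiDirections α`, where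
α counts the occurrences of each coordinate, so the value is one of the D^α f(x). -/
theorem norm_iteratedFDeriv_single_le {f : EuclideanSpace ℝ (Fin n) → ℂ} (hf : ContDiff ℝ m f)
    (x : EuclideanSpace ℝ (Fin n)) (s : Fin m → Fin n) :
    ‖iteratedFDeriv ℝ m f x fun l => EuclideanSpace.single (s l) (1 : ℝ)‖ ≤
      ∑ α ∈ multiIndices n m, ‖multiDeriv α f x‖ := by
  classical
  set S : List (EuclideanSpace ℝ (Fin n)) :=
    (List.ofFn s).map fun i => EuclideanSpace.single i (1 : ℝ) with hS
  have hlen : S.length = m := by simp [hS]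
  set α : Fin n → ℕ := fun i => (List.ofFn s).count i with hα
  have hperm : S.Perm (multiDirections α) := by
    have h1 : (List.ofFn s).Perm ((List.finRange n).flatMap fun i => List.replicate (α i) i) := by
      rw [List.perm_iff_count]
      intro a
      rw [List.count_flatMap]
      simp [Function.comp_def, List.count_replicate, hα, ← Fin.sum_univ_def]
    have h2 := h1.map (fun i => EuclideanSpace.single i (1 : ℝ))
    rw [hS]
    refine h2.trans (List.Perm.of_eq ?_)
    simp [multiDirections, List.map_flatMap]
  have hmem : α ∈ multiIndices n m := by
    rw [Finset.mem_piAntidiag]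
    refine ⟨?_, by simp⟩
    rw [← multiDirections_length, ← hperm.length_eq, hlen]
  have h1 : (iteratedFDeriv ℝ m f x fun l => EuclideanSpace.single (s l) (1 : ℝ)) =
      listDeriv S f x := by
    unfold listDeriv
    -- `S.length` and `m` agree only propositionally; quantifying over the length allows the cast to
    -- be eliminated.
    have key : ∀ (k : ℕ) (hk : k = m) (v : Fin k → EuclideanSpace ℝ (Fin n))
        (_ : ∀ l, v l = EuclideanSpace.single (s (Fin.cast hk l)) (1 : ℝ)),
        (iteratedFDeriv ℝ m f x fun l => EuclideanSpace.single (s l) (1 : ℝ)) =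
          iteratedFDeriv ℝ k f x v := by
      rintro k rfl v hv
      congr 1
      ext1 l
      simp [hv]
    refine key _ hlen _ fun l => ?_
    simp [hS]
    rfl
  rw [h1, listDeriv_perm hperm (by rw [hlen]; exact hf)]
  exact Finset.single_le_sum (f := fun α => ‖multiDeriv α f x‖) (fun _ _ => norm_nonneg _) hmem

/-- Expanding every argument in the standard basis produces n^m terms, each controlled by the
previous lemma. -/
theorem norm_iteratedFDeriv_le_sum_multiDeriv {f : EuclideanSpace ℝ (Fin n) → ℂ}
    (hf : ContDiff ℝ m f) (x : EuclideanSpace ℝ (Fin n)) :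
    ‖iteratedFDeriv ℝ m f x‖ ≤ (n : ℝ) ^ m * ∑ α ∈ multiIndices n m, ‖multiDeriv α f x‖ := by
  refine ContinuousMultilinearMap.opNorm_le_bound (by positivity) fun v => ?_
  have hv : v = fun l => ∑ i, v l i • EuclideanSpace.single i (1 : ℝ) := by
    ext l i
    simp [Pi.single_apply]
  have hexp : iteratedFDeriv ℝ m f x v = ∑ s : Fin m → Fin n,
      (∏ l, v l (s l)) • iteratedFDeriv ℝ m f x fun l => EuclideanSpace.single (s l) (1 : ℝ) := by
    conv_lhs => rw [hv]
    rw [ContinuousMultilinearMap.map_sum]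
    refine Finset.sum_congr rfl fun s _ => ?_
    exact (iteratedFDeriv ℝ m f x).map_smul_univ (fun l => v l (s l))
      (fun l => EuclideanSpace.single (s l) (1 : ℝ))
  rw [hexp]
  refine (norm_sum_le _ _).trans ?_
  have hterm : ∀ s ∈ (Finset.univ : Finset (Fin m → Fin n)),
      ‖(∏ l, v l (s l)) • iteratedFDeriv ℝ m f x
        fun l => EuclideanSpace.single (s l) (1 : ℝ)‖ ≤
      (∏ l, ‖v l‖) * ∑ α ∈ multiIndices n m, ‖multiDeriv α f x‖ := by
    intro s _
    rw [norm_smul, norm_prod]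
    refine mul_le_mul (Finset.prod_le_prod (fun _ _ => norm_nonneg _) fun l _ => ?_)
      (norm_iteratedFDeriv_single_le hf x s) (norm_nonneg _) (by positivity)
    exact PiLp.norm_apply_le _ _
  refine (Finset.sum_le_sum hterm).trans (le_of_eq ?_)
  simp
  ring

theorem norm_multiDeriv_le {α : Fin n → ℕ} (h : α ∈ multiIndices n m)
    (f : EuclideanSpace ℝ (Fin n) → ℂ) (x : EuclideanSpace ℝ (Fin n)) :
    ‖multiDeriv α f x‖ ≤ ‖iteratedFDeriv ℝ m f x‖ := by
  have hm := multiDirections_length_of_mem h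
  unfold multiDeriv
  refine (ContinuousMultilinearMap.le_opNorm _ _).trans ?_
  have : ∏ i, ‖(multiDirections α).get i‖ = 1 := by
    refine Finset.prod_eq_one fun i _ => ?_
    have hi := (multiDirections α).get_mem i
    simp only [multiDirections, List.mem_flatMap, List.mem_replicate] at hi
    obtain ⟨j, -, -, hj⟩ := hi
    change ‖(multiDirections α).get i‖ = 1
    unfold multiDirections
    rw [hj]
    simp
  rw [this, mul_one, hm]

end NormBound

/-! ### Taylor's formula with integral remainder. -/

section TaylorPolynomial

variable {V : Type*} [NormedAddCommGroup V] [NormedSpace ℝ V]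

/-- The Taylor polynomial of degree less than `m` of `f` at `y`, evaluated at `x`. -/
def taylorPoly (m : ℕ) (f : V → ℂ) (y x : V) : ℂ :=
  ∑ k ∈ Finset.range m, (k.factorial : ℝ)⁻¹ • iteratedFDeriv ℝ k f y fun _ => x - y

theorem enorm_sub_taylorPoly_le {m : ℕ} (hm : m ≠ 0) {f : V → ℂ} (hf : ContDiff ℝ m f) (y x : V) :
    ‖f x - taylorPoly m f y x‖ₑ ≤ ∫⁻ t in Set.Ioc (0 : ℝ) 1,
      ENNReal.ofReal ((1 - t) ^ (m - 1)) * (‖x - y‖ₑ ^ m *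
        ‖iteratedFDeriv ℝ m f (y + t • (x - y))‖ₑ) := by
  obtain ⟨k, rfl⟩ := Nat.exists_eq_succ_of_ne_zero hm
  have h := map_add_eq_sum_add_integral_iteratedFDeriv (f := f) (x := y) (y := x - y) (n := k)
    (fun t _ => by exact_mod_cast hf.contDiffAt)
  rw [add_sub_cancel] at h
  rw [h]
  simp only [taylorPoly, Nat.succ_eq_add_one, add_sub_cancel_left, add_tsub_cancel_right]
  rw [enorm_smul, intervalIntegral.integral_of_le zero_le_one]
  -- The factor 1/(m-1)! of the remainder is discarded; constants are irrelevant for the rates.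
  have hfac : ‖((k.factorial : ℝ))⁻¹‖ₑ ≤ 1 := by
    rw [← ofReal_norm, ENNReal.ofReal_le_one, norm_inv, Real.norm_natCast]
    exact inv_le_one_of_one_le₀ (by exact_mod_cast Nat.factorial_pos k)
  refine (mul_le_of_le_one_left' hfac).trans ?_
  refine (enorm_integral_le_lintegral_enorm _).trans ?_
  refine setLIntegral_mono_ae' measurableSet_Ioc (ae_of_all _ fun t ht => ?_)
  rw [enorm_smul]
  refine mul_le_mul' ?_ ?_
  · rw [← ofReal_norm, Real.norm_of_nonneg (pow_nonneg (by linarith [ht.2]) _)]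
  · rw [← ofReal_norm, ← ofReal_norm, ← ofReal_norm,
      ← ENNReal.ofReal_pow (norm_nonneg _), ← ENNReal.ofReal_mul (by positivity)]
    refine ENNReal.ofReal_le_ofReal ?_
    refine (ContinuousMultilinearMap.le_opNorm _ _).trans (le_of_eq ?_)
    simp [mul_comm]

end TaylorPolynomial

/-! ### Jensen's inequality and affine changes of variables. -/

section Lintegral

/-- Jensen's inequality for the function `t ↦ t ^ p` and a density `a`. -/
theorem rpow_lintegral_mul_le {X : Type*} [MeasurableSpace X] {μ : Measure X} {a b : X → ℝ≥0∞}
    (ha : Measurable a) (hb : Measurable b) {p : ℝ} (hp : 1 ≤ p) :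
    (∫⁻ x, a x * b x ∂μ) ^ p ≤ (∫⁻ x, a x ∂μ) ^ (p - 1) * ∫⁻ x, a x * b x ^ p ∂μ := by
  have hp0 : 0 < p := by linarith
  have h := eLpNorm'_le_eLpNorm'_mul_rpow_measure_univ (μ := μ.withDensity a) (f := b)
    zero_lt_one hp hb.aestronglyMeasurable
  rw [eLpNorm', eLpNorm', lintegral_withDensity_eq_lintegral_mul _ ha (by fun_prop),
    lintegral_withDensity_eq_lintegral_mul _ ha (by fun_prop), withDensity_apply _ .univ,
    Measure.restrict_univ] at h
  simp only [enorm_eq_self, ENNReal.rpow_one, one_div, inv_one, Pi.mul_apply] at h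
  refine (ENNReal.rpow_le_rpow h hp0.le).trans (le_of_eq ?_)
  rw [ENNReal.mul_rpow_of_nonneg _ _ hp0.le, ← ENNReal.rpow_mul, ← ENNReal.rpow_mul,
    inv_mul_cancel₀ hp0.ne', ENNReal.rpow_one, mul_comm, sub_mul, inv_mul_cancel₀ hp0.ne', one_mul]

variable {V : Type*} [NormedAddCommGroup V] [NormedSpace ℝ V] [MeasurableSpace V] [BorelSpace V]
  [FiniteDimensional ℝ V]

theorem lintegral_comp_const_smul (μ : Measure V) [μ.IsAddHaarMeasure] {F : V → ℝ≥0∞}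
    (hF : Measurable F) {c : ℝ} (hc : c ≠ 0) :
    ∫⁻ x, F (c • x) ∂μ = ENNReal.ofReal |(c ^ Module.finrank ℝ V)⁻¹| * ∫⁻ x, F x ∂μ := by
  rw [← lintegral_map (f := F) hF (measurable_const_smul c), Measure.map_addHaar_smul μ hc,
    lintegral_smul_measure, smul_eq_mul]

theorem lintegral_comp_add_smul (μ : Measure V) [μ.IsAddHaarMeasure] {F : V → ℝ≥0∞}
    (hF : Measurable F) (a : V) {c : ℝ} (hc : c ≠ 0) :
    ∫⁻ x, F (a + c • x) ∂μ = ENNReal.ofReal |(c ^ Module.finrank ℝ V)⁻¹| * ∫⁻ x, F x ∂μ := by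
  rw [lintegral_comp_const_smul μ (F := fun x => F (a + x)) (by fun_prop) hc,
    lintegral_add_left_eq_self]

end Lintegral

/-! ### The logarithmic factor of the weight. -/

section LogWeight

variable {V : Type*} [NormedAddCommGroup V]

/-- The slowly varying factor `1 + |log ‖x‖|` of the weight. -/
def logWeight (x : V) : ℝ := 1 + |Real.log ‖x‖|

theorem one_le_logWeight (x : V) : 1 ≤ logWeight x := by
  simp [logWeight]

theorem logWeight_pos (x : V) : 0 < logWeight x := zero_lt_one.trans_le (one_le_logWeight x)

variable [MeasurableSpace V] [BorelSpace V]

theorem measurable_logWeight : Measurable (logWeight : V → ℝ) := by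
  unfold logWeight
  have : Measurable fun x : V => |Real.log ‖x‖| :=
    continuous_abs.measurable.comp (Real.measurable_log.comp measurable_norm)
  exact measurable_const.add this

end LogWeight

/-! ### The Hardy inequality with logarithmic weights. -/

section Hardy

variable {V : Type*} [NormedAddCommGroup V] [NormedSpace ℝ V]

/-- Repeated integration along the ray through `x` recovers `f x` from its derivatives of
order `m`. -/
theorem enorm_le_lintegral_ray {m : ℕ} (hm : m ≠ 0) {f : V → ℂ} (hf : ContDiff ℝ m f)
    (hc : HasCompactSupport f) {x : V} (hx : x ≠ 0) :
    ‖f x‖ₑ ≤ ∫⁻ t in Set.Ici (1 : ℝ), ENNReal.ofReal t⁻¹ *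
      (‖t • x‖ₑ ^ m * ‖iteratedFDeriv ℝ m f (t • x)‖ₑ) := by
  obtain ⟨R, hR0, hR⟩ := hc.isCompact.isBounded.exists_pos_norm_le
  have hxn : 0 < ‖x‖ := norm_pos_iff.2 hx
  -- The base point T • x has norm R + 2‖x‖ > R, so it lies off the support and the Taylor
  -- polynomial there is zero.
  set T : ℝ := R / ‖x‖ + 2 with hT
  have hT1 : 0 < T - 1 := by have : 0 < R / ‖x‖ := by positivity
                             linarith
  have hTx : T • x ∉ tsupport f := by
    intro h
    have h1 := hR _ h
    rw [norm_smul, Real.norm_of_nonneg (by linarith), hT, add_mul, div_mul_cancel₀ _ hxn.ne'] at h1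
    linarith
  have hzero : taylorPoly m f (T • x) x = 0 := by
    unfold taylorPoly
    refine Finset.sum_eq_zero fun k _ => ?_
    have : iteratedFDeriv ℝ k f (T • x) = 0 := by
      by_contra h0
      exact hTx (support_iteratedFDeriv_subset (𝕜 := ℝ) k h0)
    simp [this]
  have h := enorm_sub_taylorPoly_le hm hf (T • x) x
  rw [hzero, sub_zero] at h
  refine h.trans ?_
  set F : ℝ → ℝ≥0∞ := (Set.Ici (1 : ℝ)).indicator fun t => ENNReal.ofReal t⁻¹ *
      (‖t • x‖ₑ ^ m * ‖iteratedFDeriv ℝ m f (t • x)‖ₑ) with hF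
  have hFm : Measurable F := by
    refine Measurable.indicator ?_ measurableSet_Ici
    have h1 : Continuous fun t : ℝ => iteratedFDeriv ℝ m f (t • x) :=
      (hf.continuous_iteratedFDeriv le_rfl).comp (by fun_prop)
    have h2 : Continuous fun t : ℝ => t • x := by fun_prop
    exact (measurable_inv.ennreal_ofReal).mul
      ((h2.enorm.measurable.pow_const m).mul h1.enorm.measurable)
  -- The substitution t = T - (T - 1)s carries the segment parameter s in [0, 1] to the ray
  -- parameter t in [1, T].
  have hsub := lintegral_comp_add_smul (volume : Measure ℝ) hFm T (c := -(T - 1)) (by linarith)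
  rw [Module.finrank_self, pow_one, abs_inv, abs_neg, abs_of_pos hT1] at hsub
  rw [← lintegral_indicator measurableSet_Ici]
  change _ ≤ ∫⁻ t, F t
  have hval : ∫⁻ t, F t = ENNReal.ofReal (T - 1) * ∫⁻ s : ℝ, F (T + (-(T - 1)) • s) := by
    rw [hsub, ← mul_assoc, ← ENNReal.ofReal_mul hT1.le, mul_inv_cancel₀ hT1.ne',
      ENNReal.ofReal_one, one_mul]
  rw [hval, ← lintegral_const_mul' _ _ ENNReal.ofReal_ne_top]
  refine le_trans ?_ (setLIntegral_le_lintegral (Set.Ioc 0 1) _)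
  refine setLIntegral_mono_ae' measurableSet_Ioc (ae_of_all _ fun s hs => ?_)
  have ht : 1 ≤ T + (-(T - 1)) • s := by
    rw [smul_eq_mul]; nlinarith [hs.2]
  have hpt : T • x + s • (x - T • x) = (T + (-(T - 1)) • s) • x := by
    simp only [smul_eq_mul]
    module
  have ht0 : 0 < T + (-(T - 1)) • s := by linarith
  have e1 : 1 - s = (T + (-(T - 1)) • s - 1) / (T - 1) := by
    rw [smul_eq_mul]; field_simp; ring
  have hnx : x - T • x = -((T - 1) • x) := by rw [sub_smul, one_smul, neg_sub]
  rw [hpt, hnx, enorm_neg, hF, Set.indicator_of_mem (Set.mem_Ici.2 ht)]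
  generalize T + (-(T - 1)) • s = t at ht ht0 e1
  rw [← mul_assoc, ← mul_assoc, ← mul_assoc]
  refine mul_le_mul' ?_ le_rfl
  rw [enorm_smul, enorm_smul, mul_pow, mul_pow, ← mul_assoc, ← mul_assoc]
  refine mul_le_mul' ?_ le_rfl
  rw [Real.enorm_eq_ofReal hT1.le, Real.enorm_eq_ofReal ht0.le, ← ENNReal.ofReal_pow hT1.le,
    ← ENNReal.ofReal_pow ht0.le, ← ENNReal.ofReal_mul (by rw [e1]; positivity),
    ← ENNReal.ofReal_mul hT1.le, ← ENNReal.ofReal_mul (by positivity)]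
  refine ENNReal.ofReal_le_ofReal ?_
  -- What remains is (1 - s)^(m-1) (T - 1)^m = (T - 1)(t - 1)^(m-1) ≤ (T - 1) t^(m-1).
  obtain ⟨k, rfl⟩ := Nat.exists_eq_succ_of_ne_zero hm
  rw [Nat.succ_eq_add_one, Nat.add_sub_cancel, e1, pow_succ, div_pow, ← mul_assoc,
    div_mul_cancel₀ _ (by positivity), pow_succ, mul_assoc (T - 1), mul_comm]
  refine mul_le_mul_of_nonneg_left ?_ hT1.le
  rw [mul_comm t⁻¹, mul_assoc, mul_inv_cancel₀ ht0.ne', mul_one]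
  exact pow_le_pow_left₀ (by linarith) (by linarith) _

/-- Since log ‖x‖ = log ‖tx‖ - log t for x ≠ 0, the claim reduces to 1 + a + b ≤ (1 + a)(1 + b) for
a, b ≥ 0. -/
theorem logWeight_le_mul {x : V} {t : ℝ} (ht : 1 ≤ t) (hx : ‖t • x‖ < 1) :
    logWeight x ≤ (1 + Real.log t) * logWeight (t • x) := by
  have hl : 0 ≤ Real.log t := Real.log_nonneg ht
  rcases eq_or_ne x 0 with rfl | hx0
  · simp [logWeight, hl]
  have hxn : 0 < ‖x‖ := norm_pos_iff.2 hx0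
  have ht0 : 0 < t := by linarith
  have h : Real.log ‖t • x‖ = Real.log t + Real.log ‖x‖ := by
    rw [norm_smul, Real.norm_of_nonneg ht0.le, Real.log_mul ht0.ne' hxn.ne']
  unfold logWeight
  have h2 : Real.log ‖x‖ = Real.log ‖t • x‖ - Real.log t := by linarith
  have h3 : |Real.log ‖x‖| ≤ |Real.log ‖t • x‖| + Real.log t := by
    rw [h2]
    refine (abs_sub _ _).trans ?_
    rw [abs_of_nonneg hl]
  nlinarith [abs_nonneg (Real.log ‖t • x‖)]

theorem exists_one_add_log_rpow_le (σ : ℝ) (hσ : 0 < σ) {η : ℝ} (hη : 0 < η) :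
    ∃ C : ℝ, 0 ≤ C ∧ ∀ t : ℝ, 1 ≤ t → (1 + Real.log t) ^ σ ≤ C * t ^ η := by
  have hδ : 0 < η / σ := div_pos hη hσ
  refine ⟨(1 + (η / σ)⁻¹) ^ σ, by positivity, fun t ht => ?_⟩
  have h1 : 1 + Real.log t ≤ (1 + (η / σ)⁻¹) * t ^ (η / σ) := by
    have h2 := Real.log_le_rpow_div (by linarith : 0 ≤ t) hδ
    have h3 : 1 ≤ t ^ (η / σ) := Real.one_le_rpow ht hδ.le
    rw [div_eq_mul_inv] at h2
    nlinarith
  have hl : 0 ≤ Real.log t := Real.log_nonneg ht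
  refine (Real.rpow_le_rpow (by linarith) h1 hσ.le).trans (le_of_eq ?_)
  rw [Real.mul_rpow (by positivity) (by positivity), ← Real.rpow_mul (by linarith),
    div_mul_cancel₀ _ hσ.ne']

variable [MeasurableSpace V] [BorelSpace V]

variable [FiniteDimensional ℝ V]

/-- A Hardy inequality with logarithmic weights. -/
theorem exists_lintegral_ray_le (μ : Measure V) [μ.IsAddHaarMeasure]
    (hn : 1 ≤ Module.finrank ℝ V) {p σ : ℝ} (hp : 1 ≤ p) (hσ : 0 < σ) :
    ∃ C : ℝ≥0∞, C ≠ ∞ ∧ ∀ H : V → ℝ≥0∞, Measurable H → (∀ x, 1 ≤ ‖x‖ → H x = 0) →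
      ∫⁻ x, (ENNReal.ofReal (logWeight x ^ σ) *
        ∫⁻ t in Set.Ici (1 : ℝ), ENNReal.ofReal t⁻¹ * H (t • x)) ^ p ∂μ ≤
      C * ∫⁻ x, (ENNReal.ofReal (logWeight x ^ σ) * H x) ^ p ∂μ := by
  set N := Module.finrank ℝ V with hN
  have hp0 : 0 < p := by linarith
  have hN0 : (0 : ℝ) < N := by exact_mod_cast hn
  -- Jensen is applied with density t^(-θ-1), integrable as θ > 0. The remaining factor t^(θ+η)
  -- includes t^η for the power of 1 + log t, and dilation contributes t^(-N). The choices make (θ +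
  -- η)p = 3N/4 < N, so the resulting integral over t converges.
  set θ : ℝ := N / (2 * p) with hθ
  set η : ℝ := N / (4 * p) with hη
  have hθ0 : 0 < θ := by positivity
  have hη0 : 0 < η := by positivity
  obtain ⟨C₁, hC₁, hlog⟩ := exists_one_add_log_rpow_le σ hσ hη0
  set a : ℝ → ℝ≥0∞ := fun t => ENNReal.ofReal (t ^ (-θ - 1)) with ha
  set b : ℝ → ℝ≥0∞ := fun t => ENNReal.ofReal (C₁ * t ^ (θ + η)) with hb
  have ham : Measurable a := by fun_prop
  have hbm : Measurable b := by fun_prop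
  have hfin : ∀ (c e : ℝ), e < -1 → ∫⁻ t in Set.Ici (1 : ℝ), ENNReal.ofReal (c * t ^ e) ≠ ∞ := by
    intro c e he
    have h : IntegrableOn (fun t : ℝ => c * t ^ e) (Set.Ioi 1) :=
      (integrableOn_Ioi_rpow_of_lt he zero_lt_one).const_mul c
    rw [← integrableOn_Ici_iff_integrableOn_Ioi] at h
    exact h.lintegral_lt_top.ne
  set A : ℝ≥0∞ := ∫⁻ t in Set.Ici (1 : ℝ), a t with hA
  have hAfin : A ≠ ∞ := by
    have := hfin 1 (-θ - 1) (by linarith)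
    simpa [hA, ha] using this
  set D : ℝ≥0∞ := ∫⁻ t in Set.Ici (1 : ℝ), a t * b t ^ p * ENNReal.ofReal |(t ^ N)⁻¹| with hD
  have hDfin : D ≠ ∞ := by
    have h := hfin (C₁ ^ p) (-θ - 1 + (θ + η) * p - N) (by
      have h1 : (θ + η) * p = 3 / 4 * N := by rw [hθ, hη]; field_simp; norm_num
      rw [h1]; linarith)
    refine ne_of_eq_of_ne ?_ h
    refine setLIntegral_congr_fun measurableSet_Ici fun t ht => ?_
    have ht0 : 0 < t := lt_of_lt_of_le zero_lt_one ht
    simp only [ha, hb]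
    rw [ENNReal.ofReal_rpow_of_nonneg (by positivity) hp0.le, ← ENNReal.ofReal_mul (by positivity),
      ← ENNReal.ofReal_mul (by positivity), abs_of_pos (by positivity),
      Real.mul_rpow hC₁ (by positivity), ← Real.rpow_mul ht0.le, ← Real.rpow_natCast t N,
      ← Real.rpow_neg ht0.le, mul_left_comm, mul_assoc, ← Real.rpow_add ht0, ← Real.rpow_add ht0]
    congr 3
  refine ⟨A ^ (p - 1) * D, ENNReal.mul_ne_top
    (ENNReal.rpow_ne_top_of_nonneg (by linarith) hAfin) hDfin, fun H hH hH1 => ?_⟩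
  set H' : V → ℝ≥0∞ := fun x => ENNReal.ofReal (logWeight x ^ σ) * H x with hH'
  have hH'm : Measurable H' :=
    ((measurable_logWeight.pow_const σ).ennreal_ofReal).mul hH
  have hpt : ∀ x, (ENNReal.ofReal (logWeight x ^ σ) *
      ∫⁻ t in Set.Ici (1 : ℝ), ENNReal.ofReal t⁻¹ * H (t • x)) ^ p ≤
      A ^ (p - 1) * ∫⁻ t in Set.Ici (1 : ℝ), a t * (b t * H' (t • x)) ^ p := by
    intro x
    have hbH : Measurable fun t : ℝ => b t * H' (t • x) :=
      hbm.mul (hH'm.comp (by fun_prop))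
    refine le_trans (ENNReal.rpow_le_rpow ?_ hp0.le) (rpow_lintegral_mul_le ham hbH hp)
    rw [← lintegral_const_mul' _ _ ENNReal.ofReal_ne_top]
    refine setLIntegral_mono_ae' measurableSet_Ici (ae_of_all _ fun t ht => ?_)
    have ht1 : (1 : ℝ) ≤ t := ht
    have ht0 : 0 < t := by linarith
    rcases le_or_gt 1 ‖t • x‖ with h1 | h1
    · simp [hH1 _ h1]
    simp only [ha, hb, hH']
    rw [← mul_assoc, ← mul_assoc, ← mul_assoc]
    refine mul_le_mul' ?_ le_rfl
    have hw := logWeight_pos (t • x)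
    rw [← ENNReal.ofReal_mul (Real.rpow_nonneg (logWeight_pos x).le _),
      ← ENNReal.ofReal_mul (by positivity), ← ENNReal.ofReal_mul (by positivity)]
    refine ENNReal.ofReal_le_ofReal ?_
    have hl : 0 ≤ Real.log t := Real.log_nonneg ht1
    have h2 : logWeight x ^ σ ≤ C₁ * t ^ η * logWeight (t • x) ^ σ := by
      refine (Real.rpow_le_rpow (logWeight_pos x).le (logWeight_le_mul ht1 h1) hσ.le).trans ?_
      rw [Real.mul_rpow (by linarith) hw.le]
      exact mul_le_mul_of_nonneg_right (hlog t ht1) (by positivity)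
    have h3 : t ^ (-θ - 1) * (C₁ * t ^ (θ + η)) = t⁻¹ * (C₁ * t ^ η) := by
      rw [Real.rpow_sub ht0, Real.rpow_add ht0, Real.rpow_neg ht0.le, Real.rpow_one]
      have : t ^ θ ≠ 0 := by positivity
      field_simp
    rw [h3, mul_comm, mul_assoc t⁻¹]
    exact mul_le_mul_of_nonneg_left h2 (by positivity)
  refine (lintegral_mono hpt).trans ?_
  rw [lintegral_const_mul' _ _ (ENNReal.rpow_ne_top_of_nonneg (by linarith) hAfin), mul_assoc]
  refine mul_le_mul' le_rfl (le_of_eq ?_)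
  rw [lintegral_lintegral_swap, hD, ← lintegral_mul_const]
  · refine setLIntegral_congr_fun measurableSet_Ici fun t ht => ?_
    have ht0 : 0 < t := lt_of_lt_of_le zero_lt_one ht
    simp only [ENNReal.mul_rpow_of_nonneg _ _ hp0.le]
    rw [lintegral_const_mul _ (by fun_prop), lintegral_const_mul _ (by fun_prop),
      lintegral_comp_const_smul μ (F := fun x => H' x ^ p) (by fun_prop) ht0.ne', mul_assoc,
      mul_assoc, hH']
    simp only [ENNReal.mul_rpow_of_nonneg _ _ hp0.le]
    rfl
  · fun_prop
  · fun_prop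

end Hardy

/-! ### The Poincaré inequality for averaged Taylor polynomials. -/

section Poincare

variable {V : Type*} [NormedAddCommGroup V] [NormedSpace ℝ V]

theorem continuous_taylorPoly {m : ℕ} {f : V → ℂ} (hf : ContDiff ℝ m f) (x : V) :
    Continuous fun y => taylorPoly m f y x := by
  unfold taylorPoly
  refine continuous_finsetSum _ fun k hk => ?_
  have h1 : Continuous (iteratedFDeriv ℝ k f) :=
    hf.continuous_iteratedFDeriv (by exact_mod_cast (Finset.mem_range.1 hk).le)
  have h2 : Continuous fun y => iteratedFDeriv ℝ k f y fun _ => x - y := by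
    fun_prop
  exact h2.const_smul ((k.factorial : ℝ)⁻¹)

variable [MeasurableSpace V] [BorelSpace V] [FiniteDimensional ℝ V] (μ : Measure V)
  [μ.IsAddHaarMeasure]

/-- The Taylor polynomial of degree less than `m`, averaged over base points in `Q`. -/
def averagedTaylor (m : ℕ) (Q : Set V) (f : V → ℂ) (x : V) : ℂ :=
  ⨍ y in Q, taylorPoly m f y x ∂μ

theorem setLIntegral_comp_add_smul_le {F : V → ℝ≥0∞} (hF : Measurable F) {Q : Set V}
    (hQ : MeasurableSet Q) {a : V} {c : ℝ} (hc : 1 / 2 ≤ c) (hmaps : ∀ x ∈ Q, a + c • x ∈ Q) :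
    ∫⁻ x in Q, F (a + c • x) ∂μ ≤ 2 ^ Module.finrank ℝ V * ∫⁻ x in Q, F x ∂μ := by
  have hc0 : 0 < c := by linarith
  calc ∫⁻ x in Q, F (a + c • x) ∂μ ≤ ∫⁻ x, Q.indicator F (a + c • x) ∂μ := by
        rw [← lintegral_indicator hQ]
        refine lintegral_mono fun x => ?_
        by_cases hx : x ∈ Q
        · rw [Set.indicator_of_mem hx, Set.indicator_of_mem (hmaps x hx)]
        · rw [Set.indicator_of_notMem hx]; exact zero_le
    _ = ENNReal.ofReal |(c ^ Module.finrank ℝ V)⁻¹| * ∫⁻ x, Q.indicator F x ∂μ :=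
        lintegral_comp_add_smul μ (hF.indicator hQ) a hc0.ne'
    _ ≤ _ := by
        rw [lintegral_indicator hQ]
        refine mul_le_mul' ?_ le_rfl
        rw [abs_of_pos (by positivity), ← inv_pow, ENNReal.ofReal_pow (by positivity)]
        refine pow_le_pow_left' ?_ _
        rw [← ENNReal.ofReal_ofNat]
        refine ENNReal.ofReal_le_ofReal ?_
        rw [inv_le_comm₀ hc0 (by norm_num)]
        linarith

/-- In (1 - t)y + tx one coefficient is at least 1/2. Integrating first in that variable keeps the
Jacobian below 2^N, N being the dimension, uniformly in t; convexity keeps the point in Q. -/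
theorem lintegral_lintegral_segment_le {F : V → ℝ≥0∞} (hF : Measurable F) {Q : Set V}
    (hQ : MeasurableSet Q) (hconv : Convex ℝ Q) {t : ℝ} (ht : t ∈ Set.Ioc (0 : ℝ) 1) :
    ∫⁻ y in Q, ∫⁻ x in Q, F (y + t • (x - y)) ∂μ ∂μ ≤
      2 ^ Module.finrank ℝ V * (∫⁻ x in Q, F x ∂μ) * μ Q := by
  have e1 : ∀ x y : V, y + t • (x - y) = (1 - t) • y + t • x := fun x y => by module
  simp_rw [e1]
  rcases le_total (1 / 2) t with h | h
  · calc _ ≤ ∫⁻ y in Q, 2 ^ Module.finrank ℝ V * ∫⁻ x in Q, F x ∂μ ∂μ := by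
          refine setLIntegral_mono_ae' hQ (ae_of_all _ fun y hy => ?_)
          refine setLIntegral_comp_add_smul_le μ hF hQ h fun x hx => ?_
          exact hconv hy hx (by linarith [ht.2]) ht.1.le (by ring)
      _ = _ := by rw [setLIntegral_const]
  · rw [lintegral_lintegral_swap (by fun_prop)]
    calc _ ≤ ∫⁻ y in Q, 2 ^ Module.finrank ℝ V * ∫⁻ x in Q, F x ∂μ ∂μ := by
          refine setLIntegral_mono_ae' hQ (ae_of_all _ fun x hx => ?_)
          simp_rw [add_comm _ (t • x)]
          refine setLIntegral_comp_add_smul_le μ hF hQ (by linarith) fun y hy => ?_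
          exact hconv hx hy ht.1.le (by linarith [ht.2]) (by ring)
      _ = _ := by rw [setLIntegral_const]

/-- The Poincaré inequality for the averaged Taylor polynomial on a bounded convex set. -/
theorem lintegral_sub_averagedTaylor_le {m : ℕ} (hm : m ≠ 0) {p : ℝ} (hp : 1 ≤ p) {Q : Set V}
    (hQ : MeasurableSet Q) (hconv : Convex ℝ Q) (hb : Bornology.IsBounded Q) {d : ℝ≥0∞}
    (hd : ∀ x ∈ Q, ∀ y ∈ Q, ‖x - y‖ₑ ≤ d) {f : V → ℂ} (hf : ContDiff ℝ m f) :
    ∫⁻ x in Q, ‖f x - averagedTaylor μ m Q f x‖ₑ ^ p ∂μ ≤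
      2 ^ Module.finrank ℝ V * ∫⁻ x in Q, (d ^ m * ‖iteratedFDeriv ℝ m f x‖ₑ) ^ p ∂μ := by
  have hp0 : 0 < p := by linarith
  have hfin : μ Q ≠ ∞ := hb.measure_lt_top.ne
  rcases eq_or_ne (μ Q) 0 with h0 | h0
  · rw [Measure.restrict_eq_zero.2 h0]; simp
  set ν : Measure V := (μ Q)⁻¹ • μ.restrict Q with hν
  have hprob : IsProbabilityMeasure ν :=
    ⟨by simp [hν, ENNReal.inv_mul_cancel h0 hfin]⟩
  -- The base point and the segment parameter together range over a probability space, so Jensen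
  -- with density 1 costs no constant.
  set ρ : Measure (V × ℝ) := ν.prod (volume.restrict (Set.Ioc (0 : ℝ) 1)) with hρ
  have hρu : ρ Set.univ = 1 := by
    rw [hρ, ← Set.univ_prod_univ, Measure.prod_prod]
    simp
  have hGc : Continuous (iteratedFDeriv ℝ m f) := hf.continuous_iteratedFDeriv le_rfl
  set G : V → ℝ≥0∞ := fun x => d ^ m * ‖iteratedFDeriv ℝ m f x‖ₑ with hG
  have hGm : Measurable G := (hGc.enorm.measurable).const_mul _
  have hmem : ∀ᵐ y ∂ν, y ∈ Q := Measure.ae_smul_measure (ae_restrict_mem hQ) _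
  have hpt : ∀ x ∈ Q, ‖f x - averagedTaylor μ m Q f x‖ₑ ^ p ≤
      ∫⁻ z, G (z.1 + z.2 • (x - z.1)) ^ p ∂ρ := by
    intro x hx
    have hint : Integrable (fun y => taylorPoly m f y x) ν := by
      refine Integrable.smul_measure ?_ (ENNReal.inv_ne_top.2 h0)
      exact ((continuous_taylorPoly hf x).continuousOn.integrableOn_compact
        hb.isCompact_closure).mono_set subset_closure
    have e1 : f x - averagedTaylor μ m Q f x = ∫ y, (f x - taylorPoly m f y x) ∂ν := by
      rw [integral_sub (integrable_const _) hint, averagedTaylor, setAverage_eq', integral_const,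
        probReal_univ, one_smul]
    have h1 : ‖f x - averagedTaylor μ m Q f x‖ₑ ≤ ∫⁻ z, 1 * G (z.1 + z.2 • (x - z.1)) ∂ρ := by
      rw [e1]
      refine (enorm_integral_le_lintegral_enorm _).trans ?_
      simp only [one_mul]
      rw [hρ, lintegral_prod _ (by fun_prop)]
      refine lintegral_mono_ae ?_
      filter_upwards [hmem] with y hy
      refine (enorm_sub_taylorPoly_le hm hf y x).trans ?_
      refine setLIntegral_mono_ae' measurableSet_Ioc (ae_of_all _ fun t ht => ?_)
      refine (mul_le_of_le_one_left' ?_).trans ?_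
      · rw [ENNReal.ofReal_le_one]
        exact pow_le_one₀ (by linarith [ht.2]) (by linarith [ht.1])
      · exact mul_le_mul' (pow_le_pow_left' (hd x hx y hy) _) le_rfl
    refine (ENNReal.rpow_le_rpow h1 hp0.le).trans ?_
    refine (rpow_lintegral_mul_le measurable_const (by fun_prop) hp).trans (le_of_eq ?_)
    rw [lintegral_const, hρu]
    simp
  calc _ ≤ ∫⁻ x in Q, ∫⁻ z, G (z.1 + z.2 • (x - z.1)) ^ p ∂ρ ∂μ :=
        setLIntegral_mono_ae' hQ (ae_of_all _ hpt)
    _ = ∫⁻ z, ∫⁻ x in Q, G (z.1 + z.2 • (x - z.1)) ^ p ∂μ ∂ρ :=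
        lintegral_lintegral_swap (by fun_prop)
    _ = ∫⁻ t in Set.Ioc (0 : ℝ) 1, ∫⁻ y, ∫⁻ x in Q, G (y + t • (x - y)) ^ p ∂μ ∂ν := by
        rw [hρ, lintegral_prod_symm' _ (by fun_prop)]
    _ ≤ ∫⁻ t in Set.Ioc (0 : ℝ) 1, 2 ^ Module.finrank ℝ V * ∫⁻ x in Q, G x ^ p ∂μ := by
        refine setLIntegral_mono_ae' measurableSet_Ioc (ae_of_all _ fun t ht => ?_)
        rw [hν, lintegral_smul_measure, smul_eq_mul]
        refine (mul_le_mul' le_rfl (lintegral_lintegral_segment_le μ (F := fun x => G x ^ p)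
          (by fun_prop) hQ hconv ht)).trans (le_of_eq ?_)
        rw [mul_comm, mul_assoc, ENNReal.mul_inv_cancel h0 hfin, mul_one]
    _ = _ := by simp [hG]

end Poincare

/-! ### Taylor polynomials in a fixed finite family of monomials. -/

section PolynomialSpan

variable {n : ℕ}

/-- Indices for the monomials produced by expanding a Taylor polynomial of degree less
than `m` in coordinates. -/
abbrev TaylorIndex (n m : ℕ) : Type :=
  Σ k : Fin m, (Fin k → Fin n) × Finset (Fin k)

/-- The monomial in `x` with index `κ`. -/
def taylorMonomial {m : ℕ} (κ : TaylorIndex n m) (x : EuclideanSpace ℝ (Fin n)) : ℂ :=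
  ((∏ l ∈ κ.2.2, x (κ.2.1 l) : ℝ) : ℂ)

/-- The coefficient, depending on the base point, of the monomial with index `κ`. -/
def taylorCoeff {m : ℕ} (κ : TaylorIndex n m) (f : EuclideanSpace ℝ (Fin n) → ℂ)
    (y : EuclideanSpace ℝ (Fin n)) : ℂ :=
  (((κ.1 : ℕ).factorial : ℝ)⁻¹ * ∏ l ∈ Finset.univ \ κ.2.2, (-y (κ.2.1 l)) : ℝ) •
    iteratedFDeriv ℝ κ.1 f y fun l => EuclideanSpace.single (κ.2.1 l) (1 : ℝ)

/-- Expanding the products of x_i - y_i over subsets separates x from y. Averaging over y then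
changes only the coefficients, so the polynomials stay in a span that does not depend on f. -/
theorem taylorPoly_eq_sum (m : ℕ) (f : EuclideanSpace ℝ (Fin n) → ℂ)
    (y x : EuclideanSpace ℝ (Fin n)) :
    taylorPoly m f y x = ∑ κ : TaylorIndex n m, taylorCoeff κ f y * taylorMonomial κ x := by
  classical
  unfold taylorPoly
  rw [Finset.sum_range, Fintype.sum_sigma]
  refine Finset.sum_congr rfl fun k _ => ?_
  have hv : (fun _ : Fin k => x - y) =
      fun _ => ∑ i, (x i - y i) • EuclideanSpace.single i (1 : ℝ) := by
    ext l i
    simp [Pi.single_apply]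
  have hexp : (iteratedFDeriv ℝ k f y fun _ => x - y) = ∑ s : Fin k → Fin n,
      (∏ l, (x (s l) - y (s l))) •
        iteratedFDeriv ℝ k f y fun l => EuclideanSpace.single (s l) (1 : ℝ) := by
    rw [hv, ContinuousMultilinearMap.map_sum]
    refine Finset.sum_congr rfl fun s _ => ?_
    exact (iteratedFDeriv ℝ k f y).map_smul_univ (fun l => x (s l) - y (s l))
      (fun l => EuclideanSpace.single (s l) (1 : ℝ))
  rw [hexp, Finset.smul_sum, Fintype.sum_prod_type]
  refine Finset.sum_congr rfl fun s _ => ?_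
  simp_rw [sub_eq_add_neg, Finset.prod_add]
  rw [Finset.powerset_univ, Finset.sum_smul, Finset.smul_sum]
  refine Finset.sum_congr rfl fun A _ => ?_
  simp only [taylorCoeff, taylorMonomial, Complex.real_smul]
  push_cast
  ring

theorem continuous_taylorMonomial {m : ℕ} (κ : TaylorIndex n m) :
    Continuous (taylorMonomial κ) := by
  unfold taylorMonomial
  fun_prop

theorem continuous_taylorCoeff {m : ℕ} (κ : TaylorIndex n m)
    {f : EuclideanSpace ℝ (Fin n) → ℂ} (hf : ContDiff ℝ m f) : Continuous (taylorCoeff κ f) := by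
  unfold taylorCoeff
  have h1 : Continuous (iteratedFDeriv ℝ κ.1 f) :=
    hf.continuous_iteratedFDeriv (by exact_mod_cast κ.1.2.le)
  have h2 := (ContinuousMultilinearMap.apply ℝ (fun _ : Fin κ.1 => EuclideanSpace ℝ (Fin n)) ℂ
    fun l => EuclideanSpace.single (κ.2.1 l) (1 : ℝ)).continuous.comp h1
  have h3 : Continuous fun y : EuclideanSpace ℝ (Fin n) =>
      ((κ.1 : ℕ).factorial : ℝ)⁻¹ * ∏ l ∈ Finset.univ \ κ.2.2, (-y (κ.2.1 l)) := by fun_prop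
  exact h3.smul h2

theorem taylorCoeff_add {m : ℕ} (κ : TaylorIndex n m) {f g : EuclideanSpace ℝ (Fin n) → ℂ}
    (hf : ContDiff ℝ m f) (hg : ContDiff ℝ m g) (y : EuclideanSpace ℝ (Fin n)) :
    taylorCoeff κ (f + g) y = taylorCoeff κ f y + taylorCoeff κ g y := by
  have hk : ((κ.1 : ℕ) : WithTop ℕ∞) ≤ m := by exact_mod_cast κ.1.2.le
  unfold taylorCoeff
  rw [iteratedFDeriv_add_apply (hf.of_le hk).contDiffAt (hg.of_le hk).contDiffAt, ← smul_add]
  rfl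

theorem taylorCoeff_smul {m : ℕ} (κ : TaylorIndex n m) (c : ℂ)
    {f : EuclideanSpace ℝ (Fin n) → ℂ} (hf : ContDiff ℝ m f) (y : EuclideanSpace ℝ (Fin n)) :
    taylorCoeff κ (c • f) y = c • taylorCoeff κ f y := by
  have hk : ((κ.1 : ℕ) : WithTop ℕ∞) ≤ m := by exact_mod_cast κ.1.2.le
  unfold taylorCoeff
  rw [iteratedFDeriv_const_smul_apply (hf.of_le hk).contDiffAt, smul_comm c]
  rfl

theorem averagedTaylor_eq_sum {m : ℕ} {Q : Set (EuclideanSpace ℝ (Fin n))}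
    (hb : Bornology.IsBounded Q) {f : EuclideanSpace ℝ (Fin n) → ℂ} (hf : ContDiff ℝ m f)
    (x : EuclideanSpace ℝ (Fin n)) :
    averagedTaylor volume m Q f x =
      ∑ κ : TaylorIndex n m, (⨍ y in Q, taylorCoeff κ f y) * taylorMonomial κ x := by
  unfold averagedTaylor
  simp only [taylorPoly_eq_sum, setAverage_eq]
  rw [integral_finsetSum, Finset.smul_sum]
  · refine Finset.sum_congr rfl fun κ _ => ?_
    rw [integral_mul_const, smul_mul_assoc]
  · intro κ _
    refine Integrable.mul_const ?_ _
    exact ((continuous_taylorCoeff κ hf).continuousOn.integrableOn_compact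
      hb.isCompact_closure).mono_set subset_closure

end PolynomialSpan

/-! ### Norm, energy and the Hardy inequality on C_0^m(B). -/

section EnergyDensity

variable {n m : ℕ} {p : ℝ≥0} {σ : ℝ}

/-- The weighted size `|x|^m (1 + |log |x||)^σ ‖D^m f(x)‖` of the derivative of order `m`. -/
def energyDensity (m : ℕ) (σ : ℝ) (f : EuclideanSpace ℝ (Fin n) → ℂ)
    (x : EuclideanSpace ℝ (Fin n)) : ℝ≥0∞ :=
  ENNReal.ofReal (radialWeight n m σ x) * ‖iteratedFDeriv ℝ m f x‖ₑ

theorem CompactlySupported.tsupport_subset (f : CompactlySupported n m p σ) :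
    tsupport f ⊆ Metric.ball 0 1 :=
  TestFunction.tsupport_subset (f : 𝓓^{(m : ℕ∞)}(unitBall n, ℂ))

theorem CompactlySupported.apply_eq_zero (f : CompactlySupported n m p σ)
    {x : EuclideanSpace ℝ (Fin n)} (hx : 1 ≤ ‖x‖) : f x = 0 := by
  refine image_eq_zero_of_notMem_tsupport fun h => ?_
  have := f.tsupport_subset h
  rw [mem_ball_zero_iff] at this
  linarith

theorem CompactlySupported.iteratedFDeriv_eq_zero (f : CompactlySupported n m p σ) (k : ℕ)
    {x : EuclideanSpace ℝ (Fin n)} (hx : 1 ≤ ‖x‖) : iteratedFDeriv ℝ k f x = 0 := by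
  by_contra h
  have := f.tsupport_subset (support_iteratedFDeriv_subset (𝕜 := ℝ) k h)
  rw [mem_ball_zero_iff] at this
  linarith

theorem CompactlySupported.energyDensity_eq_zero (f : CompactlySupported n m p σ)
    {x : EuclideanSpace ℝ (Fin n)} (hx : 1 ≤ ‖x‖) : energyDensity m σ f x = 0 := by
  simp [energyDensity, f.iteratedFDeriv_eq_zero m hx]

theorem setLIntegral_ball_eq {F : EuclideanSpace ℝ (Fin n) → ℝ≥0∞}
    (hF : ∀ x, 1 ≤ ‖x‖ → F x = 0) : ∫⁻ x, F x ∂(ballMeasure n) = ∫⁻ x, F x := by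
  rw [← lintegral_indicator (unitBall n).isOpen.measurableSet]
  refine lintegral_congr fun x => ?_
  by_cases hx : x ∈ (unitBall n : Set (EuclideanSpace ℝ (Fin n)))
  · rw [Set.indicator_of_mem hx]
  · rw [Set.indicator_of_notMem hx, hF x]
    simpa [unitBall] using hx

variable [Fact (1 ≤ (p : ℝ≥0∞))]

theorem one_le_coe_of_fact : (1 : ℝ) ≤ p := by
  have h : (1 : ℝ≥0∞) ≤ p := Fact.out
  exact_mod_cast h

theorem eLpNorm_rpow_eq_lintegral {X F : Type*} [MeasurableSpace X] [NormedAddCommGroup F]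
    (μ : Measure X) (g : X → F) :
    eLpNorm g (p : ℝ≥0∞) μ ^ (p : ℝ) = ∫⁻ x, ‖g x‖ₑ ^ (p : ℝ) ∂μ := by
  have hp := one_le_coe_of_fact (p := p)
  have hp0 : (p : ℝ≥0∞) ≠ 0 := by
    have h : (1 : ℝ≥0∞) ≤ p := Fact.out
    exact (zero_lt_one.trans_le h).ne'
  rw [eLpNorm_eq_lintegral_rpow_enorm_toReal hp0 ENNReal.coe_ne_top, ← ENNReal.rpow_mul,
    ENNReal.coe_toReal, one_div, inv_mul_cancel₀ (by linarith), ENNReal.rpow_one]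

/-- Together with `energyDensity_le` this allows every estimate to be made with the operator norm of
the full m-th derivative instead of the sum over α. -/
theorem enorm_weightedDerivs_le (f : EuclideanSpace ℝ (Fin n) → ℂ)
    (x : EuclideanSpace ℝ (Fin n)) :
    ‖weightedDerivs n m p σ f x‖ₑ ≤ (multiIndices n m).card * energyDensity m σ f x := by
  classical
  have h1 : weightedDerivs n m p σ f x = ∑ α : multiIndices n m,
      PiLp.single (p : ℝ≥0∞) α (weightedDerivs n m p σ f x α) := by
    ext α
    simp [Pi.single_apply]
  rw [h1]
  refine (enorm_sum_le _ _).trans ?_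
  have h2 : ∀ α ∈ (Finset.univ : Finset (multiIndices n m)),
      ‖PiLp.single (p : ℝ≥0∞) (β := fun _ => ℂ) α (weightedDerivs n m p σ f x α)‖ₑ ≤
        energyDensity m σ f x := by
    intro α _
    rw [← ofReal_norm, PiLp.norm_single, ofReal_norm]
    simp only [weightedDerivs, energyDensity]
    rw [enorm_mul, ← ofReal_norm, Complex.norm_real,
      Real.norm_of_nonneg (radialWeight_nonneg ..)]
    refine mul_le_mul' le_rfl ?_
    rw [← ofReal_norm, ← ofReal_norm]
    exact ENNReal.ofReal_le_ofReal (norm_multiDeriv_le α.2 f x)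
  refine (Finset.sum_le_sum h2).trans (le_of_eq ?_)
  simp

theorem energyDensity_le {f : EuclideanSpace ℝ (Fin n) → ℂ} (hf : ContDiff ℝ m f)
    (x : EuclideanSpace ℝ (Fin n)) :
    energyDensity m σ f x ≤
      ((n : ℝ≥0∞) ^ m * (multiIndices n m).card) * ‖weightedDerivs n m p σ f x‖ₑ := by
  have h0 : ‖iteratedFDeriv ℝ m f x‖ₑ ≤
      (n : ℝ≥0∞) ^ m * ∑ α ∈ multiIndices n m, ‖multiDeriv α f x‖ₑ := by
    have h := ENNReal.ofReal_le_ofReal (norm_iteratedFDeriv_le_sum_multiDeriv hf x)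
    rw [ofReal_norm, ENNReal.ofReal_mul (by positivity), ENNReal.ofReal_pow (by positivity),
      ENNReal.ofReal_natCast, ENNReal.ofReal_sum_of_nonneg fun _ _ => norm_nonneg _] at h
    simpa only [ofReal_norm] using h
  unfold energyDensity
  refine (mul_le_mul' le_rfl h0).trans ?_
  rw [mul_left_comm, mul_assoc]
  refine mul_le_mul' le_rfl ?_
  rw [Finset.mul_sum, ← Finset.sum_coe_sort]
  have h2 : ∀ α ∈ (Finset.univ : Finset (multiIndices n m)),
      ENNReal.ofReal (radialWeight n m σ x) * ‖multiDeriv α.1 f x‖ₑ ≤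
        ‖weightedDerivs n m p σ f x‖ₑ := by
    intro α _
    refine le_trans (le_of_eq ?_) (PiLp.enorm_apply_le (weightedDerivs n m p σ f x) α)
    simp only [weightedDerivs]
    rw [enorm_mul]
    congr 1
    rw [← ofReal_norm, Complex.norm_real, Real.norm_of_nonneg (radialWeight_nonneg ..)]
  refine (Finset.sum_le_sum h2).trans (le_of_eq ?_)
  simp

variable [NeZero m]

theorem enorm_eq_eLpNorm_weightedDerivs (f : CompactlySupported n m p σ) :
    ‖f‖ₑ = eLpNorm (weightedDerivs n m p σ f) p (ballMeasure n) := by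
  have h : ‖f‖ = ‖(memLp_weightedDerivs f).toLp‖ := weightedNorm_eq f
  rw [← ofReal_norm, h, ofReal_norm, Lp.enorm_toLp]

theorem enorm_rpow_eq (f : CompactlySupported n m p σ) :
    ‖f‖ₑ ^ (p : ℝ) = ∫⁻ x, ‖weightedDerivs n m p σ f x‖ₑ ^ (p : ℝ) ∂(ballMeasure n) := by
  rw [enorm_eq_eLpNorm_weightedDerivs, eLpNorm_rpow_eq_lintegral]

variable (n m p σ)

theorem exists_enorm_rpow_le_energy : ∃ C : ℝ≥0∞, C ≠ ∞ ∧ ∀ f : CompactlySupported n m p σ,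
    ‖f‖ₑ ^ (p : ℝ) ≤ C * ∫⁻ x, energyDensity m σ f x ^ (p : ℝ) := by
  have hp := one_le_coe_of_fact (p := p)
  refine ⟨((multiIndices n m).card : ℝ≥0∞) ^ (p : ℝ), by finiteness, fun f => ?_⟩
  rw [enorm_rpow_eq, ← setLIntegral_ball_eq, ← lintegral_const_mul' _ _ (by finiteness)]
  · refine lintegral_mono fun x => ?_
    rw [← ENNReal.mul_rpow_of_nonneg _ _ (by linarith)]
    exact ENNReal.rpow_le_rpow (enorm_weightedDerivs_le f x) (by linarith)
  · intro x hx
    rw [f.energyDensity_eq_zero hx, ENNReal.zero_rpow_of_pos (by linarith)]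

theorem exists_energy_le_enorm_rpow : ∃ C : ℝ≥0∞, C ≠ ∞ ∧ ∀ f : CompactlySupported n m p σ,
    ∫⁻ x, energyDensity m σ f x ^ (p : ℝ) ≤ C * ‖f‖ₑ ^ (p : ℝ) := by
  have hp := one_le_coe_of_fact (p := p)
  refine ⟨((n : ℝ≥0∞) ^ m * (multiIndices n m).card) ^ (p : ℝ), by finiteness, fun f => ?_⟩
  rw [enorm_rpow_eq, ← setLIntegral_ball_eq, ← lintegral_const_mul' _ _ (by finiteness)]
  · refine lintegral_mono fun x => ?_
    rw [← ENNReal.mul_rpow_of_nonneg _ _ (by linarith)]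
    exact ENNReal.rpow_le_rpow (energyDensity_le f.contDiff x) (by linarith)
  · intro x hx
    rw [f.energyDensity_eq_zero hx, ENNReal.zero_rpow_of_pos (by linarith)]

/-- The weighted Hardy inequality on `C_0^m(B)`. -/
theorem exists_lintegral_logWeight_le (hn : 1 ≤ n) (hσ : 0 < σ) :
    ∃ C : ℝ≥0∞, C ≠ ∞ ∧ ∀ f : CompactlySupported n m p σ,
      ∫⁻ x, (ENNReal.ofReal (logWeight x ^ σ) * ‖f x‖ₑ) ^ (p : ℝ) ≤ C * ‖f‖ₑ ^ (p : ℝ) := by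
  have hp := one_le_coe_of_fact (p := p)
  obtain ⟨C₁, hC₁, h₁⟩ := exists_lintegral_ray_le (V := EuclideanSpace ℝ (Fin n)) volume
    (by simpa using hn) hp hσ
  obtain ⟨C₂, hC₂, h₂⟩ := exists_energy_le_enorm_rpow n m p σ
  refine ⟨C₁ * C₂, by finiteness, fun f => ?_⟩
  set H : EuclideanSpace ℝ (Fin n) → ℝ≥0∞ := fun x => ‖x‖ₑ ^ m * ‖iteratedFDeriv ℝ m f x‖ₑ with hH
  have hHm : Measurable H :=
    (measurable_enorm.pow_const m).mul
      (f.contDiff.continuous_iteratedFDeriv le_rfl).enorm.measurable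
  have hdens : ∀ x, ENNReal.ofReal (logWeight x ^ σ) * H x = energyDensity m σ f x := by
    intro x
    have hw := logWeight_pos x
    rw [hH, energyDensity, ← mul_assoc]
    congr 1
    rw [← ofReal_norm, ← ENNReal.ofReal_pow (norm_nonneg _), ← ENNReal.ofReal_mul (by positivity),
      radialWeight, mul_comm]
    rfl
  have h3 := h₁ H hHm fun x hx => by simp [hH, f.iteratedFDeriv_eq_zero m hx]
  simp only [hdens] at h3
  calc _ ≤ ∫⁻ x, (ENNReal.ofReal (logWeight x ^ σ) *
        ∫⁻ t in Set.Ici (1 : ℝ), ENNReal.ofReal t⁻¹ * H (t • x)) ^ (p : ℝ) := by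
        refine lintegral_mono_ae ?_
        have hnt : Nontrivial (EuclideanSpace ℝ (Fin n)) := by
          have : Nonempty (Fin n) := ⟨⟨0, hn⟩⟩
          infer_instance
        filter_upwards [Measure.ae_ne volume (0 : EuclideanSpace ℝ (Fin n))] with x hx
        refine ENNReal.rpow_le_rpow (mul_le_mul' le_rfl ?_) (by linarith)
        exact enorm_le_lintegral_ray (NeZero.ne m) f.contDiff f.hasCompactSupport hx
    _ ≤ C₁ * ∫⁻ x, energyDensity m σ f x ^ (p : ℝ) := h3
    _ ≤ C₁ * (C₂ * ‖f‖ₑ ^ (p : ℝ)) := mul_le_mul' le_rfl (h₂ f)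
    _ = _ := by rw [mul_assoc]

end EnergyDensity

/-! ### Extension of bounded maps to the completion. -/

section Extension

variable {X Y : Type*} [SeminormedAddCommGroup X] [NormedSpace ℂ X] [NormedAddCommGroup Y]
  [NormedSpace ℂ Y]

theorem opNorm_le_of_coe {T : UniformSpace.Completion X →L[ℂ] Y} {C : ℝ} (hC : 0 ≤ C)
    (h : ∀ f : X, ‖T (f : UniformSpace.Completion X)‖ ≤ C * ‖f‖) :
    ‖T‖ ≤ C := by
  refine T.opNorm_le_bound hC fun x => ?_
  induction x using UniformSpace.Completion.induction_on with
  | hp => exact isClosed_le (by fun_prop) (by fun_prop)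
  | ih f => simpa using h f

variable [CompleteSpace Y]

/-- The extension of a bounded linear map to the completion of its domain. -/
def extendToCompletion (T : X →ₗ[ℂ] Y) :
    UniformSpace.Completion X →L[ℂ] Y :=
  T.extendOfNorm (UniformSpace.Completion.toComplₗᵢ (𝕜 := ℂ) (E := X)).toLinearMap

theorem extendToCompletion_coe {T : X →ₗ[ℂ] Y}
    (hT : ∃ C, ∀ f, ‖T f‖ ≤ C * ‖f‖) (f : X) :
    extendToCompletion T (f : UniformSpace.Completion X) = T f := by
  refine LinearMap.extendOfNorm_eq (e := (UniformSpace.Completion.toComplₗᵢ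
    (E := X)).toLinearMap) UniformSpace.Completion.denseRange_coe ?_ f
  obtain ⟨C, hC⟩ := hT
  refine ⟨C, fun f => ?_⟩
  simpa using hC f

/-- A finite-dimensional span is closed, so by density the extension takes its values in it as well.
-/
theorem rank_extendToCompletion_le {T : X →ₗ[ℂ] Y}
    (hT : ∃ C, ∀ f, ‖T f‖ ≤ C * ‖f‖) {K : Type*} [Fintype K] {e : K → Y}
    (he : ∀ f, T f ∈ Submodule.span ℂ (Set.range e)) :
    (extendToCompletion T : UniformSpace.Completion X →ₗ[ℂ] Y).rank ≤ Fintype.card K := by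
  set W := Submodule.span ℂ (Set.range e) with hW
  have hfd : FiniteDimensional ℂ W := FiniteDimensional.span_of_finite ℂ (Set.finite_range e)
  have hcl : IsClosed (W : Set Y) := W.closed_of_finiteDimensional
  have hle : LinearMap.range (extendToCompletion T : UniformSpace.Completion X →ₗ[ℂ] Y) ≤
      W := by
    rintro _ ⟨x, rfl⟩
    change extendToCompletion T x ∈ W
    induction x using UniformSpace.Completion.induction_on with
    | hp => exact hcl.preimage (extendToCompletion T).continuous
    | ih f => rw [extendToCompletion_coe hT]; exact he f
  refine (Submodule.rank_mono hle).trans ?_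
  rw [← Module.finrank_eq_rank]
  exact_mod_cast finrank_range_le_card (R := ℂ) e

end Extension

/-! ### Boundedness of the inclusion into L_p(B). -/

section Embedding

variable {n m : ℕ} {p : ℝ≥0} [Fact (1 ≤ (p : ℝ≥0∞))] {σ : ℝ}

theorem enorm_toLpBall_rpow (f : CompactlySupported n m p σ) :
    ‖f.toLpBall‖ₑ ^ (p : ℝ) = ∫⁻ x, ‖f x‖ₑ ^ (p : ℝ) := by
  have hp := one_le_coe_of_fact (p := p)
  rw [CompactlySupported.toLpBall, Lp.enorm_toLp, eLpNorm_rpow_eq_lintegral, setLIntegral_ball_eq]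
  intro x hx
  rw [f.apply_eq_zero hx, enorm_zero, ENNReal.zero_rpow_of_pos (by linarith)]

/-- The inclusion `C_0^m(B) ⊂ L_p(B)` as a linear map. -/
def toLpBallₗ (n m : ℕ) (p : ℝ≥0) [Fact (1 ≤ (p : ℝ≥0∞))] (σ : ℝ) :
    CompactlySupported n m p σ →ₗ[ℂ] LpBall n p where
  toFun f := f.toLpBall
  map_add' _ _ := rfl
  map_smul' _ _ := rfl

theorem norm_le_mul_of_enorm_rpow_le {X Y : Type*} [SeminormedAddCommGroup X]
    [SeminormedAddCommGroup Y] {x : X} {y : Y} {C : ℝ≥0∞} (hC : C ≠ ∞) {ε : ℝ} (hε : 0 ≤ ε)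
    (h : ‖y‖ₑ ^ (p : ℝ) ≤ C * (ENNReal.ofReal ε * ‖x‖ₑ) ^ (p : ℝ)) :
    ‖y‖ ≤ (C ^ (1 / (p : ℝ))).toReal * ε * ‖x‖ := by
  have hp := one_le_coe_of_fact (p := p)
  have hp0 : (0 : ℝ) < p := by linarith
  have h1 := ENNReal.rpow_le_rpow h (by positivity : (0 : ℝ) ≤ 1 / p)
  rw [ENNReal.mul_rpow_of_nonneg _ _ (by positivity), ← ENNReal.rpow_mul, ← ENNReal.rpow_mul,
    mul_one_div_cancel hp0.ne', ENNReal.rpow_one, ENNReal.rpow_one] at h1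
  have hfin : C ^ (1 / (p : ℝ)) ≠ ∞ := ENNReal.rpow_ne_top_of_nonneg (by positivity) hC
  have h2 := ENNReal.toReal_mono (by finiteness) h1
  rw [ENNReal.toReal_mul, ENNReal.toReal_mul, toReal_enorm, toReal_enorm,
    ENNReal.toReal_ofReal hε, ← mul_assoc] at h2
  exact h2

variable [NeZero m] (n m p σ)

/-- This is the Hardy inequality with the factor (1 + |log |x||)^σ ≥ 1 dropped. -/
theorem exists_norm_toLpBall_le (hn : 1 ≤ n) (hσ : 0 < σ) :
    ∃ C, ∀ f : CompactlySupported n m p σ, ‖toLpBallₗ n m p σ f‖ ≤ C * ‖f‖ := by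
  have hp := one_le_coe_of_fact (p := p)
  obtain ⟨C, hC, h⟩ := exists_lintegral_logWeight_le n m p σ hn hσ
  refine ⟨(C ^ (1 / (p : ℝ))).toReal * 1, fun f => ?_⟩
  refine norm_le_mul_of_enorm_rpow_le hC zero_le_one ?_
  rw [ENNReal.ofReal_one, one_mul]
  refine le_trans ?_ (h f)
  change ‖f.toLpBall‖ₑ ^ (p : ℝ) ≤ _
  rw [enorm_toLpBall_rpow]
  refine lintegral_mono fun x => ENNReal.rpow_le_rpow ?_ (by linarith)
  refine le_mul_of_one_le_left' ?_
  rw [ENNReal.one_le_ofReal]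
  exact Real.one_le_rpow (one_le_logWeight x) hσ.le

end Embedding

/-! ### Piecewise polynomial operators of finite rank. -/

section PiecewisePolynomial

variable {n m : ℕ} {p : ℝ≥0} {σ : ℝ}

instance : IsFiniteMeasure (ballMeasure n) :=
  ⟨by simpa [unitBall] using measure_ball_lt_top⟩

theorem memLp_indicator_taylorMonomial {Q : Set (EuclideanSpace ℝ (Fin n))} (hQ : MeasurableSet Q)
    (κ : TaylorIndex n m) : MemLp (Q.indicator (taylorMonomial κ)) p (ballMeasure n) := by
  refine MemLp.indicator hQ ?_
  obtain ⟨C, hC⟩ :=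
    (isCompact_closedBall (0 : EuclideanSpace ℝ (Fin n)) 1).exists_bound_of_continuousOn
    (continuous_taylorMonomial κ).continuousOn
  refine MemLp.of_bound (continuous_taylorMonomial κ).aestronglyMeasurable C ?_
  filter_upwards [ae_restrict_mem (unitBall n).isOpen.measurableSet] with x hx
  exact hC x (Metric.ball_subset_closedBall hx)

variable [Fact (1 ≤ (p : ℝ≥0∞))]

/-- The average over `Q` of a coefficient of the Taylor polynomial, as a linear functional. -/
def averagedCoeff {Q : Set (EuclideanSpace ℝ (Fin n))} (hb : Bornology.IsBounded Q)
    (κ : TaylorIndex n m) : CompactlySupported n m p σ →ₗ[ℂ] ℂ where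
  toFun f := ⨍ y in Q, taylorCoeff κ f y
  map_add' f g := by
    have hint : ∀ f : CompactlySupported n m p σ, IntegrableOn (taylorCoeff κ f) Q := fun f =>
      ((continuous_taylorCoeff κ f.contDiff).continuousOn.integrableOn_compact
        hb.isCompact_closure).mono_set subset_closure
    simp only [CompactlySupported.coe_add, taylorCoeff_add κ f.contDiff g.contDiff, setAverage_eq]
    rw [integral_add (hint f) (hint g), smul_add]
  map_smul' c f := by
    simp only [CompactlySupported.coe_smul, taylorCoeff_smul κ c f.contDiff, setAverage_eq]
    rw [integral_smul, smul_comm]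
    rfl

variable {I : Type*} [Fintype I] {Q : I → Set (EuclideanSpace ℝ (Fin n))}
  (hQ : ∀ i, MeasurableSet (Q i)) (hb : ∀ i, Bornology.IsBounded (Q i))

/-- The operator replacing `f` on each `Q i` by its averaged Taylor polynomial. -/
def piecewiseTaylor (m : ℕ) (p : ℝ≥0) [Fact (1 ≤ (p : ℝ≥0∞))] (σ : ℝ) :
    CompactlySupported n m p σ →ₗ[ℂ] LpBall n p :=
  ∑ j : I × TaylorIndex n m, (averagedCoeff (hb j.1) j.2).smulRight
    (memLp_indicator_taylorMonomial (p := p) (hQ j.1) j.2).toLp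

theorem piecewiseTaylor_apply (f : CompactlySupported n m p σ) :
    piecewiseTaylor hQ hb m p σ f = ∑ j : I × TaylorIndex n m,
      (⨍ y in Q j.1, taylorCoeff j.2 f y) •
        (memLp_indicator_taylorMonomial (p := p) (hQ j.1) j.2).toLp := by
  simp only [piecewiseTaylor, LinearMap.sum_apply, LinearMap.smulRight_apply]
  rfl

theorem piecewiseTaylor_mem_span (f : CompactlySupported n m p σ) :
    piecewiseTaylor hQ hb m p σ f ∈ Submodule.span ℂ (Set.range fun j : I × TaylorIndex n m =>
      (memLp_indicator_taylorMonomial (p := p) (hQ j.1) j.2).toLp) := by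
  rw [piecewiseTaylor_apply]
  exact Submodule.sum_mem _ fun j _ => Submodule.smul_mem _ _ (Submodule.subset_span ⟨j, rfl⟩)

theorem coeFn_piecewiseTaylor (f : CompactlySupported n m p σ) :
    piecewiseTaylor hQ hb m p σ f =ᵐ[ballMeasure n]
      fun x => ∑ i, (Q i).indicator (averagedTaylor volume m (Q i) f) x := by
  rw [piecewiseTaylor_apply]
  have h1 : ∀ j : I × TaylorIndex n m, ∀ᵐ x ∂(ballMeasure n),
      ((⨍ y in Q j.1, taylorCoeff j.2 f y) •
        (memLp_indicator_taylorMonomial (p := p) (hQ j.1) j.2).toLp : LpBall n p) x =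
      (⨍ y in Q j.1, taylorCoeff j.2 f y) * (Q j.1).indicator (taylorMonomial j.2) x := by
    intro j
    filter_upwards [Lp.coeFn_smul (⨍ y in Q j.1, taylorCoeff j.2 f y)
      (memLp_indicator_taylorMonomial (p := p) (hQ j.1) j.2).toLp,
      (memLp_indicator_taylorMonomial (p := p) (hQ j.1) j.2).coeFn_toLp] with x hx1 hx2
    rw [hx1, Pi.smul_apply, hx2, smul_eq_mul]
  filter_upwards [Lp.coeFn_fun_finsetSum Finset.univ fun j : I × TaylorIndex n m =>
    ((⨍ y in Q j.1, taylorCoeff j.2 f y) •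
      (memLp_indicator_taylorMonomial (p := p) (hQ j.1) j.2).toLp : LpBall n p),
    ae_all_iff.2 h1] with x hx1 hx2
  rw [hx1, Finset.sum_congr rfl fun j _ => hx2 j, Fintype.sum_prod_type]
  refine Finset.sum_congr rfl fun i _ => ?_
  by_cases hx : x ∈ Q i
  · simp only [Set.indicator_of_mem hx]
    exact (averagedTaylor_eq_sum (hb i) f.contDiff x).symm
  · simp [Set.indicator_of_notMem hx]

/-- On a cell only its own polynomial is subtracted. Off the cells the operator gives zero and the
error is f itself, dominated by W f; the origin, where nothing is assumed of W, is a null set. -/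
theorem enorm_toLpBall_sub_piecewiseTaylor_rpow_le (hdisj : Pairwise (Function.onFun Disjoint Q))
    (hn : 1 ≤ n) (f : CompactlySupported n m p σ) {W : EuclideanSpace ℝ (Fin n) → ℝ≥0∞}
    (hW : ∀ x, x ≠ 0 → ‖x‖ < 1 → (∀ i, x ∉ Q i) → 1 ≤ W x) :
    ‖f.toLpBall - piecewiseTaylor hQ hb m p σ f‖ₑ ^ (p : ℝ) ≤
      (∑ i, ∫⁻ x in Q i, ‖f x - averagedTaylor volume m (Q i) f x‖ₑ ^ (p : ℝ)) +
        ∫⁻ x, (W x * ‖f x‖ₑ) ^ (p : ℝ) := by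
  have hp := one_le_coe_of_fact (p := p)
  rw [Lp.enorm_def, eLpNorm_rpow_eq_lintegral]
  have hf : f.toLpBall =ᵐ[ballMeasure n] f := MemLp.coeFn_toLp _
  have hmeas : ∀ i, Measurable ((Q i).indicator
      fun x => ‖f x - averagedTaylor volume m (Q i) f x‖ₑ ^ (p : ℝ)) := by
    intro i
    refine Measurable.indicator ?_ (hQ i)
    have h1 : Continuous (averagedTaylor volume m (Q i) f) := by
      rw [show averagedTaylor volume m (Q i) f = _ from
        funext (averagedTaylor_eq_sum (hb i) f.contDiff)]
      exact continuous_finsetSum _ fun κ _ => continuous_const.mul (continuous_taylorMonomial κ)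
    exact ((f.contDiff.continuous.sub h1).enorm.measurable).pow_const _
  calc _ ≤ ∫⁻ x, (∑ i, (Q i).indicator
          (fun x => ‖f x - averagedTaylor volume m (Q i) f x‖ₑ ^ (p : ℝ)) x +
          (W x * ‖f x‖ₑ) ^ (p : ℝ)) ∂(ballMeasure n) := by
        refine lintegral_mono_ae ?_
        have : Nonempty (Fin n) := ⟨⟨0, hn⟩⟩
        filter_upwards [ae_restrict_of_ae (Measure.ae_ne volume (0 : EuclideanSpace ℝ (Fin n))),
          Lp.coeFn_sub f.toLpBall (piecewiseTaylor hQ hb m p σ f), hf,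
          coeFn_piecewiseTaylor hQ hb f,
          ae_restrict_mem (unitBall n).isOpen.measurableSet] with x h0 h1 h2 h3 h4
        rw [h1, Pi.sub_apply, h2, h3]
        have hx1 : ‖x‖ < 1 := by simpa [unitBall] using h4
        by_cases hx : ∃ i, x ∈ Q i
        · obtain ⟨i, hi⟩ := hx
          have hne : ∀ j, j ≠ i → x ∉ Q j := fun j hj hxj =>
            Set.disjoint_left.1 (hdisj hj) hxj hi
          refine le_add_right ?_
          rw [Finset.sum_eq_single i, Finset.sum_eq_single i, Set.indicator_of_mem hi,
            Set.indicator_of_mem hi]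
          · intro j _ hj; exact Set.indicator_of_notMem (hne j hj) _
          · simp
          · intro j _ hj; exact Set.indicator_of_notMem (hne j hj) _
          · simp
        · push Not at hx
          refine le_add_left ?_
          rw [Finset.sum_eq_zero fun i _ => Set.indicator_of_notMem (hx i) _, sub_zero]
          exact ENNReal.rpow_le_rpow (le_mul_of_one_le_left' (hW x h0 hx1 hx)) (by linarith)
    _ ≤ ∫⁻ x, (∑ i, (Q i).indicator
          (fun x => ‖f x - averagedTaylor volume m (Q i) f x‖ₑ ^ (p : ℝ)) x +
          (W x * ‖f x‖ₑ) ^ (p : ℝ)) := lintegral_mono' Measure.restrict_le_self le_rfl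
    _ = _ := by
        rw [lintegral_add_left (Finset.measurable_fun_sum _ fun i _ => hmeas i),
          lintegral_finsetSum _ fun i _ => hmeas i]
        congr 1
        exact Finset.sum_congr rfl fun i _ => lintegral_indicator (hQ i) _

end PiecewisePolynomial

/-! ### Approximation of the embedding on a partition. -/

section UpperBound

variable (n m : ℕ) [NeZero m] (p : ℝ≥0) [Fact (1 ≤ (p : ℝ≥0∞))] (σ : ℝ)

/-- The embedding of `E^m_{p,σ}(B)` into `L_p(B)`. -/
def embedding : WeightedSobolev n m p σ →L[ℂ] LpBall n p :=
  extendToCompletion (toLpBallₗ n m p σ)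

theorem embedding_coe (hn : 1 ≤ n) (hσ : 0 < σ) (f : CompactlySupported n m p σ) :
    embedding n m p σ (f : WeightedSobolev n m p σ) = f.toLpBall :=
  extendToCompletion_coe (exists_norm_toLpBall_le n m p σ hn hσ) f

/-- A partition into convex sets that are small compared with the weight yields an
approximation of the embedding by operators of finite rank. -/
theorem exists_finiteRank_approx (hn : 1 ≤ n) (hσ : 0 < σ) : ∃ C : ℝ, 0 < C ∧
    ∀ {I : Type} [Fintype I] (Q : I → Set (EuclideanSpace ℝ (Fin n))) (d : I → ℝ) (ε : ℝ),
      (∀ i, MeasurableSet (Q i)) → (∀ i, Bornology.IsBounded (Q i)) → (∀ i, Convex ℝ (Q i)) →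
      Pairwise (Function.onFun Disjoint Q) → 0 ≤ ε →
      (∀ i, ∀ x ∈ Q i, ∀ y ∈ Q i, ‖x - y‖ ≤ d i) → (∀ i, 0 ≤ d i) →
      (∀ i, ∀ x ∈ Q i, ‖x‖ < 1 → d i ^ m ≤ ε * radialWeight n m σ x) →
      (∀ x, x ≠ 0 → ‖x‖ < 1 → (∀ i, x ∉ Q i) → 1 ≤ ε * logWeight x ^ σ) →
      ∃ S : WeightedSobolev n m p σ →L[ℂ] LpBall n p,
        (S : WeightedSobolev n m p σ →ₗ[ℂ] LpBall n p).rank ≤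
          (Fintype.card I * Fintype.card (TaylorIndex n m) : ℕ) ∧
        ‖embedding n m p σ - S‖ ≤ C * ε := by
  have hp := one_le_coe_of_fact (p := p)
  have hp0 : (0 : ℝ) < p := by linarith
  obtain ⟨C₁, hC₁, h₁⟩ := exists_lintegral_logWeight_le n m p σ hn hσ
  obtain ⟨C₂, hC₂, h₂⟩ := exists_energy_le_enorm_rpow n m p σ
  -- The first summand pays for the cells (Poincaré), the second for the uncovered part (Hardy).
  set C : ℝ≥0∞ := 2 ^ n * C₂ + C₁ with hC
  have hCfin : C ≠ ∞ := by finiteness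
  refine ⟨(C ^ (1 / (p : ℝ))).toReal + 1, by positivity, ?_⟩
  intro I _ Q d ε hQ hb hconv hdisj hε hd hd0 hdw hW
  have hbound : ∀ f : CompactlySupported n m p σ,
      ‖toLpBallₗ n m p σ f - piecewiseTaylor hQ hb m p σ f‖ ≤
        ((C ^ (1 / (p : ℝ))).toReal + 1) * ε * ‖f‖ := by
    intro f
    have key : ‖toLpBallₗ n m p σ f - piecewiseTaylor hQ hb m p σ f‖ₑ ^ (p : ℝ) ≤
        C * (ENNReal.ofReal ε * ‖f‖ₑ) ^ (p : ℝ) := by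
      have hlog : ∀ x : EuclideanSpace ℝ (Fin n), 0 ≤ logWeight x ^ σ := fun x =>
        Real.rpow_nonneg (logWeight_pos x).le _
      refine (enorm_toLpBall_sub_piecewiseTaylor_rpow_le hQ hb hdisj hn f
        (W := fun x => ENNReal.ofReal ε * ENNReal.ofReal (logWeight x ^ σ)) ?_).trans ?_
      · intro x hx0 hx1 hx
        rw [← ENNReal.ofReal_mul hε, ENNReal.one_le_ofReal]
        exact hW x hx0 hx1 hx
      rw [hC, add_mul]
      refine add_le_add ?_ ?_
      · calc _ ≤ ∑ i, 2 ^ n * ∫⁻ x in Q i,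
              (ENNReal.ofReal ε * energyDensity m σ f x) ^ (p : ℝ) := by
              refine Finset.sum_le_sum fun i _ => ?_
              refine (lintegral_sub_averagedTaylor_le volume (NeZero.ne m) hp (hQ i) (hconv i)
                (hb i) (d := ENNReal.ofReal (d i)) ?_ f.contDiff).trans ?_
              · intro x hx y hy
                rw [← ofReal_norm]
                exact ENNReal.ofReal_le_ofReal (hd i x hx y hy)
              rw [finrank_euclideanSpace_fin]
              refine mul_le_mul' le_rfl ?_
              refine setLIntegral_mono_ae' (hQ i) (ae_of_all _ fun x hx => ?_)
              refine ENNReal.rpow_le_rpow ?_ hp0.le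
              -- Cells may stick out of the ball; there the derivative of f vanishes, so the
              -- condition on `d i` is needed only inside.
              rcases lt_or_ge ‖x‖ 1 with hx1 | hx1
              · rw [energyDensity, ← mul_assoc, ← ENNReal.ofReal_mul hε,
                  ← ENNReal.ofReal_pow (hd0 i)]
                exact mul_le_mul' (ENNReal.ofReal_le_ofReal (hdw i x hx hx1)) le_rfl
              · simp [f.iteratedFDeriv_eq_zero m hx1]
          _ = 2 ^ n * ∫⁻ x in ⋃ i ∈ (Finset.univ : Finset I), Q i,
              (ENNReal.ofReal ε * energyDensity m σ f x) ^ (p : ℝ) := by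
              rw [← Finset.mul_sum, lintegral_biUnion_finset
                (fun i _ j _ hij => hdisj hij) fun i _ => hQ i]
          _ ≤ 2 ^ n * ∫⁻ x, (ENNReal.ofReal ε * energyDensity m σ f x) ^ (p : ℝ) :=
              mul_le_mul' le_rfl (setLIntegral_le_lintegral _ _)
          _ ≤ _ := by
              simp only [ENNReal.mul_rpow_of_nonneg _ _ hp0.le]
              rw [lintegral_const_mul' _ _ (by finiteness), mul_assoc, mul_left_comm C₂]
              exact mul_le_mul' le_rfl (mul_le_mul' le_rfl (h₂ f))
      · simp only [mul_assoc, ENNReal.mul_rpow_of_nonneg _ _ hp0.le]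
        rw [lintegral_const_mul' _ _ (by finiteness), mul_left_comm]
        refine mul_le_mul' le_rfl ?_
        have := h₁ f
        simpa only [ENNReal.mul_rpow_of_nonneg _ _ hp0.le] using this
    refine (norm_le_mul_of_enorm_rpow_le hCfin hε key).trans ?_
    gcongr
    linarith
  -- Boundedness follows from closeness to the bounded inclusion; the coefficient functionals are
  -- never estimated one by one.
  have hS : ∃ K, ∀ f : CompactlySupported n m p σ, ‖piecewiseTaylor hQ hb m p σ f‖ ≤ K * ‖f‖ := by
    obtain ⟨K, hK⟩ := exists_norm_toLpBall_le n m p σ hn hσ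
    refine ⟨K + ((C ^ (1 / (p : ℝ))).toReal + 1) * ε, fun f => ?_⟩
    have h1 := norm_le_norm_add_norm_sub (toLpBallₗ n m p σ f) (piecewiseTaylor hQ hb m p σ f)
    have h2 := hK f
    have h3 := hbound f
    rw [add_mul]
    linarith
  refine ⟨extendToCompletion (piecewiseTaylor hQ hb m p σ), ?_, ?_⟩
  · refine (rank_extendToCompletion_le hS (piecewiseTaylor_mem_span hQ hb)).trans ?_
    rw [Fintype.card_prod]
  · refine opNorm_le_of_coe (by positivity) fun f => ?_
    rw [sub_apply, extendToCompletion_coe hS, embedding,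
      extendToCompletion_coe (exists_norm_toLpBall_le n m p σ hn hσ)]
    exact hbound f

end UpperBound

/-! ### Graded grids on dyadic shells. -/

section Grid

variable {n : ℕ}

theorem norm_le_sum_abs (x : EuclideanSpace ℝ (Fin n)) : ‖x‖ ≤ ∑ i, |x i| := by
  have h : x = ∑ i, EuclideanSpace.single i (x i) := by
    ext j
    simp [Pi.single_apply]
  conv_lhs => rw [h]
  refine (norm_sum_le _ _).trans (le_of_eq ?_)
  simp

theorem norm_le_of_abs_le {x : EuclideanSpace ℝ (Fin n)} {r : ℝ} (h : ∀ i, |x i| ≤ r) :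
    ‖x‖ ≤ n * r := by
  refine (norm_le_sum_abs x).trans ((Finset.sum_le_sum fun i _ => h i).trans (le_of_eq ?_))
  simp

/-- The half-open cube of side length `h` with lower corner `h • z`. -/
def gridCell (h : ℝ) (z : Fin n → ℤ) : Set (EuclideanSpace ℝ (Fin n)) :=
  {x | ∀ i, ⌊x i / h⌋ = z i}

theorem mem_gridCell_iff {h : ℝ} (hh : 0 < h) {z : Fin n → ℤ} {x : EuclideanSpace ℝ (Fin n)} :
    x ∈ gridCell h z ↔ ∀ i, z i * h ≤ x i ∧ x i < (z i + 1) * h := by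
  simp only [gridCell, Set.mem_ofPred_eq, Int.floor_eq_iff, le_div_iff₀ hh, div_lt_iff₀ hh]

theorem measurableSet_gridCell (h : ℝ) (z : Fin n → ℤ) : MeasurableSet (gridCell h z) := by
  unfold gridCell
  rw [Set.ofPred_forall]
  refine MeasurableSet.iInter fun i => ?_
  have : Measurable fun x : EuclideanSpace ℝ (Fin n) => ⌊x i / h⌋ :=
    Int.measurable_floor.comp (by fun_prop)
  exact this (measurableSet_singleton (z i))

theorem convex_gridCell {h : ℝ} (hh : 0 < h) (z : Fin n → ℤ) : Convex ℝ (gridCell h z) := by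
  intro x hx y hy a b ha hb hab
  rw [mem_gridCell_iff hh] at *
  intro i
  have := convex_Ico ((z i : ℝ) * h) ((z i + 1) * h) (hx i) (hy i) ha hb hab
  simpa using this

theorem norm_sub_le_of_mem_gridCell {h : ℝ} (hh : 0 < h) {z : Fin n → ℤ}
    {x y : EuclideanSpace ℝ (Fin n)} (hx : x ∈ gridCell h z) (hy : y ∈ gridCell h z) :
    ‖x - y‖ ≤ n * h := by
  rw [mem_gridCell_iff hh] at *
  refine norm_le_of_abs_le fun i => ?_
  rw [PiLp.sub_apply, abs_le]
  constructor <;> nlinarith [(hx i).1, (hx i).2, (hy i).1, (hy i).2]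

theorem isBounded_gridCell {h : ℝ} (hh : 0 < h) (z : Fin n → ℤ) :
    Bornology.IsBounded (gridCell h z) := by
  rw [Metric.isBounded_iff]
  exact ⟨n * h, fun x hx y hy => by
    rw [dist_eq_norm]; exact norm_sub_le_of_mem_gridCell hh hx hy⟩

/-- The half-open cube `[-2⁻ʲ, 2⁻ʲ)ⁿ`. -/
def dyadicCube (n j : ℕ) : Set (EuclideanSpace ℝ (Fin n)) :=
  {x | ∀ i, -(1 / 2 : ℝ) ^ j ≤ x i ∧ x i < (1 / 2 : ℝ) ^ j}

theorem dyadicCube_anti {j k : ℕ} (h : j ≤ k) : dyadicCube n k ⊆ dyadicCube n j := by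
  intro x hx i
  have h1 : (1 / 2 : ℝ) ^ k ≤ (1 / 2 : ℝ) ^ j :=
    pow_le_pow_of_le_one (by norm_num) (by norm_num) h
  exact ⟨by linarith [(hx i).1], by linarith [(hx i).2]⟩

theorem norm_le_of_mem_dyadicCube {j : ℕ} {x : EuclideanSpace ℝ (Fin n)}
    (hx : x ∈ dyadicCube n j) : ‖x‖ ≤ n * (1 / 2 : ℝ) ^ j :=
  norm_le_of_abs_le fun i => abs_le.2 ⟨(hx i).1, (hx i).2.le⟩

theorem le_norm_of_notMem_dyadicCube {j : ℕ} {x : EuclideanSpace ℝ (Fin n)}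
    (hx : x ∉ dyadicCube n j) : (1 / 2 : ℝ) ^ j ≤ ‖x‖ := by
  simp only [dyadicCube, Set.mem_ofPred_eq, not_forall, not_and_or, not_le, not_lt] at hx
  obtain ⟨i, hi⟩ := hx
  refine le_trans ?_ (PiLp.norm_apply_le x i)
  rw [Real.norm_eq_abs, le_abs]
  rcases hi with hi | hi
  · right; linarith
  · left; exact hi

theorem zero_mem_dyadicCube (j : ℕ) : (0 : EuclideanSpace ℝ (Fin n)) ∈ dyadicCube n j := by
  intro i
  have : (0 : ℝ) < (1 / 2 : ℝ) ^ j := by positivity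
  exact ⟨by simp, by simp⟩

theorem mem_dyadicCube_zero {x : EuclideanSpace ℝ (Fin n)} (hx : ‖x‖ < 1) :
    x ∈ dyadicCube n 0 := by
  by_contra h
  have := le_norm_of_notMem_dyadicCube h
  norm_num at this
  linarith

/-- From ‖x‖ ≤ n 2^(-j) one gets |log ‖x‖| ≥ j log 2 - log n, and dividing by 1 + log n absorbs the
loss for small j. The origin is excluded because `Real.log 0 = 0` gives it weight 1 although it lies
in every cube. -/
theorem exists_mul_le_logWeight (hn : 1 ≤ n) : ∃ c : ℝ, 0 < c ∧
    ∀ (j : ℕ) (x : EuclideanSpace ℝ (Fin n)), x ≠ 0 → ‖x‖ < 1 → x ∈ dyadicCube n j →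
      c * (1 + j) ≤ logWeight x := by
  have hn0 : (0 : ℝ) < n := by exact_mod_cast hn
  have hL : 0 ≤ Real.log n := Real.log_nonneg (by exact_mod_cast hn)
  have h2 : 0 < Real.log 2 := Real.log_pos (by norm_num)
  have h2' : Real.log 2 ≤ 1 := by
    have := Real.log_le_sub_one_of_pos (by norm_num : (0 : ℝ) < 2)
    linarith
  refine ⟨Real.log 2 / (1 + Real.log n), by positivity, fun j x hx0 hx1 hx => ?_⟩
  have hxn : 0 < ‖x‖ := norm_pos_iff.2 hx0
  have h3 : Real.log ‖x‖ ≤ Real.log n - j * Real.log 2 := by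
    refine (Real.log_le_log hxn (norm_le_of_mem_dyadicCube hx)).trans (le_of_eq ?_)
    rw [Real.log_mul hn0.ne' (by positivity), Real.log_pow, one_div, Real.log_inv]
    ring
  have h4 : -Real.log ‖x‖ ≤ |Real.log ‖x‖| := neg_le_abs _
  have h5 := abs_nonneg (Real.log ‖x‖)
  rw [div_mul_eq_mul_div, div_le_iff₀ (by positivity), logWeight]
  nlinarith

/-- The integer points of `[-2M, 2M)ⁿ` outside `[-M, M)ⁿ`. -/
def shell (n M : ℕ) : Finset (Fin n → ℤ) :=
  Fintype.piFinset (fun _ => Finset.Ico (-(2 * M : ℤ)) (2 * M)) \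
    Fintype.piFinset (fun _ => Finset.Ico (-(M : ℤ)) M)

theorem card_shell_le (n M : ℕ) : (shell n M).card ≤ (4 * M) ^ n := by
  refine (Finset.card_le_card Finset.sdiff_subset).trans (le_of_eq ?_)
  rw [Fintype.card_piFinset_const, Int.card_Ico]
  congr 1
  omega

/-- The mesh size of the grid used in the `j`-th dyadic shell. -/
def mesh (j M : ℕ) : ℝ := (1 / 2) ^ (j + 1) / M

theorem mesh_pos (j : ℕ) {M : ℕ} (hM : 0 < M) : 0 < mesh j M := by
  have : (0 : ℝ) < M := by exact_mod_cast hM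
  unfold mesh; positivity

theorem mul_mesh (j : ℕ) {M : ℕ} (hM : 0 < M) : M * mesh j M = (1 / 2) ^ (j + 1) := by
  have : (M : ℝ) ≠ 0 := by exact_mod_cast hM.ne'
  unfold mesh; field_simp

/-- The mesh divides 2^(-(j+1)) exactly, so no cell straddles the boundary of the cube and
membership depends only on z. -/
theorem mem_dyadicCube_succ_iff {j M : ℕ} (hM : 0 < M) {z : Fin n → ℤ}
    {x : EuclideanSpace ℝ (Fin n)} (hx : x ∈ gridCell (mesh j M) z) :
    x ∈ dyadicCube n (j + 1) ↔ ∀ i, z i ∈ Finset.Ico (-(M : ℤ)) M := by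
  have hh := mesh_pos j hM
  refine forall_congr' fun i => ?_
  rw [← hx i, Finset.mem_Ico, Int.le_floor, Int.floor_lt, le_div_iff₀ hh, div_lt_iff₀ hh]
  push_cast
  rw [neg_mul, mul_mesh j hM]

theorem mem_dyadicCube_iff {j M : ℕ} (hM : 0 < M) {z : Fin n → ℤ}
    {x : EuclideanSpace ℝ (Fin n)} (hx : x ∈ gridCell (mesh j M) z) :
    x ∈ dyadicCube n j ↔ ∀ i, z i ∈ Finset.Ico (-(2 * M : ℤ)) (2 * M) := by
  have hh := mesh_pos j hM
  refine forall_congr' fun i => ?_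
  rw [← hx i, Finset.mem_Ico, Int.le_floor, Int.floor_lt, le_div_iff₀ hh, div_lt_iff₀ hh]
  push_cast
  rw [neg_mul, mul_assoc, mul_mesh j hM, pow_succ]
  ring_nf

theorem mem_shell_iff {j M : ℕ} (hM : 0 < M) {z : Fin n → ℤ}
    {x : EuclideanSpace ℝ (Fin n)} (hx : x ∈ gridCell (mesh j M) z) :
    z ∈ shell n M ↔ x ∈ dyadicCube n j ∧ x ∉ dyadicCube n (j + 1) := by
  rw [shell, Finset.mem_sdiff, Fintype.mem_piFinset, Fintype.mem_piFinset,
    mem_dyadicCube_iff hM hx, mem_dyadicCube_succ_iff hM hx]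

/-- The cells of a graded grid with `M j` subdivisions in the `j`-th dyadic shell. -/
abbrev CellIndex (n J : ℕ) (M : ℕ → ℕ) : Type := Σ j : Fin J, {z // z ∈ shell n (M j)}

/-- The cell with index `a`, with the shells starting at level `j₀`. -/
def cell {n J : ℕ} {M : ℕ → ℕ} (j₀ : ℕ) (a : CellIndex n J M) : Set (EuclideanSpace ℝ (Fin n)) :=
  gridCell (mesh (j₀ + a.1) (M a.1)) a.2.1

theorem card_cellIndex_le (n J : ℕ) (M : ℕ → ℕ) :
    Fintype.card (CellIndex n J M) ≤ 4 ^ n * ∑ j ∈ Finset.range J, M j ^ n := by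
  rw [Fintype.card_sigma, Finset.sum_range, Finset.mul_sum]
  refine Finset.sum_le_sum fun j _ => ?_
  rw [Fintype.card_coe, ← mul_pow]
  exact card_shell_le n _

/-- The block [M, 2M)ⁿ already lies in the shell; n ≥ 1 provides a coordinate that leaves the inner
cube. -/
theorem pow_le_card_shell (hn : 1 ≤ n) (M : ℕ) : M ^ n ≤ (shell n M).card := by
  have h : Fintype.piFinset (fun _ : Fin n => Finset.Ico (M : ℤ) (2 * M)) ⊆ shell n M := by
    intro z hz
    rw [Fintype.mem_piFinset] at hz
    rw [shell, Finset.mem_sdiff, Fintype.mem_piFinset, Fintype.mem_piFinset]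
    simp only [Finset.mem_Ico] at *
    refine ⟨fun i => ⟨by linarith [(hz i).1, (hz i).2], (hz i).2⟩, fun h => ?_⟩
    have := h ⟨0, hn⟩
    linarith [(hz ⟨0, hn⟩).1, this.2]
  refine le_trans (le_of_eq ?_) (Finset.card_le_card h)
  rw [Fintype.card_piFinset_const, Int.card_Ico]
  congr 1
  omega

theorem le_card_cellIndex (hn : 1 ≤ n) (J : ℕ) (M : ℕ → ℕ) :
    ∑ j ∈ Finset.range J, M j ^ n ≤ Fintype.card (CellIndex n J M) := by
  rw [Fintype.card_sigma, Finset.sum_range]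
  refine Finset.sum_le_sum fun j _ => ?_
  rw [Fintype.card_coe]
  exact pow_le_card_shell hn _

variable {J : ℕ} {M : ℕ → ℕ}

theorem mem_dyadicCube_of_mem_cell (hM : ∀ j < J, 0 < M j) {j₀ : ℕ} {a : CellIndex n J M}
    {x : EuclideanSpace ℝ (Fin n)} (hx : x ∈ cell j₀ a) :
    x ∈ dyadicCube n (j₀ + a.1) ∧ x ∉ dyadicCube n (j₀ + a.1 + 1) :=
  (mem_shell_iff (hM a.1 a.1.2) hx).1 a.2.2

theorem pairwise_disjoint_cell (hM : ∀ j < J, 0 < M j) (j₀ : ℕ) :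
    Pairwise (Function.onFun Disjoint (cell (n := n) (J := J) (M := M) j₀)) := by
  rintro ⟨j, z⟩ ⟨k, w⟩ hne
  rw [Function.onFun, Set.disjoint_left]
  intro x hx hy
  have h1 := mem_dyadicCube_of_mem_cell hM hx
  have h2 := mem_dyadicCube_of_mem_cell hM hy
  have hjk : j = k := by
    rcases lt_trichotomy j k with h | h | h
    · exact absurd (dyadicCube_anti (by simp only; omega) h2.1) h1.2
    · exact h
    · exact absurd (dyadicCube_anti (by simp only; omega) h1.1) h2.2
  subst hjk
  apply hne
  congr 1
  apply Subtype.ext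
  ext i
  rw [← hx i, ← hy i]

/-- The first dyadic cube that misses x determines its shell, and the floors of the rescaled
coordinates determine its cell. -/
theorem exists_mem_cell (hM : ∀ j < J, 0 < M j) {x : EuclideanSpace ℝ (Fin n)}
    (hx : x ∈ dyadicCube n 0) (hxJ : x ∉ dyadicCube n J) :
    ∃ a : CellIndex n J M, x ∈ cell 0 a := by
  classical
  have hex : ∃ j, x ∉ dyadicCube n j := ⟨J, hxJ⟩
  obtain ⟨j, hj⟩ : ∃ j, Nat.find hex = j + 1 := by
    refine Nat.exists_eq_succ_of_ne_zero fun h => ?_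
    have := Nat.find_spec hex
    rw [h] at this
    exact this hx
  have h1 : x ∉ dyadicCube n (j + 1) := hj ▸ Nat.find_spec hex
  have h2 : x ∈ dyadicCube n j := by
    have := Nat.find_min hex (m := j) (by omega)
    simpa using this
  have hjJ : j < J := by
    have := Nat.find_min' hex hxJ
    omega
  have hx' : x ∈ gridCell (mesh j (M j)) fun i => ⌊x i / mesh j (M j)⌋ := fun i => rfl
  refine ⟨⟨⟨j, hjJ⟩, ⟨_, (mem_shell_iff (hM j hjJ) hx').2 ⟨h2, h1⟩⟩⟩, ?_⟩
  simpa [cell] using hx'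

end Grid

/-! ### Upper bound on a graded grid. -/

section GradedApproximation

variable (n m : ℕ) [NeZero m] (p : ℝ≥0) [Fact (1 ≤ (p : ℝ≥0∞))] (σ : ℝ)

/-- Approximation of the embedding on a graded grid. -/
theorem exists_graded_approx (hn : 1 ≤ n) (hσ : 0 < σ) : ∃ C : ℝ, 0 < C ∧ ∃ D : ℕ, 0 < D ∧
    ∀ (J : ℕ) (M : ℕ → ℕ) (K : ℝ), 0 < K → (∀ j < J, 0 < M j) →
      (∀ j < J, K ≤ (M j : ℝ) ^ m * (1 + j : ℝ) ^ σ) → K ≤ (1 + J : ℝ) ^ σ →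
      ∃ S : WeightedSobolev n m p σ →L[ℂ] LpBall n p,
        (S : WeightedSobolev n m p σ →ₗ[ℂ] LpBall n p).rank ≤
          (D * ∑ j ∈ Finset.range J, M j ^ n : ℕ) ∧
        ‖embedding n m p σ - S‖ ≤ C / K := by
  obtain ⟨C, hC, h⟩ := exists_finiteRank_approx n m p σ hn hσ
  obtain ⟨c, hc, hlog⟩ := exists_mul_le_logWeight hn
  have hn1 : (1 : ℝ) ≤ n := by exact_mod_cast hn
  have hnm : (1 : ℝ) ≤ (n : ℝ) ^ m := one_le_pow₀ hn1
  refine ⟨C * ((n : ℝ) ^ m / c ^ σ), by positivity,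
    4 ^ n * (Fintype.card (TaylorIndex n m) + 1), by positivity, ?_⟩
  intro J M K hK hM hKM hKJ
  -- The factor n^m comes from the diameter bound n · mesh, and c^σ from the lower bound c(1 + j)
  -- for the logarithmic factor.
  set ε : ℝ := (n : ℝ) ^ m / c ^ σ / K with hε
  have hε0 : 0 < ε := by positivity
  have hεc : ε * c ^ σ * K = (n : ℝ) ^ m := by rw [hε]; field_simp
  obtain ⟨S, hS1, hS2⟩ := h (fun a : CellIndex n J M => cell 0 a)
    (fun a => n * mesh (0 + a.1) (M a.1)) ε
    (fun a => measurableSet_gridCell _ _)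
    (fun a => isBounded_gridCell (mesh_pos _ (hM a.1 a.1.2)) _)
    (fun a => convex_gridCell (mesh_pos _ (hM a.1 a.1.2)) _)
    (pairwise_disjoint_cell hM 0) hε0.le
    (fun a x hx y hy => norm_sub_le_of_mem_gridCell (mesh_pos _ (hM a.1 a.1.2)) hx hy)
    (fun a => mul_nonneg (by positivity) (mesh_pos _ (hM a.1 a.1.2)).le)
    (by
      rintro ⟨j, z⟩ x hx hx1
      have hMj : (0 : ℝ) < M j := by exact_mod_cast hM j j.2
      obtain ⟨h1, h2⟩ := mem_dyadicCube_of_mem_cell hM hx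
      simp only [zero_add] at h1 h2 ⊢
      have hx0 : x ≠ 0 := by
        rintro rfl
        exact h2 (zero_mem_dyadicCube _)
      have h3 := le_norm_of_notMem_dyadicCube h2
      have h4 := hlog j x hx0 hx1 h1
      have h5 : (c * (1 + (j : ℕ) : ℝ)) ^ σ ≤ logWeight x ^ σ :=
        Real.rpow_le_rpow (by positivity) h4 hσ.le
      rw [Real.mul_rpow hc.le (by positivity)] at h5
      have h6 := hKM j j.2
      have h7 : ((1 / 2 : ℝ) ^ ((j : ℕ) + 1)) ^ m * (c ^ σ * (1 + (j : ℕ) : ℝ) ^ σ) ≤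
          radialWeight n m σ x := by
        unfold radialWeight
        exact mul_le_mul (pow_le_pow_left₀ (by positivity) h3 m) h5 (by positivity) (by positivity)
      have h8 : (n * mesh j (M j)) ^ m = (n : ℝ) ^ m * ((1 / 2 : ℝ) ^ ((j : ℕ) + 1)) ^ m /
          (M j : ℝ) ^ m := by
        rw [mesh, mul_div_assoc', div_pow, mul_pow]
      rw [h8, div_le_iff₀ (by positivity)]
      set P : ℝ := ((1 / 2 : ℝ) ^ ((j : ℕ) + 1)) ^ m
      set w : ℝ := (1 + (j : ℕ) : ℝ) ^ σ
      calc (n : ℝ) ^ m * P = ε * c ^ σ * P * K := by rw [← hεc]; ring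
        _ ≤ ε * c ^ σ * P * ((M j : ℝ) ^ m * w) := mul_le_mul_of_nonneg_left h6 (by positivity)
        _ = ε * (P * (c ^ σ * w)) * (M j : ℝ) ^ m := by ring
        _ ≤ ε * radialWeight n m σ x * (M j : ℝ) ^ m := by gcongr)
    (by
      intro x hx0 hx1 hx
      have hxJ : x ∈ dyadicCube n J := by
        by_contra hcon
        obtain ⟨a, ha⟩ := exists_mem_cell hM (mem_dyadicCube_zero hx1) hcon
        exact hx a ha
      have h5 : (c * (1 + J : ℝ)) ^ σ ≤ logWeight x ^ σ :=
        Real.rpow_le_rpow (by positivity) (hlog J x hx0 hx1 hxJ) hσ.le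
      rw [Real.mul_rpow hc.le (by positivity)] at h5
      calc (1 : ℝ) ≤ (n : ℝ) ^ m := hnm
        _ = ε * (c ^ σ * K) := by rw [← hεc]; ring
        _ ≤ ε * (c ^ σ * (1 + J : ℝ) ^ σ) := by gcongr
        _ ≤ _ := by gcongr)
  refine ⟨S, hS1.trans ?_, hS2.trans (le_of_eq ?_)⟩
  · have h1 := card_cellIndex_le n J M
    have h2 : Fintype.card (CellIndex n J M) * Fintype.card (TaylorIndex n m) ≤
        4 ^ n * (Fintype.card (TaylorIndex n m) + 1) * ∑ j ∈ Finset.range J, M j ^ n := by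
      calc _ ≤ 4 ^ n * (∑ j ∈ Finset.range J, M j ^ n) * (Fintype.card (TaylorIndex n m) + 1) :=
            Nat.mul_le_mul h1 (by omega)
        _ = _ := by ring
    exact_mod_cast h2
  · rw [hε, mul_div_assoc]

end GradedApproximation

/-! ### Lower bounds from subspaces on which the embedding is bounded below. -/

section Bernstein

/-- A lower bound for the distance to operators of small rank in terms of a subspace on which
the operator is bounded below. -/
theorem inv_le_norm_sub_of_rank_lt {X Y : Type} [NormedAddCommGroup X] [NormedSpace ℂ X]
    [NormedAddCommGroup Y] [NormedSpace ℂ Y] (T S : X →L[ℂ] Y) {I : Type} [Fintype I]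
    (φ : I → X) {A : ℝ} (hA : 0 < A) (hφ : ∀ c : I → ℂ, ‖∑ a, c a • φ a‖ ≤ A * ‖T (∑ a, c a • φ a)‖)
    (hne : ∀ c : I → ℂ, c ≠ 0 → T (∑ a, c a • φ a) ≠ 0)
    (hS : (S : X →ₗ[ℂ] Y).rank < Fintype.card I) : A⁻¹ ≤ ‖T - S‖ := by
  set L : (I → ℂ) →ₗ[ℂ] X := Fintype.linearCombination ℂ φ with hL
  -- Injectivity would force the rank of S up to the number of coefficients. So S kills a
  -- combination with nonzero coefficients, on which T - S acts as T.
  have hnot : ¬ Function.Injective ((S : X →ₗ[ℂ] Y).comp L) := by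
    intro hinj
    have h1 := LinearMap.rank_comp_le_left L (S : X →ₗ[ℂ] Y)
    have h2 := rank_range_of_injective _ hinj
    rw [rank_fun'] at h2
    have h3 : ((S : X →ₗ[ℂ] Y).comp L).rank = (Fintype.card I : Cardinal) := h2
    rw [h3] at h1
    exact absurd hS (not_lt.2 h1)
  rw [← LinearMap.ker_eq_bot, Submodule.eq_bot_iff] at hnot
  push Not at hnot
  obtain ⟨c, hc, hc0⟩ := hnot
  have hSc : S (∑ a, c a • φ a) = 0 := by
    have : S (L c) = 0 := hc
    rwa [hL, Fintype.linearCombination_apply] at this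
  have hpos := norm_pos_iff.2 (hne c hc0)
  have h1 : ‖T (∑ a, c a • φ a)‖ ≤ ‖T - S‖ * (A * ‖T (∑ a, c a • φ a)‖) := by
    calc ‖T (∑ a, c a • φ a)‖ = ‖(T - S) (∑ a, c a • φ a)‖ := by
          rw [sub_apply, hSc, sub_zero]
      _ ≤ ‖T - S‖ * ‖∑ a, c a • φ a‖ := (T - S).le_opNorm _
      _ ≤ _ := mul_le_mul_of_nonneg_left (hφ c) (norm_nonneg _)
  rw [inv_le_iff_one_le_mul₀ hA]
  nlinarith

/-- At most one summand is nonzero. Applied pointwise, this makes p-th powers additive over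
functions with disjoint supports. -/
theorem enorm_sum_rpow_eq {I F : Type*} [Fintype I] [NormedAddCommGroup F] {v : I → F} {p : ℝ}
    (hp : 0 < p) (hv : ∀ a b, a ≠ b → v a = 0 ∨ v b = 0) :
    ‖∑ a, v a‖ₑ ^ p = ∑ a, ‖v a‖ₑ ^ p := by
  by_cases h : ∃ a, v a ≠ 0
  · obtain ⟨a, ha⟩ := h
    have h0 : ∀ b, b ≠ a → v b = 0 := fun b hb => (hv b a hb).resolve_right ha
    rw [Fintype.sum_eq_single a h0, Fintype.sum_eq_single a]
    intro b hb
    rw [h0 b hb, enorm_zero, ENNReal.zero_rpow_of_pos hp]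
  · push Not at h
    simp [h, hp]

end Bernstein

/-! ### Bumps in the cells of a graded grid. -/

section Bump

variable {n : ℕ}

/-- A fixed smooth bump supported in the ball of radius `1 / 4`. -/
def baseBump (n : ℕ) (x : EuclideanSpace ℝ (Fin n)) : ℂ :=
  ((⟨1 / 8, 1 / 4, by norm_num, by norm_num⟩ : ContDiffBump (0 : EuclideanSpace ℝ (Fin n))) x : ℝ)

theorem contDiff_baseBump (m : ℕ) : ContDiff ℝ m (baseBump n) :=
  Complex.ofRealCLM.contDiff.comp (ContDiffBump.contDiff _)

theorem baseBump_eq_zero {x : EuclideanSpace ℝ (Fin n)} (hx : 1 / 4 ≤ ‖x‖) : baseBump n x = 0 := by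
  unfold baseBump
  rw [ContDiffBump.zero_of_le_dist _ (by simpa using hx), Complex.ofReal_zero]

theorem hasCompactSupport_baseBump : HasCompactSupport (baseBump n) :=
  HasCompactSupport.intro (isCompact_closedBall 0 (1 / 4)) fun x hx => by
    rw [mem_closedBall_zero_iff, not_le] at hx
    exact baseBump_eq_zero hx.le

variable {p : ℝ≥0}

theorem lintegral_baseBump_ne_zero : ∫⁻ x, ‖baseBump n x‖ₑ ^ (p : ℝ) ≠ 0 := by
  have h : volume (Metric.ball (0 : EuclideanSpace ℝ (Fin n)) (1 / 8)) ≤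
      ∫⁻ x, ‖baseBump n x‖ₑ ^ (p : ℝ) := by
    rw [← setLIntegral_one]
    refine le_trans (setLIntegral_mono_ae' measurableSet_ball (ae_of_all _ fun x hx => ?_))
      (setLIntegral_le_lintegral _ _)
    unfold baseBump
    rw [ContDiffBump.one_of_mem_closedBall _ (Metric.ball_subset_closedBall hx)]
    simp
  exact ((Metric.measure_ball_pos volume _ (by norm_num)).trans_le h).ne'

theorem lintegral_enorm_rpow_ne_top [Fact (1 ≤ (p : ℝ≥0∞))] {F : Type*} [NormedAddCommGroup F]
    {g : EuclideanSpace ℝ (Fin n) → F} (hg : Continuous g) (hc : HasCompactSupport g) :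
    ∫⁻ x, ‖g x‖ₑ ^ (p : ℝ) ≠ ∞ := by
  have hp := one_le_coe_of_fact (p := p)
  rw [← eLpNorm_rpow_eq_lintegral]
  exact ENNReal.rpow_ne_top_of_nonneg (by linarith)
    (hg.memLp_of_hasCompactSupport hc).eLpNorm_ne_top

/-- The bump of scale `h` centred at `c`. -/
def scaledBump (h : ℝ) (c x : EuclideanSpace ℝ (Fin n)) : ℂ :=
  baseBump n (h⁻¹ • (x - c))

theorem contDiff_scaledBump (m : ℕ) (h : ℝ) (c : EuclideanSpace ℝ (Fin n)) :
    ContDiff ℝ m (scaledBump h c) :=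
  (contDiff_baseBump m).comp (by fun_prop)

theorem iteratedFDeriv_scaledBump (m : ℕ) (h : ℝ) (c x : EuclideanSpace ℝ (Fin n)) :
    iteratedFDeriv ℝ m (scaledBump h c) x =
      h⁻¹ ^ m • iteratedFDeriv ℝ m (baseBump n) (h⁻¹ • (x - c)) := by
  have h1 := iteratedFDeriv_comp_sub (𝕜 := ℝ) (f := fun z => baseBump n (h⁻¹ • z)) m c x
  rw [iteratedFDeriv_comp_const_smul _ (contDiff_baseBump m)] at h1
  exact h1

theorem tsupport_scaledBump_subset {h : ℝ} (hh : 0 < h) (c : EuclideanSpace ℝ (Fin n)) :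
    tsupport (scaledBump h c) ⊆ Metric.closedBall c (h / 4) := by
  refine closure_minimal (fun x hx => ?_) Metric.isClosed_closedBall
  rw [Metric.mem_closedBall, dist_eq_norm]
  by_contra hcon
  refine hx (baseBump_eq_zero ?_)
  rw [norm_smul, norm_inv, Real.norm_of_nonneg hh.le, inv_mul_eq_div, le_div_iff₀ hh]
  linarith

theorem lintegral_scaled {h : ℝ} (hh : 0 < h) (c : EuclideanSpace ℝ (Fin n))
    {F : EuclideanSpace ℝ (Fin n) → ℝ≥0∞} (hF : Measurable F) :
    ∫⁻ x, F (h⁻¹ • (x - c)) = ENNReal.ofReal (h ^ n) * ∫⁻ x, F x := by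
  rw [lintegral_sub_right_eq_self (fun x => F (h⁻¹ • x)) c,
    lintegral_comp_const_smul volume hF (inv_ne_zero hh.ne'), finrank_euclideanSpace_fin, inv_pow,
    inv_inv, abs_of_pos (by positivity)]

/-- The centre of a grid cell. -/
def gridCenter (h : ℝ) (z : Fin n → ℤ) : EuclideanSpace ℝ (Fin n) :=
  WithLp.toLp 2 fun i => (z i + 1 / 2 : ℝ) * h

theorem closedBall_subset_gridCell {h : ℝ} (hh : 0 < h) (z : Fin n → ℤ) :
    Metric.closedBall (gridCenter h z) (h / 4) ⊆ gridCell h z := by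
  intro x hx
  rw [mem_gridCell_iff hh]
  intro i
  rw [Metric.mem_closedBall, dist_eq_norm] at hx
  have h1 := (PiLp.norm_apply_le (x - gridCenter h z) i).trans hx
  rw [PiLp.sub_apply, Real.norm_eq_abs, abs_le] at h1
  simp only [gridCenter] at h1
  constructor <;> nlinarith [h1.1, h1.2]

variable {J : ℕ} {M : ℕ → ℕ}

/-- The mesh size of the cell with index `a`. -/
def cellMesh (a : CellIndex n J M) : ℝ := mesh (n + a.1) (M a.1)

theorem cellMesh_pos (hM : ∀ j < J, 0 < M j) (a : CellIndex n J M) : 0 < cellMesh a :=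
  mesh_pos _ (hM a.1 a.1.2)

/-- The bump placed in the cell with index `a`. -/
def cellBump (a : CellIndex n J M) : EuclideanSpace ℝ (Fin n) → ℂ :=
  scaledBump (cellMesh a) (gridCenter (cellMesh a) a.2.1)

theorem tsupport_cellBump_subset (hM : ∀ j < J, 0 < M j) (a : CellIndex n J M) :
    tsupport (cellBump a) ⊆ cell n a :=
  (tsupport_scaledBump_subset (cellMesh_pos hM a) _).trans
    (closedBall_subset_gridCell (cellMesh_pos hM a) _)

/-- The shells start at level n because n 2^(-n) < 1, which puts even the corners of the largest
cube inside the ball. -/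
theorem cell_subset_ball (hM : ∀ j < J, 0 < M j) (a : CellIndex n J M) :
    cell n a ⊆ Metric.ball 0 1 := by
  intro x hx
  have h1 := (mem_dyadicCube_of_mem_cell hM hx).1
  have h2 := norm_le_of_mem_dyadicCube (dyadicCube_anti (Nat.le_add_right n a.1) h1)
  rw [mem_ball_zero_iff]
  refine h2.trans_lt ?_
  have h3 : (n : ℝ) < 2 ^ n := by exact_mod_cast Nat.lt_two_pow_self
  rw [one_div, inv_pow, ← div_eq_mul_inv, div_lt_one (by positivity)]
  exact h3

theorem cellBump_eq_zero (hM : ∀ j < J, 0 < M j) {a : CellIndex n J M}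
    {x : EuclideanSpace ℝ (Fin n)} (hx : x ∉ cell n a) : cellBump a x = 0 :=
  image_eq_zero_of_notMem_tsupport fun h => hx (tsupport_cellBump_subset hM a h)

theorem iteratedFDeriv_cellBump_eq_zero (hM : ∀ j < J, 0 < M j) {a : CellIndex n J M} (m : ℕ)
    {x : EuclideanSpace ℝ (Fin n)} (hx : x ∉ cell n a) :
    iteratedFDeriv ℝ m (cellBump a) x = 0 := by
  by_contra h
  exact hx (tsupport_cellBump_subset hM a (support_iteratedFDeriv_subset (𝕜 := ℝ) m h))

theorem eq_zero_or_eq_zero_of_cell {F : Type*} [Zero F] (hM : ∀ j < J, 0 < M j)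
    {v : CellIndex n J M → F} {x : EuclideanSpace ℝ (Fin n)} (hv : ∀ a, x ∉ cell n a → v a = 0)
    (a b : CellIndex n J M) (hab : a ≠ b) : v a = 0 ∨ v b = 0 := by
  by_cases ha : x ∈ cell n a
  · exact Or.inr (hv b (Set.disjoint_left.1 (pairwise_disjoint_cell hM n hab) ha))
  · exact Or.inl (hv a ha)

/-- With ‖x‖ ≤ n 2^(-(n+j)) and mesh 2^(-(n+j+1))/M_j the dyadic powers cancel; the logarithmic
factor is at most (n + 2)(1 + j). -/
theorem radialWeight_le_of_mem_cell (hn : 1 ≤ n) (m : ℕ) {σ : ℝ} (hσ : 0 < σ)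
    (hM : ∀ j < J, 0 < M j) {a : CellIndex n J M} {x : EuclideanSpace ℝ (Fin n)}
    (hx : x ∈ cell n a) :
    radialWeight n m σ x * (cellMesh a)⁻¹ ^ m ≤
      (2 * n) ^ m * (n + 2) ^ σ * ((M a.1 : ℝ) ^ m * (1 + (a.1 : ℕ) : ℝ) ^ σ) := by
  obtain ⟨j, z⟩ := a
  have hMj : (0 : ℝ) < M j := by exact_mod_cast hM j j.2
  obtain ⟨h1, h2⟩ := mem_dyadicCube_of_mem_cell hM hx
  have hx1 : ‖x‖ < 1 := by simpa using cell_subset_ball hM _ hx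
  simp only at h1 h2 ⊢
  have h3 := norm_le_of_mem_dyadicCube h1
  have h4 := le_norm_of_notMem_dyadicCube h2
  have hlog : 1 + |Real.log ‖x‖| ≤ (n + 2) * (1 + (j : ℕ)) := by
    have hpos : (0 : ℝ) < (1 / 2) ^ (n + (j : ℕ) + 1) := by positivity
    have h5 := Real.log_le_log hpos h4
    rw [Real.log_pow, one_div, Real.log_inv] at h5
    have h6 : Real.log ‖x‖ ≤ 0 := Real.log_nonpos (norm_nonneg _) hx1.le
    have h7 : Real.log 2 ≤ 1 := by
      have := Real.log_le_sub_one_of_pos (by norm_num : (0 : ℝ) < 2)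
      linarith
    rw [abs_of_nonpos h6]
    push_cast at h5
    have h8 : (0 : ℝ) ≤ (n : ℝ) * (j : ℕ) := by positivity
    have h9 : ((n : ℝ) + (j : ℕ) + 1) * Real.log 2 ≤ (n : ℝ) + (j : ℕ) + 1 :=
      mul_le_of_le_one_right (by positivity) h7
    have h10 : (0 : ℝ) ≤ (j : ℕ) := by positivity
    nlinarith
  have hw : radialWeight n m σ x ≤
      (n * (1 / 2 : ℝ) ^ (n + (j : ℕ))) ^ m * ((n + 2) ^ σ * (1 + (j : ℕ) : ℝ) ^ σ) := by
    unfold radialWeight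
    rw [← Real.mul_rpow (by positivity) (by positivity)]
    refine mul_le_mul (pow_le_pow_left₀ (norm_nonneg _) h3 m)
      (Real.rpow_le_rpow (by positivity) hlog hσ.le) (by positivity) (by positivity)
  have hmesh : (cellMesh (⟨j, z⟩ : CellIndex n J M))⁻¹ ^ m =
      (M j : ℝ) ^ m * 2 ^ m / ((1 / 2 : ℝ) ^ (n + (j : ℕ))) ^ m := by
    rw [cellMesh, mesh, inv_div, div_pow, pow_succ, mul_pow, mul_div_assoc, one_div 2]
    rw [← one_div (2 : ℝ), one_div_pow 2 m]
    field_simp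
  have hinv : 0 ≤ (cellMesh (⟨j, z⟩ : CellIndex n J M))⁻¹ ^ m :=
    pow_nonneg (inv_nonneg.2 (cellMesh_pos hM _).le) _
  refine (mul_le_mul_of_nonneg_right hw hinv).trans (le_of_eq ?_)
  rw [hmesh]
  have hP : ((1 / 2 : ℝ) ^ (n + (j : ℕ))) ^ m ≠ 0 := by positivity
  rw [mul_pow, mul_pow]
  field_simp

end Bump

/-! ### Norms of linear combinations of bumps. -/

section BumpSums

variable {n m : ℕ} {p : ℝ≥0} {σ : ℝ} {J : ℕ} {M : ℕ → ℕ}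

/-- The bump in the cell with index `a`, as an element of `C_0^m(B)`. -/
def cellTestFunction (m : ℕ) (p : ℝ≥0) (σ : ℝ) (hM : ∀ j < J, 0 < M j) (a : CellIndex n J M) :
    CompactlySupported n m p σ :=
  (⟨cellBump a, contDiff_scaledBump m _ _,
    (isCompact_closedBall _ _).of_isClosed_subset (isClosed_tsupport _)
      (tsupport_scaledBump_subset (cellMesh_pos hM a) _),
    (tsupport_cellBump_subset hM a).trans (cell_subset_ball hM a)⟩ : 𝓓^{(m : ℕ∞)}(unitBall n, ℂ))

theorem CompactlySupported.coe_sum_smul {I : Type*} [Fintype I] (c : I → ℂ)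
    (φ : I → CompactlySupported n m p σ) : ⇑(∑ a, c a • φ a) = fun x => ∑ a, c a • φ a x := by
  let L : CompactlySupported n m p σ →+ (EuclideanSpace ℝ (Fin n) → ℂ) :=
    { toFun := fun f => f, map_zero' := rfl, map_add' := fun f g => coe_add f g }
  have h := map_sum L (fun a => c a • φ a) Finset.univ
  ext x
  have hx := congrFun h x
  rw [Finset.sum_apply] at hx
  exact hx

/-- A linear combination of the bumps in the cells. -/
def bumpSum (m : ℕ) (p : ℝ≥0) (σ : ℝ) (hM : ∀ j < J, 0 < M j) (c : CellIndex n J M → ℂ) :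
    CompactlySupported n m p σ :=
  ∑ a, c a • cellTestFunction m p σ hM a

theorem coe_bumpSum (hM : ∀ j < J, 0 < M j) (c : CellIndex n J M → ℂ) :
    ⇑(bumpSum m p σ hM c) = fun x => ∑ a, c a • cellBump a x :=
  CompactlySupported.coe_sum_smul c _

variable [Fact (1 ≤ (p : ℝ≥0∞))]

theorem enorm_toLpBall_bumpSum_rpow (hM : ∀ j < J, 0 < M j) (c : CellIndex n J M → ℂ) :
    ‖(bumpSum m p σ hM c).toLpBall‖ₑ ^ (p : ℝ) =
      (∑ a, ‖c a‖ₑ ^ (p : ℝ) * ENNReal.ofReal (cellMesh a ^ n)) *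
        ∫⁻ x, ‖baseBump n x‖ₑ ^ (p : ℝ) := by
  have hp := one_le_coe_of_fact (p := p)
  have hp0 : (0 : ℝ) < p := by linarith
  have hcont : ∀ a : CellIndex n J M, Continuous (cellBump a) := fun a =>
    (contDiff_scaledBump 0 _ _).continuous
  rw [enorm_toLpBall_rpow, coe_bumpSum]
  have h1 : ∀ x, ‖∑ a, c a • cellBump a x‖ₑ ^ (p : ℝ) =
      ∑ a, ‖c a‖ₑ ^ (p : ℝ) * ‖cellBump a x‖ₑ ^ (p : ℝ) := by
    intro x
    rw [enorm_sum_rpow_eq hp0 (eq_zero_or_eq_zero_of_cell hM (x := x) fun a ha => by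
      rw [cellBump_eq_zero hM ha, smul_zero])]
    refine Finset.sum_congr rfl fun a _ => ?_
    rw [enorm_smul, ENNReal.mul_rpow_of_nonneg _ _ hp0.le]
  simp only [h1]
  rw [lintegral_finsetSum _ fun a _ =>
    ((hcont a).enorm.measurable.pow_const _).const_mul _, Finset.sum_mul]
  refine Finset.sum_congr rfl fun a _ => ?_
  rw [lintegral_const_mul _ ((hcont a).enorm.measurable.pow_const _), mul_assoc]
  congr 1
  exact lintegral_scaled (cellMesh_pos hM a) _ (F := fun x => ‖baseBump n x‖ₑ ^ (p : ℝ))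
    ((contDiff_baseBump 0).continuous.enorm.measurable.pow_const _)

/-- The factor h^(-m) from differentiating a bump of scale h is compensated by the weight up to K.
What is left carries the same sum over cells as `enorm_toLpBall_bumpSum_rpow`, so the ratio of the
two is bounded independently of c. -/
theorem lintegral_energyDensity_bumpSum_le (hn : 1 ≤ n) (hσ : 0 < σ) (hM : ∀ j < J, 0 < M j)
    {K : ℝ} (hK : ∀ j < J, (M j : ℝ) ^ m * (1 + j : ℝ) ^ σ ≤ K) (c : CellIndex n J M → ℂ) :
    ∫⁻ x, energyDensity m σ (bumpSum m p σ hM c) x ^ (p : ℝ) ≤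
      ENNReal.ofReal ((2 * n) ^ m * (n + 2) ^ σ * K) ^ (p : ℝ) *
        ((∑ a, ‖c a‖ₑ ^ (p : ℝ) * ENNReal.ofReal (cellMesh a ^ n)) *
          ∫⁻ x, ‖iteratedFDeriv ℝ m (baseBump n) x‖ₑ ^ (p : ℝ)) := by
  have hp := one_le_coe_of_fact (p := p)
  have hp0 : (0 : ℝ) < p := by linarith
  set A : ℝ := (2 * n) ^ m * (n + 2) ^ σ * K with hA
  set G : EuclideanSpace ℝ (Fin n) → ℝ≥0∞ := fun x => ‖iteratedFDeriv ℝ m (baseBump n) x‖ₑ with hG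
  have hGm : Measurable G :=
    ((contDiff_baseBump m).continuous_iteratedFDeriv le_rfl).enorm.measurable
  have hderiv : ∀ x, iteratedFDeriv ℝ m (bumpSum m p σ hM c) x =
      ∑ a, c a • iteratedFDeriv ℝ m (cellBump a) x := by
    intro x
    have hcd : ∀ a : CellIndex n J M, ContDiff ℝ m (cellBump a) := fun a =>
      contDiff_scaledBump m _ _
    rw [coe_bumpSum, iteratedFDeriv_fun_sum_apply fun a _ => ((hcd a).const_smul (c a)).contDiffAt]
    refine Finset.sum_congr rfl fun a _ => ?_
    exact iteratedFDeriv_const_smul_apply (a := c a) (hcd a).contDiffAt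
  have hpt : ∀ x, energyDensity m σ (bumpSum m p σ hM c) x ^ (p : ℝ) ≤
      ∑ a, ENNReal.ofReal A ^ (p : ℝ) * (‖c a‖ₑ ^ (p : ℝ) *
        G ((cellMesh a)⁻¹ • (x - gridCenter (cellMesh a) a.2.1)) ^ (p : ℝ)) := by
    intro x
    rw [energyDensity, hderiv, ENNReal.mul_rpow_of_nonneg _ _ hp0.le,
      enorm_sum_rpow_eq hp0 (eq_zero_or_eq_zero_of_cell hM (x := x) fun a ha => by
        rw [iteratedFDeriv_cellBump_eq_zero hM m ha, smul_zero]), Finset.mul_sum]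
    refine Finset.sum_le_sum fun a _ => ?_
    by_cases ha : x ∈ cell n a
    · rw [← ENNReal.mul_rpow_of_nonneg _ _ hp0.le, ← ENNReal.mul_rpow_of_nonneg _ _ hp0.le,
        ← ENNReal.mul_rpow_of_nonneg _ _ hp0.le]
      refine ENNReal.rpow_le_rpow ?_ hp0.le
      rw [enorm_smul, cellBump, iteratedFDeriv_scaledBump, enorm_smul, mul_left_comm,
        mul_left_comm (ENNReal.ofReal A)]
      refine mul_le_mul' le_rfl ?_
      rw [← mul_assoc]
      refine mul_le_mul' ?_ le_rfl
      have hpos : 0 ≤ (cellMesh a)⁻¹ ^ m := pow_nonneg (inv_nonneg.2 (cellMesh_pos hM a).le) _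
      rw [Real.enorm_eq_ofReal hpos, ← ENNReal.ofReal_mul (radialWeight_nonneg ..)]
      refine ENNReal.ofReal_le_ofReal ((radialWeight_le_of_mem_cell hn m hσ hM ha).trans ?_)
      exact mul_le_mul_of_nonneg_left (hK a.1 a.1.2) (by positivity)
    · rw [iteratedFDeriv_cellBump_eq_zero hM m ha, smul_zero, enorm_zero,
        ENNReal.zero_rpow_of_pos hp0, mul_zero]
      exact zero_le
  refine (lintegral_mono hpt).trans (le_of_eq ?_)
  rw [lintegral_finsetSum, Finset.sum_mul, Finset.mul_sum]
  · refine Finset.sum_congr rfl fun a _ => ?_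
    rw [lintegral_const_mul _ (by fun_prop), lintegral_const_mul _ (by fun_prop), mul_assoc,
      lintegral_scaled (cellMesh_pos hM a) _ (F := fun x => G x ^ (p : ℝ)) (by fun_prop)]
  · intro a _
    fun_prop

end BumpSums

/-! ### Lower bound on a graded grid. -/

section LowerBound

variable (n m : ℕ) [NeZero m] (p : ℝ≥0) [Fact (1 ≤ (p : ℝ≥0∞))] (σ : ℝ)

/-- Disjoint bumps on a graded grid bound the approximation error from below. -/
theorem exists_graded_lower_bound (hn : 1 ≤ n) (hσ : 0 < σ) : ∃ c : ℝ, 0 < c ∧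
    ∀ (J : ℕ) (M : ℕ → ℕ) (K : ℝ), 0 < K → (∀ j < J, 0 < M j) →
      (∀ j < J, (M j : ℝ) ^ m * (1 + j : ℝ) ^ σ ≤ K) →
      ∀ S : WeightedSobolev n m p σ →L[ℂ] LpBall n p,
        (S : WeightedSobolev n m p σ →ₗ[ℂ] LpBall n p).rank <
          (∑ j ∈ Finset.range J, M j ^ n : ℕ) →
        c / K ≤ ‖embedding n m p σ - S‖ := by
  have hp := one_le_coe_of_fact (p := p)
  have hp0 : (0 : ℝ) < p := by linarith
  obtain ⟨C, hC, hle⟩ := exists_enorm_rpow_le_energy n m p σ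
  set B₀ : ℝ≥0∞ := ∫⁻ x, ‖baseBump n x‖ₑ ^ (p : ℝ) with hB₀
  set B₁ : ℝ≥0∞ := ∫⁻ x, ‖iteratedFDeriv ℝ m (baseBump n) x‖ₑ ^ (p : ℝ) with hB₁
  have hB₀0 : B₀ ≠ 0 := lintegral_baseBump_ne_zero
  have hB₀t : B₀ ≠ ∞ := lintegral_enorm_rpow_ne_top (contDiff_baseBump 0).continuous
    hasCompactSupport_baseBump
  have hB₁t : B₁ ≠ ∞ := lintegral_enorm_rpow_ne_top
    ((contDiff_baseBump m).continuous_iteratedFDeriv le_rfl)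
    (hasCompactSupport_baseBump.iteratedFDeriv m)
  -- B₁/B₀ is the ratio of energy to L_p mass of the base bump, the only trace of the bump in the
  -- constant.
  set C' : ℝ≥0∞ := C * B₁ * B₀⁻¹ with hC'
  have hC't : C' ≠ ∞ := ENNReal.mul_ne_top (by finiteness) (ENNReal.inv_ne_top.2 hB₀0)
  set A : ℝ := (2 * n) ^ m * (n + 2) ^ σ with hA
  have hA0 : 0 < A := by
    have : (0 : ℝ) < n := by exact_mod_cast hn
    positivity
  refine ⟨(((C' ^ (1 / (p : ℝ))).toReal + 1) * A)⁻¹, by positivity, ?_⟩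
  intro J M K hK hM hMK S hS
  have hbound : ∀ c : CellIndex n J M → ℂ, ‖bumpSum m p σ hM c‖ ≤
      ((C' ^ (1 / (p : ℝ))).toReal + 1) * A * K * ‖(bumpSum m p σ hM c).toLpBall‖ := by
    intro c
    have key : ‖bumpSum m p σ hM c‖ₑ ^ (p : ℝ) ≤
        C' * (ENNReal.ofReal (A * K) * ‖(bumpSum m p σ hM c).toLpBall‖ₑ) ^ (p : ℝ) := by
      refine (hle _).trans ((mul_le_mul' le_rfl
        (lintegral_energyDensity_bumpSum_le hn hσ hM hMK c)).trans (le_of_eq ?_))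
      rw [ENNReal.mul_rpow_of_nonneg _ _ hp0.le, enorm_toLpBall_bumpSum_rpow, ← hA, ← hB₀, ← hB₁,
        hC']
      generalize (∑ a, ‖c a‖ₑ ^ (p : ℝ) * ENNReal.ofReal (cellMesh a ^ n)) = s
      have h1 : B₀⁻¹ * B₀ = 1 := ENNReal.inv_mul_cancel hB₀0 hB₀t
      calc _ = C * B₁ * (ENNReal.ofReal (A * K) ^ (p : ℝ) * s) * 1 := by ring
        _ = _ := by rw [← h1]; ring
    refine (norm_le_mul_of_enorm_rpow_le hC't (by positivity) key).trans ?_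
    rw [← mul_assoc]
    gcongr
    linarith
  have hsum : ∀ c : CellIndex n J M → ℂ,
      ∑ a, c a • (cellTestFunction m p σ hM a : WeightedSobolev n m p σ) =
        (bumpSum m p σ hM c : WeightedSobolev n m p σ) := by
    intro c
    have h := map_sum (UniformSpace.Completion.toComplL (𝕜 := ℂ)
      (E := CompactlySupported n m p σ)) (fun a => c a • cellTestFunction m p σ hM a) Finset.univ
    simp only [map_smul] at h
    exact h.symm
  have hfin : (∑ j ∈ Finset.range J, M j ^ n : ℕ) ≤ Fintype.card (CellIndex n J M) :=
    le_card_cellIndex hn J M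
  have hmain := inv_le_norm_sub_of_rank_lt (embedding n m p σ) S
    (fun a : CellIndex n J M => (cellTestFunction m p σ hM a : WeightedSobolev n m p σ))
    (A := ((C' ^ (1 / (p : ℝ))).toReal + 1) * A * K) (by positivity) ?_ ?_
    (hS.trans_le (by exact_mod_cast hfin))
  · refine le_trans (le_of_eq ?_) hmain
    rw [mul_inv _ K, div_eq_mul_inv]
  · intro c
    rw [hsum, embedding_coe n m p σ hn hσ, UniformSpace.Completion.norm_coe]
    exact hbound c
  · intro c hc h0
    rw [hsum, embedding_coe n m p σ hn hσ] at h0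
    have h1 := enorm_toLpBall_bumpSum_rpow (m := m) (p := p) (σ := σ) hM c
    rw [h0, enorm_zero, ENNReal.zero_rpow_of_pos hp0, eq_comm, mul_eq_zero,
      or_iff_left hB₀0, Finset.sum_eq_zero_iff] at h1
    refine hc (funext fun a => ?_)
    have h2 := h1 a (Finset.mem_univ a)
    have h3 : ENNReal.ofReal (cellMesh a ^ n) ≠ 0 := by
      simpa using pow_pos (cellMesh_pos hM a) n
    rw [mul_eq_zero, or_iff_left h3, ENNReal.rpow_eq_zero_iff_of_pos hp0, enorm_eq_zero] at h2
    simpa using h2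

end LowerBound

/-! ### Integration by parts for iterated directional derivatives. -/

section IntegrationByParts

variable {V : Type*} [NormedAddCommGroup V] [NormedSpace ℝ V] [MeasurableSpace V] [BorelSpace V]
  [FiniteDimensional ℝ V] (μ : Measure V) [μ.IsAddHaarMeasure]

/-- Repeated integration by parts against a smooth function with compact support. -/
theorem exists_integral_listDeriv_mul_eq (L : List V) {φ : V → ℂ} (hφ : ContDiff ℝ (⊤ : ℕ∞) φ)
    (hφc : HasCompactSupport φ) : ∃ ψ : V → ℂ, Continuous ψ ∧ HasCompactSupport ψ ∧
      ∀ f : V → ℂ, ContDiff ℝ (L.length : ℕ) f →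
        ∫ x, listDeriv L f x * φ x ∂μ = ∫ x, f x * ψ x ∂μ := by
  induction L generalizing φ with
  | nil => exact ⟨φ, hφ.continuous, hφc, fun f _ => rfl⟩
  | cons a L ih =>
    have hφ1 : ContDiff ℝ (⊤ : ℕ∞) fun x => -fderiv ℝ φ x a :=
      ((hφ.fderiv_right (m := (⊤ : ℕ∞)) (by simp)).clm_apply contDiff_const).neg
    have hφc1 : HasCompactSupport fun x => -fderiv ℝ φ x a :=
      (hφc.fderiv_apply (𝕜 := ℝ) a).neg
    obtain ⟨ψ, hψ, hψc, h⟩ := ih hφ1 hφc1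
    -- ψ is fixed before f, so that the identity can later pass to limits in f.
    refine ⟨ψ, hψ, hψc, fun f hf => ?_⟩
    have hf' : ContDiff ℝ ((L.length + 1 : ℕ)) f := by simpa using hf
    rw [← h f (hf'.of_le (by norm_cast; omega)), listDeriv_cons a hf']
    have hg : ContDiff ℝ 1 (listDeriv L f) := by exact_mod_cast contDiff_listDeriv hf'
    have hgd : Continuous fun x => fderiv ℝ (listDeriv L f) x a :=
      (hg.continuous_fderiv one_ne_zero).clm_apply continuous_const
    have hφd : Continuous fun x => fderiv ℝ φ x a := by
      have := hφ1.continuous.neg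
      simpa only [Pi.neg_def, neg_neg] using this
    have key := integral_mul_fderiv_eq_neg_fderiv_mul_of_integrable (μ := μ)
      (f := listDeriv L f) (g := φ) (v := a)
      ((hgd.mul hφ.continuous).integrable_of_hasCompactSupport hφc.mul_left)
      ((hg.continuous.mul hφd).integrable_of_hasCompactSupport
        (hφc.fderiv_apply (𝕜 := ℝ) a).mul_left)
      ((hg.continuous.mul hφ.continuous).integrable_of_hasCompactSupport hφc.mul_left)
      (fun x _ => (hg.differentiable one_ne_zero) x)
      (fun x _ => (hφ.differentiable (by simp)) x)
    simp only [mul_neg, integral_neg]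
    rw [key, neg_neg]

end IntegrationByParts

/-! ### Regularity of the weight away from the origin. -/

section Weight

variable {n m : ℕ} {σ : ℝ}

theorem radialWeight_pos {x : EuclideanSpace ℝ (Fin n)} (hx : x ≠ 0) :
    0 < radialWeight n m σ x :=
  mul_pos (pow_pos (norm_pos_iff.2 hx) m) (Real.rpow_pos_of_pos (logWeight_pos x) σ)

theorem continuousOn_radialWeight : ContinuousOn (radialWeight n m σ) {0}ᶜ := by
  have h1 : ContinuousOn (fun x : EuclideanSpace ℝ (Fin n) => 1 + |Real.log ‖x‖|) {0}ᶜ :=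
    continuousOn_const.add (continuous_norm.continuousOn.log fun x hx => norm_ne_zero_iff.2 hx).abs
  exact (continuous_norm.pow m).continuousOn.mul
    (h1.rpow_const fun x _ => Or.inl (logWeight_pos x).ne')

end Weight

/-! ### Injectivity of the embedding. -/

section Injectivity

variable {n m : ℕ} [NeZero m] {p : ℝ≥0} [Fact (1 ≤ (p : ℝ≥0∞))] {σ : ℝ}

/-- The isometric embedding of `C_0^m(B)` by weighted derivatives, as a linear map. -/
def weightedDerivsₗ (n m : ℕ) [NeZero m] (p : ℝ≥0) [Fact (1 ≤ (p : ℝ≥0∞))] (σ : ℝ) :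
    CompactlySupported n m p σ →ₗ[ℂ]
      Lp (PiLp (p : ℝ≥0∞) fun _ : multiIndices n m => ℂ) (p : ℝ≥0∞) (ballMeasure n) where
  toFun f := (memLp_weightedDerivs f).toLp
  map_add' f g := by
    rw [← MemLp.toLp_add]
    congr 1
    ext x α
    simp only [weightedDerivs, CompactlySupported.coe_add, Pi.add_apply, PiLp.add_apply,
      multiDeriv_add α.2 f.contDiff g.contDiff]
    ring
  map_smul' c f := by
    rw [RingHom.id_apply, ← MemLp.toLp_const_smul]
    congr 1
    ext x α
    simp only [weightedDerivs, CompactlySupported.coe_smul, Pi.smul_apply, PiLp.smul_apply,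
      multiDeriv_smul α.2 c f.contDiff, smul_eq_mul]
    ring

theorem norm_weightedDerivsₗ (f : CompactlySupported n m p σ) :
    ‖weightedDerivsₗ n m p σ f‖ = ‖f‖ :=
  (weightedNorm_eq f).symm

/-- The isometric embedding of `E^m_{p,σ}(B)` by weighted derivatives. -/
def weightedDerivsL (n m : ℕ) [NeZero m] (p : ℝ≥0) [Fact (1 ≤ (p : ℝ≥0∞))] (σ : ℝ) :
    WeightedSobolev n m p σ →L[ℂ]
      Lp (PiLp (p : ℝ≥0∞) fun _ : multiIndices n m => ℂ) (p : ℝ≥0∞) (ballMeasure n) :=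
  extendToCompletion (weightedDerivsₗ n m p σ)

theorem weightedDerivsL_coe (f : CompactlySupported n m p σ) :
    weightedDerivsL n m p σ (f : WeightedSobolev n m p σ) = weightedDerivsₗ n m p σ f :=
  extendToCompletion_coe ⟨1, fun f => by rw [norm_weightedDerivsₗ, one_mul]⟩ f

theorem norm_weightedDerivsL (x : WeightedSobolev n m p σ) : ‖weightedDerivsL n m p σ x‖ = ‖x‖ := by
  induction x using UniformSpace.Completion.induction_on with
  | hp => exact isClosed_eq (by fun_prop) (by fun_prop)
  | ih f => rw [weightedDerivsL_coe, norm_weightedDerivsₗ, UniformSpace.Completion.norm_coe]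

/-- Integration against a bounded measurable function is continuous on `L_p(B)`. -/
theorem continuous_integral_mul {n : ℕ} {p : ℝ≥0} [Fact (1 ≤ (p : ℝ≥0∞))]
    {g : EuclideanSpace ℝ (Fin n) → ℂ} (hg : Measurable g) {C : ℝ} (hC : ∀ x, ‖g x‖ ≤ C) :
    Continuous fun u : LpBall n p => ∫ x, u x * g x ∂(ballMeasure n) := by
  have hp1 : (1 : ℝ≥0∞) ≤ p := Fact.out
  have hint : ∀ u : LpBall n p, Integrable (fun x => u x * g x) (ballMeasure n) := fun u =>
    ((Lp.memLp u).integrable hp1).mul_bdd hg.aestronglyMeasurable (ae_of_all _ hC)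
  let T : LpBall n p →ₗ[ℂ] ℂ :=
    { toFun := fun u => ∫ x, u x * g x ∂(ballMeasure n)
      map_add' := fun u v => by
        rw [← integral_add (hint u) (hint v)]
        refine integral_congr_ae ?_
        filter_upwards [Lp.coeFn_add u v] with x hx
        rw [hx, Pi.add_apply, add_mul]
      map_smul' := fun c u => by
        rw [RingHom.id_apply, smul_eq_mul, ← integral_const_mul]
        refine integral_congr_ae ?_
        filter_upwards [Lp.coeFn_smul c u] with x hx
        rw [hx, Pi.smul_apply, smul_eq_mul, mul_assoc] }
  have hC0 : 0 ≤ C := (norm_nonneg _).trans (hC 0)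
  set V : ℝ≥0∞ := ballMeasure n Set.univ ^ (1 / (1 : ℝ≥0∞).toReal - 1 / (p : ℝ≥0∞).toReal) with hV
  have hVt : V ≠ ∞ := by
    refine ENNReal.rpow_ne_top_of_nonneg ?_ (measure_ne_top _ _)
    have := one_le_coe_of_fact (p := p)
    simp only [ENNReal.toReal_one, ENNReal.coe_toReal, one_div, inv_one, sub_nonneg]
    exact inv_le_one_of_one_le₀ this
  refine (T.mkContinuous (C * V.toReal) fun u => ?_).continuous
  have h1 : eLpNorm u 1 (ballMeasure n) ≤ eLpNorm u p (ballMeasure n) * V :=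
    eLpNorm_le_eLpNorm_mul_rpow_measure_univ hp1 (Lp.aestronglyMeasurable u)
  have h2 : ∫ x, ‖u x‖ ∂(ballMeasure n) = (eLpNorm u 1 (ballMeasure n)).toReal := by
    rw [eLpNorm_one_eq_lintegral_enorm,
      integral_norm_eq_lintegral_enorm (Lp.aestronglyMeasurable u)]
  calc ‖T u‖ ≤ ∫ x, ‖u x * g x‖ ∂(ballMeasure n) := norm_integral_le_integral_norm _
    _ ≤ ∫ x, C * ‖u x‖ ∂(ballMeasure n) := by
        refine integral_mono (hint u).norm (((Lp.memLp u).integrable hp1).norm.const_mul C)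
          fun x => ?_
        rw [norm_mul, mul_comm]
        exact mul_le_mul_of_nonneg_right (hC x) (norm_nonneg _)
    _ = C * (eLpNorm u 1 (ballMeasure n)).toReal := by rw [integral_const_mul, h2]
    _ ≤ C * (‖u‖ * V.toReal) := by
        refine mul_le_mul_of_nonneg_left ?_ hC0
        rw [Lp.norm_def, ← ENNReal.toReal_mul]
        exact ENNReal.toReal_mono (ENNReal.mul_ne_top (Lp.eLpNorm_ne_top u) hVt) h1
    _ = _ := by ring

/-- The component with index `α` of the weighted derivatives of an element of `E^m_{p,σ}(B)`. -/
def weightedDeriv (α : multiIndices n m) (x : WeightedSobolev n m p σ) : LpBall n p :=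
  (PiLp.proj (𝕜 := ℂ) (p : ℝ≥0∞) (fun _ : multiIndices n m => ℂ) α).compLpL (p : ℝ≥0∞)
    (ballMeasure n) (weightedDerivsL n m p σ x)

theorem coeFn_weightedDeriv (α : multiIndices n m) (x : WeightedSobolev n m p σ) :
    weightedDeriv α x =ᵐ[ballMeasure n] fun y => weightedDerivsL n m p σ x y α :=
  ContinuousLinearMap.coeFn_compLpL _ _

theorem continuous_weightedDeriv (α : multiIndices n m) :
    Continuous (weightedDeriv (p := p) (σ := σ) α) :=
  (ContinuousLinearMap.continuous _).comp (ContinuousLinearMap.continuous _)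

theorem coeFn_weightedDeriv_coe (α : multiIndices n m) (f : CompactlySupported n m p σ) :
    weightedDeriv α (f : WeightedSobolev n m p σ) =ᵐ[ballMeasure n]
      fun y => (radialWeight n m σ y : ℂ) * multiDeriv α.1 f y := by
  filter_upwards [coeFn_weightedDeriv α (f : WeightedSobolev n m p σ),
    (memLp_weightedDerivs f).coeFn_toLp] with y hy1 hy2
  rw [hy1, weightedDerivsL_coe]
  change ((MemLp.toLp _ (memLp_weightedDerivs f) :
    Lp (PiLp (p : ℝ≥0∞) fun _ : multiIndices n m => ℂ) (p : ℝ≥0∞) (ballMeasure n)) y) α = _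
  rw [hy2]
  rfl

theorem eq_zero_of_weightedDeriv_eq_zero {x : WeightedSobolev n m p σ}
    (h : ∀ α : multiIndices n m, ∀ᵐ y ∂(ballMeasure n), weightedDeriv α x y = 0) : x = 0 := by
  rw [← norm_eq_zero, ← norm_weightedDerivsL, norm_eq_zero]
  refine Lp.ext ?_
  filter_upwards [ae_all_iff.2 h, ae_all_iff.2 fun α => coeFn_weightedDeriv α x,
    Lp.coeFn_zero (PiLp (p : ℝ≥0∞) fun _ : multiIndices n m => ℂ) (p : ℝ≥0∞) (ballMeasure n)]
    with y h1 h2 h3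
  rw [h3]
  ext α
  rw [← h2 α, h1 α]
  rfl

/-- The weak formulation of the derivatives of an element of `E^m_{p,σ}(B)` in terms of its
image in `L_p(B)`. -/
theorem exists_integral_weightedDeriv_eq (hn : 1 ≤ n) (hσ : 0 < σ) (α : multiIndices n m)
    {φ : EuclideanSpace ℝ (Fin n) → ℝ} (hφ : ContDiff ℝ (⊤ : ℕ∞) φ) (hφc : HasCompactSupport φ)
    (hφs : tsupport φ ⊆ Metric.ball 0 1 \ {0}) :
    ∃ ψ : EuclideanSpace ℝ (Fin n) → ℂ, ∀ x : WeightedSobolev n m p σ,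
      ∫ y, weightedDeriv α x y * ((φ y / radialWeight n m σ y : ℝ) : ℂ) ∂(ballMeasure n) =
        ∫ y, embedding n m p σ x y * ψ y ∂(ballMeasure n) := by
  have hlen := multiDirections_length_of_mem α.2
  obtain ⟨ψ, hψ, hψc, hparts⟩ := exists_integral_listDeriv_mul_eq volume (multiDirections α.1)
    (φ := fun y => (φ y : ℂ)) (Complex.ofRealCLM.contDiff.comp hφ)
    (hφc.comp_left (g := ((↑) : ℝ → ℂ)) Complex.ofReal_zero)
  refine ⟨ψ, fun x => ?_⟩
  have h0 : (fun y => φ y / radialWeight n m σ y) =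
      fun y => (radialWeight n m σ y)⁻¹ * φ y := by
    ext y; rw [div_eq_inv_mul]
  -- On the support of φ, which avoids the origin, the weight is continuous and positive; off the
  -- support the quotient vanishes locally.
  have hcont : Continuous fun y => φ y / radialWeight n m σ y := by
    rw [h0, continuous_iff_continuousAt]
    intro y
    by_cases hy : y ∈ tsupport φ
    · have hy0 : y ≠ 0 := (hφs hy).2
      have h2 := (continuousOn_radialWeight (n := n) (m := m) (σ := σ)).continuousAt
        (isOpen_compl_singleton.mem_nhds hy0)
      exact (h2.inv₀ (radialWeight_pos hy0).ne').mul hφ.continuous.continuousAt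
    · have hev : (fun y => (radialWeight n m σ y)⁻¹ * φ y) =ᶠ[nhds y] fun _ => 0 := by
        filter_upwards [(isClosed_tsupport φ).isOpen_compl.mem_nhds hy] with z hz
        rw [image_eq_zero_of_notMem_tsupport hz, mul_zero]
      exact continuousAt_const.congr hev.symm
  have hcs : HasCompactSupport fun y => φ y / radialWeight n m σ y := by
    rw [h0]; exact hφc.mul_left
  obtain ⟨C₁, hC₁⟩ := hcont.bounded_above_of_compact_support hcs
  obtain ⟨C₂, hC₂⟩ := hψ.bounded_above_of_compact_support hψc
  have hcl := continuous_integral_mul (n := n) (p := p)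
    (g := fun y => ((φ y / radialWeight n m σ y : ℝ) : ℂ))
    (Complex.continuous_ofReal.comp hcont).measurable (C := C₁)
    (fun y => by rw [Complex.norm_real]; exact hC₁ y)
  have hcr := continuous_integral_mul (n := n) (p := p) hψ.measurable hC₂
  -- Both sides are continuous in x, so it suffices to treat C_0^m functions, where the weight
  -- cancels and classical integration by parts applies.
  induction x using UniformSpace.Completion.induction_on with
  | hp =>
    exact isClosed_eq (hcl.comp (continuous_weightedDeriv α))
      (hcr.comp (embedding n m p σ).continuous)
  | ih f =>
    have e1 : ∫ y, weightedDeriv α (f : WeightedSobolev n m p σ) y *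
        ((φ y / radialWeight n m σ y : ℝ) : ℂ) ∂(ballMeasure n) =
        ∫ y, listDeriv (multiDirections α.1) f y * (φ y : ℂ) ∂(ballMeasure n) := by
      refine integral_congr_ae ?_
      filter_upwards [coeFn_weightedDeriv_coe α f] with y hy
      rw [hy]
      change _ = multiDeriv α.1 f y * _
      by_cases hφy : φ y = 0
      · simp [hφy]
      · have hy0 : y ≠ 0 := (hφs (subset_tsupport φ hφy)).2
        have hw : ((radialWeight n m σ y : ℝ) : ℂ) ≠ 0 := by
          exact_mod_cast (radialWeight_pos hy0).ne'
        push_cast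
        field_simp
    have e2 : ∫ y, embedding n m p σ (f : WeightedSobolev n m p σ) y * ψ y ∂(ballMeasure n) =
        ∫ y, f y * ψ y ∂(ballMeasure n) := by
      refine integral_congr_ae ?_
      rw [embedding_coe n m p σ hn hσ]
      filter_upwards [MemLp.coeFn_toLp (f.contDiff.continuous.memLp_of_hasCompactSupport
        (p := (p : ℝ≥0∞)) (μ := ballMeasure n) f.hasCompactSupport)] with y hy
      rw [CompactlySupported.toLpBall, hy]
    have hnorm : ∀ y : EuclideanSpace ℝ (Fin n),
        y ∉ (unitBall n : Set (EuclideanSpace ℝ (Fin n))) → 1 ≤ ‖y‖ := fun y hy => by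
      simpa [unitBall] using hy
    rw [e1, e2, setIntegral_eq_integral_of_forall_compl_eq_zero fun y hy => ?_,
      setIntegral_eq_integral_of_forall_compl_eq_zero fun y hy => ?_]
    · exact hparts f (by rw [hlen]; exact f.contDiff)
    · rw [f.apply_eq_zero (hnorm y hy), zero_mul]
    · have hφy : φ y = 0 := image_eq_zero_of_notMem_tsupport fun h => hy (hφs h).1
      rw [hφy, Complex.ofReal_zero, mul_zero]

/-- If x is mapped to 0, its weighted derivatives divided by w annihilate all test functions on the
punctured ball, hence vanish almost everywhere. The puncture keeps w⁻¹ continuous and costs only a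
null set; the isometry by weighted derivatives then gives x = 0. -/
theorem injective_embedding (hn : 1 ≤ n) (hσ : 0 < σ) :
    Function.Injective (embedding n m p σ) := by
  have hp1 : (1 : ℝ≥0∞) ≤ p := Fact.out
  rw [injective_iff_map_eq_zero]
  intro x hx
  refine eq_zero_of_weightedDeriv_eq_zero fun α => ?_
  set U : Set (EuclideanSpace ℝ (Fin n)) := Metric.ball 0 1 \ {0} with hU
  have hUo : IsOpen U := Metric.isOpen_ball.sdiff isClosed_singleton
  have hloc : LocallyIntegrableOn
      (fun y => (radialWeight n m σ y)⁻¹ • weightedDeriv α x y) U (ballMeasure n) := by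
    refine LocallyIntegrableOn.continuousOn_smul hUo.isLocallyClosed ?_ ?_
    · exact ((Lp.memLp (weightedDeriv α x)).integrable hp1).locallyIntegrable.locallyIntegrableOn U
    · exact (continuousOn_radialWeight.mono fun y hy => hy.2).inv₀ fun y hy =>
        (radialWeight_pos hy.2).ne'
  have hae := hUo.ae_eq_zero_of_integral_contDiff_smul_eq_zero hloc fun φ hφ hφc hφs => by
    obtain ⟨ψ, hψ⟩ := exists_integral_weightedDeriv_eq hn hσ α (m := m) (p := p) hφ hφc hφs
    have h1 := hψ x
    rw [hx] at h1
    have h2 : ∫ y, (0 : LpBall n p) y * ψ y ∂(ballMeasure n) = 0 := by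
      refine integral_eq_zero_of_ae ?_
      filter_upwards [Lp.coeFn_zero ℂ (p : ℝ≥0∞) (ballMeasure n)] with y hy
      rw [hy, Pi.zero_apply, zero_mul]
    rw [h2] at h1
    rw [← h1]
    refine integral_congr_ae (ae_of_all _ fun y => ?_)
    simp only [Complex.real_smul]
    push_cast
    ring
  have : Nonempty (Fin n) := ⟨⟨0, hn⟩⟩
  filter_upwards [hae, ae_restrict_mem (unitBall n).isOpen.measurableSet,
    ae_restrict_of_ae (Measure.ae_ne volume (0 : EuclideanSpace ℝ (Fin n)))] with y h1 h2 h3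
  have h4 := h1 ⟨h2, h3⟩
  rwa [smul_eq_zero_iff_right (inv_ne_zero (radialWeight_pos h3).ne')] at h4

end Injectivity

/-! ### Approximation numbers and compactness. -/

section ApproximationNumber

variable {X Y : Type} [NormedAddCommGroup X] [NormedSpace ℂ X] [NormedAddCommGroup Y]
  [NormedSpace ℂ Y]

theorem approximationNumber_le {T S : X →L[ℂ] Y} {k : ℕ}
    (hS : (S : X →ₗ[ℂ] Y).rank < (k : Cardinal)) : approximationNumber T k ≤ ‖T - S‖ :=
  csInf_le ⟨0, by rintro r ⟨S, -, rfl⟩; exact norm_nonneg _⟩ ⟨S, hS, rfl⟩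

/-- For k ≥ 1 the zero operator is admissible, so the infimum is not the default value 0 of `sInf
∅`. -/
theorem le_approximationNumber {T : X →L[ℂ] Y} {k : ℕ} (hk : 1 ≤ k) {r : ℝ}
    (h : ∀ S : X →L[ℂ] Y, (S : X →ₗ[ℂ] Y).rank < (k : Cardinal) → r ≤ ‖T - S‖) :
    r ≤ approximationNumber T k := by
  refine le_csInf ⟨‖T - 0‖, 0, ?_, rfl⟩ ?_
  · have : ((0 : X →L[ℂ] Y) : X →ₗ[ℂ] Y) = 0 := rfl
    rw [this, LinearMap.rank_zero]
    exact_mod_cast hk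
  · rintro _ ⟨S, hS, rfl⟩
    exact h S hS

theorem isCompactOperator_of_rank_lt_aleph0 {S : X →L[ℂ] Y}
    (hS : (S : X →ₗ[ℂ] Y).rank < Cardinal.aleph0) : IsCompactOperator S := by
  have : FiniteDimensional ℂ (LinearMap.range (S : X →ₗ[ℂ] Y)) :=
    Module.rank_lt_aleph0_iff.1 hS
  have : ProperSpace (LinearMap.range (S : X →ₗ[ℂ] Y)) := FiniteDimensional.proper ℂ _
  have h : IsCompactOperator
      (S.codRestrict (LinearMap.range (S : X →ₗ[ℂ] Y)) fun x => ⟨x, rfl⟩) :=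
    isCompactOperator_of_locallyCompactSpace_dom _
  exact h.clm_comp (LinearMap.range (S : X →ₗ[ℂ] Y)).subtypeL

/-- An operator which is a limit of finite rank operators is compact. -/
theorem isCompactOperator_of_forall_exists_rank_lt [CompleteSpace Y] {T : X →L[ℂ] Y}
    (h : ∀ ε > 0, ∃ S : X →L[ℂ] Y, (S : X →ₗ[ℂ] Y).rank < Cardinal.aleph0 ∧ ‖T - S‖ < ε) :
    IsCompactOperator T := by
  have hcl : IsClosed {S : X →L[ℂ] Y | IsCompactOperator S} :=
    isClosed_setOfPred_isCompactOperator
  refine hcl.closure_subset (Metric.mem_closure_iff.2 fun ε hε => ?_)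
  obtain ⟨S, hS, hST⟩ := h ε hε
  exact ⟨S, isCompactOperator_of_rank_lt_aleph0 hS, by rwa [dist_eq_norm]⟩

end ApproximationNumber

/-! ### Partial sums of (1 + j)^(-s). -/

section PowerSums

/-- The induction step is Bernoulli's inequality with exponent 1 - s at -1/(1 + J), that is J^(1-s)
≤ (1 + J)^(1-s) - (1 - s)(1 + J)^(-s). -/
theorem sum_range_rpow_neg_le {s : ℝ} (hs0 : 0 ≤ s) (hs1 : s < 1) (J : ℕ) :
    ∑ j ∈ Finset.range J, (1 + j : ℝ) ^ (-s) ≤ (J : ℝ) ^ (1 - s) / (1 - s) := by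
  have h1 : 0 < 1 - s := sub_pos.2 hs1
  induction J with
  | zero => simp [Real.zero_rpow h1.ne']
  | succ J ih =>
    rw [Finset.sum_range_succ]
    refine (add_le_add_left ih _).trans ?_
    have hJ : (0 : ℝ) < 1 + J := by positivity
    have hb := rpow_one_add_le_one_add_mul_self (s := -(1 / (1 + J : ℝ))) (p := 1 - s)
      (by rw [neg_le_neg_iff, div_le_one hJ]; linarith [(Nat.cast_nonneg J : (0 : ℝ) ≤ J)])
      h1.le (by linarith)
    have he : 1 + -(1 / (1 + J : ℝ)) = J / (1 + J) := by field_simp; ring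
    rw [he, Real.div_rpow (Nat.cast_nonneg J) hJ.le, div_le_iff₀ (by positivity)] at hb
    have hp : (1 + J : ℝ) ^ (1 - s) = (1 + J) * (1 + J : ℝ) ^ (-s) := by
      rw [sub_eq_add_neg, Real.rpow_add hJ, Real.rpow_one]
    have hc : ((J + 1 : ℕ) : ℝ) = 1 + J := by push_cast; ring
    rw [hc, div_add' _ _ _ h1.ne', div_le_div_iff_of_pos_right h1]
    have : (1 + (1 - s) * -(1 / (1 + J : ℝ))) * (1 + J : ℝ) ^ (1 - s) =
        (1 + J : ℝ) ^ (1 - s) - (1 - s) * (1 + J : ℝ) ^ (-s) := by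
      rw [hp]; field_simp; ring
    linarith

theorem sum_range_inv_le_one_add_log {J : ℕ} {x : ℝ} (hx : 1 ≤ x) (hJ : (J : ℝ) ≤ x) :
    ∑ j ∈ Finset.range J, (1 + j : ℝ)⁻¹ ≤ 1 + Real.log x := by
  rcases J.eq_zero_or_pos with rfl | hpos
  · simpa using add_nonneg zero_le_one (Real.log_nonneg hx)
  have h := harmonic_le_one_add_log J
  have e : ((harmonic J : ℚ) : ℝ) = ∑ j ∈ Finset.range J, (1 + j : ℝ)⁻¹ := by
    simp [harmonic, add_comm]
  rw [← e]
  have : (0 : ℝ) < J := by exact_mod_cast hpos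
  linarith [Real.log_le_log this hJ]

theorem log_le_sum_range_inv {x : ℝ} (hx : 0 < x) :
    Real.log x ≤ ∑ j ∈ Finset.range ⌊x⌋₊, (1 + j : ℝ)⁻¹ := by
  have h := log_add_one_le_harmonic ⌊x⌋₊
  have e : ((harmonic ⌊x⌋₊ : ℚ) : ℝ) = ∑ j ∈ Finset.range ⌊x⌋₊, (1 + j : ℝ)⁻¹ := by
    simp [harmonic, add_comm]
  rw [← e]
  refine (Real.log_le_log hx ?_).trans h
  push_cast
  exact (Nat.lt_floor_add_one x).le

theorem exists_sum_range_rpow_neg_le {s : ℝ} (hs : 1 < s) :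
    ∃ Z : ℝ, 0 < Z ∧ ∀ J : ℕ, ∑ j ∈ Finset.range J, (1 + j : ℝ) ^ (-s) ≤ Z := by
  have h : Summable fun j : ℕ => (1 + j : ℝ) ^ (-s) := by
    have := (summable_nat_add_iff 1).2 (Real.summable_nat_rpow.2 (neg_lt_neg hs))
    simpa [add_comm] using this
  refine ⟨(∑' j : ℕ, (1 + j : ℝ) ^ (-s)) + 1, ?_, fun J => ?_⟩
  · exact add_pos_of_nonneg_of_pos (tsum_nonneg fun j => by positivity) one_pos
  · exact (h.sum_le_tsum _ fun j _ => by positivity).trans (by linarith)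

end PowerSums

/-! ### Compactness and the three asymptotic regimes. -/

section Asymptotics

variable {n m : ℕ} [NeZero m] {p : ℝ≥0} [Fact (1 ≤ (p : ℝ≥0∞))] {σ : ℝ}

/-- Only a finite rank is required here, so the same large number M of subdivisions serves in every
shell. -/
theorem isCompactOperator_embedding (hn : 1 ≤ n) (hσ : 0 < σ) :
    IsCompactOperator (embedding n m p σ) := by
  refine isCompactOperator_of_forall_exists_rank_lt fun ε hε => ?_
  obtain ⟨C, hC, D, -, h⟩ := exists_graded_approx n m p σ hn hσ
  obtain ⟨K, hK⟩ := exists_gt (max (C / ε) 0)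
  have hK0 : 0 < K := (le_max_right _ _).trans_lt hK
  have hm : m ≠ 0 := NeZero.ne m
  have h1 : ∀ j : ℕ, (1 : ℝ) ≤ (1 + j : ℝ) ^ σ := fun j =>
    Real.one_le_rpow (by simp) hσ.le
  obtain ⟨J, hJ⟩ := exists_nat_ge (K ^ σ⁻¹)
  obtain ⟨M, hM⟩ := exists_nat_ge (max K 1)
  have hM1 : (1 : ℝ) ≤ M := (le_max_right _ _).trans hM
  obtain ⟨S, hS, hST⟩ := h J (fun _ => M) K hK0 (fun _ _ => by exact_mod_cast hM1)
    (fun j _ => ((le_max_left _ _).trans hM).trans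
      ((le_self_pow₀ hM1 hm).trans (le_mul_of_one_le_right (by positivity) (h1 j))))
    (by
      have h2 : K ^ σ⁻¹ ≤ 1 + J := hJ.trans (by linarith)
      have h3 := Real.rpow_le_rpow (by positivity) h2 hσ.le
      rwa [← Real.rpow_mul hK0.le, inv_mul_cancel₀ hσ.ne', Real.rpow_one] at h3)
  refine ⟨S, hS.trans_lt (Cardinal.natCast_lt_aleph0), hST.trans_lt ?_⟩
  rw [div_lt_iff₀ hK0, ← div_lt_iff₀' hε]
  exact (le_max_left _ _).trans_lt hK

/-- Upper bounds for the approximation numbers, with the parameters of the graded approximation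
chosen optimally. -/
theorem exists_approximationNumber_le (n m : ℕ) [NeZero m] (p : ℝ≥0) [Fact (1 ≤ (p : ℝ≥0∞))]
    (σ : ℝ) (hn : 1 ≤ n) (hσ : 0 < σ) :
    ∃ C : ℝ, 0 < C ∧ ∃ E : ℝ, 0 < E ∧ ∀ x : ℝ, 0 < x → ∀ k : ℕ,
      (∀ J : ℕ, (J : ℝ) ≤ x →
        E * (x ^ (σ * n / m) * ∑ j ∈ Finset.range J, (1 + j : ℝ) ^ (-(σ * n / m))) < k) →
      approximationNumber (embedding n m p σ) k ≤ C * x ^ (-σ) := by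
  obtain ⟨C, hC, D, hD, h⟩ := exists_graded_approx n m p σ hn hσ
  have hm : (m : ℝ) ≠ 0 := Nat.cast_ne_zero.2 (NeZero.ne m)
  refine ⟨C, hC, D * 2 ^ n, by positivity, fun x hx k hk => ?_⟩
  -- t_j solves t_j^m (1 + j)^σ = x^σ. With J = ⌈x⌉ - 1, every j < J has 1 + j < x, so t_j ≥ 1 and
  -- ⌈t_j⌉ ≤ 2 t_j, whence the factor 2^n; and 1 + J ≥ x.
  set t : ℕ → ℝ := fun j => (x / (1 + j)) ^ (σ / m) with ht
  have hceil : 0 < ⌈x⌉₊ := Nat.ceil_pos.2 hx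
  have hlt : ∀ j < ⌈x⌉₊ - 1, (1 + j : ℝ) < x := fun j hj => by
    have : 1 + j < ⌈x⌉₊ := by omega
    exact_mod_cast Nat.lt_ceil.1 this
  have ht1 : ∀ j < ⌈x⌉₊ - 1, 1 ≤ t j := fun j hj =>
    Real.one_le_rpow ((one_le_div (by positivity)).2 (hlt j hj).le) (by positivity)
  have htm : ∀ j, t j ^ m * (1 + j : ℝ) ^ σ = x ^ σ := fun j => by
    rw [ht, ← Real.rpow_natCast, ← Real.rpow_mul (by positivity), div_mul_cancel₀ _ hm,
      Real.div_rpow hx.le (by positivity), div_mul_cancel₀ _ (by positivity)]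
  have htn : ∀ j, t j ^ n = x ^ (σ * n / m) * (1 + j : ℝ) ^ (-(σ * n / m)) := fun j => by
    rw [ht, ← Real.rpow_natCast, ← Real.rpow_mul (by positivity), div_mul_eq_mul_div,
      Real.div_rpow hx.le (by positivity), Real.rpow_neg (by positivity), div_eq_mul_inv]
  obtain ⟨S, hS, hST⟩ := h (⌈x⌉₊ - 1) (fun j => ⌈t j⌉₊) (x ^ σ) (by positivity)
    (fun j hj => Nat.ceil_pos.2 (one_pos.trans_le (ht1 j hj)))
    (fun j _ => by
      rw [← htm j]
      gcongr
      exact Nat.le_ceil _)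
    (by
      gcongr
      have : ((1 + (⌈x⌉₊ - 1) : ℕ) : ℝ) = 1 + (⌈x⌉₊ - 1 : ℕ) := by push_cast; ring
      rw [← this, add_comm, Nat.sub_add_cancel hceil]
      exact Nat.le_ceil x)
  rw [Real.rpow_neg hx.le, ← div_eq_mul_inv]
  refine (approximationNumber_le (hS.trans_lt ?_)).trans hST
  rw [Nat.cast_lt, ← Nat.cast_lt (α := ℝ)]
  refine lt_of_le_of_lt ?_ (hk (⌈x⌉₊ - 1) ?_)
  · push_cast
    rw [mul_assoc]
    refine mul_le_mul_of_nonneg_left ?_ (by positivity)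
    rw [Finset.mul_sum, Finset.mul_sum]
    refine Finset.sum_le_sum fun j hj => ?_
    rw [← htn, ← mul_pow]
    gcongr
    have := Nat.ceil_lt_add_one (zero_le_one.trans (ht1 j (Finset.mem_range.1 hj)))
    linarith [ht1 j (Finset.mem_range.1 hj)]
  · have : ⌈x⌉₊ - 1 < ⌈x⌉₊ := by omega
    exact (Nat.lt_ceil.1 this).le

theorem exists_le_approximationNumber (n m : ℕ) [NeZero m] (p : ℝ≥0) [Fact (1 ≤ (p : ℝ≥0∞))]
    (σ : ℝ) (hn : 1 ≤ n) (hσ : 0 < σ) :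
    ∃ c : ℝ, 0 < c ∧ ∀ (J : ℕ) (M : ℕ → ℕ) (K : ℝ), 0 < K → (∀ j < J, 0 < M j) →
      (∀ j < J, (M j : ℝ) ^ m * (1 + j : ℝ) ^ σ ≤ K) →
      ∀ k : ℕ, 1 ≤ k → k ≤ ∑ j ∈ Finset.range J, M j ^ n →
        c ≤ K * approximationNumber (embedding n m p σ) k := by
  obtain ⟨c, hc, h⟩ := exists_graded_lower_bound n m p σ hn hσ
  refine ⟨c, hc, fun J M K hK h1 h2 k hk hkM => ?_⟩
  rw [← div_le_iff₀' hK]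
  exact le_approximationNumber hk fun S hS =>
    h J M K hK h1 h2 S (hS.trans_le (Nat.cast_le.2 hkM))

theorem equivalentFrom_of_le {k₀ : ℕ} {a b : ℕ → ℝ} {C c : ℝ} (hC : 0 < C) (hc : 0 < c)
    (h₁ : ∀ k ≥ k₀, a k ≤ C * b k) (h₂ : ∀ k ≥ k₀, b k ≤ c * a k) : EquivalentFrom k₀ a b :=
  ⟨C⁻¹, inv_pos.2 hC, c, hc, fun k hk => ⟨(inv_mul_le_iff₀ hC).2 (h₁ k hk), h₂ k hk⟩⟩

/-- Here s > 1 and the sum over shells converges, so the outermost shell dominates: for the lower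
bound a single shell with about k^(1/n) subdivisions suffices. -/
theorem equivalentFrom_of_gt (hn : 1 ≤ n) (hσ : 0 < σ) (h : (m : ℝ) / n < σ) :
    EquivalentFrom 1 (approximationNumber (embedding n m p σ))
      fun k => (k : ℝ) ^ (-((m : ℝ) / n)) := by
  have hm0 : (0 : ℝ) < m := Nat.cast_pos.2 (Nat.pos_of_ne_zero (NeZero.ne m))
  have hn0 : (0 : ℝ) < n := by exact_mod_cast hn
  obtain ⟨C, hC, E, hE, hup⟩ := exists_approximationNumber_le n m p σ hn hσ
  obtain ⟨c, hc, hlow⟩ := exists_le_approximationNumber n m p σ hn hσ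
  have hs : 1 < σ * n / m := by rwa [lt_div_iff₀ hm0, one_mul, ← div_lt_iff₀ hn0]
  obtain ⟨Z, hZ, hsum⟩ := exists_sum_range_rpow_neg_le hs
  refine equivalentFrom_of_le (C := C * (1 / (2 * E * Z)) ^ (-((m : ℝ) / n))) (c := 2 ^ m / c)
    (by positivity) (by positivity) (fun k hk => ?_) fun k hk => ?_
  · have hk0 : (0 : ℝ) < k := by exact_mod_cast hk
    -- This x makes x^s = k/(2EZ), so the rank bound is at most k/2 < k.
    have hx := hup ((1 / (2 * E * Z) * k) ^ ((m : ℝ) / (σ * n))) (by positivity) k fun J _ => by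
      rw [← Real.rpow_mul (by positivity)]
      have e : (m : ℝ) / (σ * n) * (σ * n / m) = 1 := by field_simp
      rw [e, Real.rpow_one]
      calc E * (1 / (2 * E * Z) * k * ∑ j ∈ Finset.range J, (1 + j : ℝ) ^ (-(σ * n / m)))
          ≤ E * (1 / (2 * E * Z) * k * Z) := by gcongr; exact hsum J
        _ = k / 2 := by field_simp
        _ < k := by linarith
    rw [← Real.rpow_mul (by positivity)] at hx
    have e : (m : ℝ) / (σ * n) * -σ = -((m : ℝ) / n) := by field_simp
    rw [e, Real.mul_rpow (by positivity) hk0.le, ← mul_assoc] at hx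
    exact hx
  · have hk1 : (1 : ℝ) ≤ k := by exact_mod_cast hk
    have hk0 : (0 : ℝ) < k := by linarith
    set y : ℝ := (k : ℝ) ^ ((1 : ℝ) / n) with hy
    have hy1 : 1 ≤ y := Real.one_le_rpow hk1 (by positivity)
    have hyn : y ^ n = k := by
      rw [hy, ← Real.rpow_natCast, ← Real.rpow_mul hk0.le, one_div_mul_cancel hn0.ne',
        Real.rpow_one]
    have hym : y ^ m = (k : ℝ) ^ ((m : ℝ) / n) := by
      rw [hy, ← Real.rpow_natCast, ← Real.rpow_mul hk0.le, one_div_mul_eq_div]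
    have hM : 0 < ⌈y⌉₊ := Nat.ceil_pos.2 (by linarith)
    have hM2 : (⌈y⌉₊ : ℝ) ≤ 2 * y := by linarith [Nat.ceil_lt_add_one (a := y) (by linarith)]
    have hl := hlow 1 (fun _ => ⌈y⌉₊) ((⌈y⌉₊ : ℝ) ^ m) (by positivity) (fun _ _ => hM)
      (fun j hj => by
        obtain rfl : j = 0 := by omega
        simp) k hk (by
        rw [Finset.sum_range_one, ← Nat.cast_le (α := ℝ), ← hyn, Nat.cast_pow]
        gcongr
        exact Nat.le_ceil y)
    have ha : 0 ≤ approximationNumber (embedding n m p σ) k :=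
      Real.sInf_nonneg (by rintro r ⟨S, -, rfl⟩; exact norm_nonneg _)
    have hKle : (⌈y⌉₊ : ℝ) ^ m ≤ 2 ^ m * (k : ℝ) ^ ((m : ℝ) / n) := by
      rw [← hym, ← mul_pow]; gcongr
    have h3 := hl.trans (mul_le_mul_of_nonneg_right hKle ha)
    rw [Real.rpow_neg hk0.le, inv_le_iff_one_le_mul₀ (by positivity), div_mul_eq_mul_div,
      div_mul_eq_mul_div, one_le_div hc]
    linarith

/-- Here s < 1 and the total rank is of the order of the number of shells: for the lower bound k
shells with one subdivision each suffice. -/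
theorem equivalentFrom_of_lt (hn : 1 ≤ n) (hσ : 0 < σ) (h : σ < (m : ℝ) / n) :
    EquivalentFrom 1 (approximationNumber (embedding n m p σ)) fun k => (k : ℝ) ^ (-σ) := by
  have hm0 : (0 : ℝ) < m := Nat.cast_pos.2 (Nat.pos_of_ne_zero (NeZero.ne m))
  have hn0 : (0 : ℝ) < n := by exact_mod_cast hn
  obtain ⟨C, hC, E, hE, hup⟩ := exists_approximationNumber_le n m p σ hn hσ
  obtain ⟨c, hc, hlow⟩ := exists_le_approximationNumber n m p σ hn hσ
  have hs : σ * n / m < 1 := by rwa [div_lt_iff₀ hm0, one_mul, ← lt_div_iff₀ hn0]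
  have hs0 : 0 ≤ σ * n / m := by positivity
  set s := σ * n / m
  have h1s : 0 < 1 - s := sub_pos.2 hs
  refine equivalentFrom_of_le (C := C * ((1 - s) / (2 * E)) ^ (-σ)) (c := 1 / c)
    (by positivity) (by positivity) (fun k hk => ?_) fun k hk => ?_
  · have hk0 : (0 : ℝ) < k := by exact_mod_cast hk
    have hx := hup ((1 - s) / (2 * E) * k) (by positivity) k fun J hJ => by
      set x := (1 - s) / (2 * E) * (k : ℝ)
      have hx0 : 0 < x := by positivity
      calc E * (x ^ s * ∑ j ∈ Finset.range J, (1 + j : ℝ) ^ (-s))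
          ≤ E * (x ^ s * (x ^ (1 - s) / (1 - s))) := by
            gcongr
            exact (sum_range_rpow_neg_le hs0 hs J).trans (by gcongr)
        _ = E * (x / (1 - s)) := by
            rw [mul_div_assoc', ← Real.rpow_add hx0, add_sub_cancel, Real.rpow_one]
        _ = k / 2 := by simp only [x]; field_simp
        _ < k := by linarith
    rw [Real.mul_rpow (by positivity) hk0.le, ← mul_assoc] at hx
    exact hx
  · have hk0 : (0 : ℝ) < k := by exact_mod_cast hk
    have hl := hlow k (fun _ => 1) ((k : ℝ) ^ σ) (by positivity) (fun _ _ => one_pos)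
      (fun j hj => by
        rw [Nat.cast_one, one_pow, one_mul]
        gcongr
        exact_mod_cast (by omega : 1 + j ≤ k)) k hk (by simp)
    rw [Real.rpow_neg hk0.le, inv_le_iff_one_le_mul₀ (by positivity), div_mul_eq_mul_div,
      div_mul_eq_mul_div, one_le_div hc]
    linarith

/-- From log x = 2 log √x ≤ 2√x. It shows that the logarithm of k/log k is still of order log k. -/
theorem sqrt_le_div_log {x : ℝ} (hx : 1 < x) : √x ≤ 2 * x / Real.log x := by
  have hl := Real.log_pos hx
  have h1 : Real.log x ≤ 2 * √x := by
    have := Real.log_le_self (Real.sqrt_nonneg x)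
    rw [Real.log_sqrt (by linarith)] at this
    linarith
  rw [le_div_iff₀ hl]
  calc √x * Real.log x ≤ √x * (2 * √x) := by gcongr
    _ = 2 * x := by rw [mul_left_comm, Real.mul_self_sqrt (by linarith)]

theorem equivalentFrom_of_eq (hn : 1 ≤ n) (hσ : 0 < σ) (h : σ = (m : ℝ) / n) :
    EquivalentFrom 2 (approximationNumber (embedding n m p σ)) fun k =>
      (k : ℝ) ^ (-((m : ℝ) / n)) * Real.log k ^ ((m : ℝ) / n) := by
  have hm0 : (0 : ℝ) < m := Nat.cast_pos.2 (Nat.pos_of_ne_zero (NeZero.ne m))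
  have hn0 : (0 : ℝ) < n := by exact_mod_cast hn
  obtain ⟨C, hC, E, hE, hup⟩ := exists_approximationNumber_le n m p σ hn hσ
  obtain ⟨c, hc, hlow⟩ := exists_le_approximationNumber n m p σ hn hσ
  have hs : σ * n / m = 1 := by rw [h]; field_simp
  rw [hs] at hup
  rw [← h]
  have hlog2 : (1 / 2 : ℝ) < Real.log 2 := by linarith [Real.log_two_gt_d9]
  have key : ∀ (A : ℝ) (k : ℕ), 0 < A → 2 ≤ k →
      (A * k / Real.log k) ^ (-σ) = A ^ (-σ) * ((k : ℝ) ^ (-σ) * Real.log k ^ σ) := by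
    intro A k hA hk
    have hl : 0 < Real.log k := Real.log_pos (by exact_mod_cast hk)
    rw [Real.div_rpow (by positivity) hl.le, Real.mul_rpow hA.le (by positivity),
      Real.rpow_neg hl.le, div_inv_eq_mul, mul_assoc]
  -- The bound 1/2 < log 2 ≤ log k gives δk/log k ≤ k, and 1/(4E) compensates (1 + log k)/log k < 4.
  set δ : ℝ := min (1 / 2) (1 / (4 * E)) with hδ
  have hδ0 : 0 < δ := lt_min (by norm_num) (by positivity)
  refine equivalentFrom_of_le (C := C * δ ^ (-σ)) (c := (2 ^ (n + 1)) ^ σ / c)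
    (by positivity) (by positivity) (fun k hk => ?_) fun k hk => ?_
  · have hk2 : (2 : ℝ) ≤ k := by exact_mod_cast hk
    have hl2 : Real.log 2 ≤ Real.log k := Real.log_le_log two_pos hk2
    have hl : 0 < Real.log k := by linarith
    rw [mul_assoc, ← key δ k hδ0 hk]
    refine hup _ (by positivity) k fun J hJ => ?_
    have hxk : δ * k / Real.log k ≤ k := by
      rw [div_le_iff₀ hl, mul_comm]
      gcongr
      exact (min_le_left _ _).trans (by linarith)
    have h4 : E * δ ≤ 1 / 4 := by
      calc E * δ ≤ E * (1 / (4 * E)) := by gcongr; exact min_le_right _ _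
        _ = 1 / 4 := by field_simp
    simp only [Real.rpow_one, Real.rpow_neg_one]
    calc E * (δ * k / Real.log k * ∑ j ∈ Finset.range J, (1 + j : ℝ)⁻¹)
        ≤ E * (δ * k / Real.log k * (1 + Real.log k)) := by
          gcongr
          exact sum_range_inv_le_one_add_log (by linarith) (hJ.trans hxk)
      _ = E * δ * k * ((1 + Real.log k) / Real.log k) := by ring
      _ < E * δ * k * 4 := by
          gcongr
          rw [div_lt_iff₀ hl]; linarith
      _ ≤ 1 / 4 * k * 4 := by gcongr
      _ = k := by ring
  · have hk2 : (2 : ℝ) ≤ k := by exact_mod_cast hk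
    have hk0 : (0 : ℝ) < k := by linarith
    have hl : 0 < Real.log k := Real.log_pos (by linarith)
    -- The factor 2^n makes up for ⌊t_j⌋ ≥ t_j/2, and the further 2 for log x ≥ (log k)/2.
    set x : ℝ := 2 ^ (n + 1) * k / Real.log k with hx
    have hx0 : 0 < x := by positivity
    set t : ℕ → ℝ := fun j => (x / (1 + j)) ^ (1 / (n : ℝ)) with ht
    have ht1 : ∀ j < ⌊x⌋₊, 1 ≤ t j := fun j hj => by
      refine Real.one_le_rpow ((one_le_div (by positivity)).2 ?_) (by positivity)
      have : ((1 + j : ℕ) : ℝ) ≤ x := (Nat.le_floor_iff hx0.le).1 (by omega)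
      exact_mod_cast this
    have htn : ∀ j, t j ^ n = x * (1 + j : ℝ)⁻¹ := fun j => by
      rw [ht, ← Real.rpow_natCast, ← Real.rpow_mul (by positivity), one_div_mul_cancel hn0.ne',
        Real.rpow_one, div_eq_mul_inv]
    have htm : ∀ j, t j ^ m * (1 + j : ℝ) ^ σ = x ^ σ := fun j => by
      rw [ht, ← Real.rpow_natCast, ← Real.rpow_mul (by positivity), one_div_mul_eq_div, ← h,
        Real.div_rpow hx0.le (by positivity), div_mul_cancel₀ _ (by positivity)]
    have hlogx : Real.log k / 2 ≤ Real.log x := by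
      rw [← Real.log_sqrt hk0.le]
      refine Real.log_le_log (Real.sqrt_pos.2 hk0) ((sqrt_le_div_log (by linarith)).trans ?_)
      rw [hx]
      gcongr
      exact le_self_pow₀ one_le_two (by omega)
    have hl := hlow ⌊x⌋₊ (fun j => ⌊t j⌋₊) (x ^ σ) (by positivity)
      (fun j hj => Nat.floor_pos.2 (ht1 j hj))
      (fun j _ => by
        rw [← htm j]
        gcongr
        exact Nat.floor_le (by positivity)) k (by omega) (by
        rw [← Nat.cast_le (α := ℝ)]
        push_cast
        calc (k : ℝ) = (1 / 2) ^ n * (x * (Real.log k / 2)) := by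
              rw [hx, pow_succ, div_pow, one_pow]; field_simp
          _ ≤ (1 / 2) ^ n * (x * ∑ j ∈ Finset.range ⌊x⌋₊, (1 + j : ℝ)⁻¹) := by
              gcongr
              exact hlogx.trans (log_le_sum_range_inv hx0)
          _ ≤ ∑ j ∈ Finset.range ⌊x⌋₊, (⌊t j⌋₊ : ℝ) ^ n := by
              rw [Finset.mul_sum, Finset.mul_sum]
              refine Finset.sum_le_sum fun j hj => ?_
              rw [← htn, ← mul_pow]
              gcongr
              have h1 := ht1 j (Finset.mem_range.1 hj)
              have h2 : (1 : ℝ) ≤ ⌊t j⌋₊ := by exact_mod_cast Nat.floor_pos.2 h1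
              linarith [Nat.lt_floor_add_one (t j)])
    have e := key (2 ^ (n + 1)) k (by positivity) hk
    rw [← hx, Real.rpow_neg hx0.le, Real.rpow_neg (by positivity)] at e
    have e2 : (k : ℝ) ^ (-σ) * Real.log k ^ σ = (2 ^ (n + 1)) ^ σ / x ^ σ := by
      rw [div_eq_mul_inv, e, mul_inv_cancel_left₀ (by positivity)]
    rw [e2, div_mul_eq_mul_div, div_le_div_iff₀ (by positivity) hc, mul_assoc]
    gcongr
    linarith

end Asymptotics

end

theorem theorem3p6 (n m : ℕ) (hn : 1 ≤ n) [NeZero m] (p : ℝ≥0) [Fact (1 ≤ (p : ℝ≥0∞))]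
    (σ : ℝ) (hσ : 0 < σ) :
    ∃ ι : WeightedSobolev n m p σ →L[ℂ] LpBall n p,
      (∀ f : CompactlySupported n m p σ, ι (f : WeightedSobolev n m p σ) = f.toLpBall) ∧
      Function.Injective ι ∧
      IsCompactOperator ι ∧
      ((m : ℝ) / n < σ →
        EquivalentFrom 1 (approximationNumber ι) fun k => (k : ℝ) ^ (-((m : ℝ) / n))) ∧
      (σ = (m : ℝ) / n →
        EquivalentFrom 2 (approximationNumber ι) fun k =>
          (k : ℝ) ^ (-((m : ℝ) / n)) * Real.log k ^ ((m : ℝ) / n)) ∧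
      (σ < (m : ℝ) / n →
        EquivalentFrom 1 (approximationNumber ι) fun k => (k : ℝ) ^ (-σ)) :=
  ⟨embedding n m p σ, embedding_coe n m p σ hn hσ, injective_embedding hn hσ,
    isCompactOperator_embedding hn hσ, equivalentFrom_of_gt hn hσ, equivalentFrom_of_eq hn hσ,
    equivalentFrom_of_lt hn hσ⟩
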